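/- Let $(\Omega,\mathcal F)$ be a measurable space and $(\Omega,\mathcal H,\mathbb E)$ a sublinear expectation space: $\mathcal H$ is a set of real random variables on $(\Omega,\mathcal F)$ that contains $I_A$ for all $A\in\mathcal F$ and contains $\varphi(X_1,\dots,X_n)$ whenever $X_1,\dots,X_n\in\mathcal H$ and $|\varphi(x)-\varphi(y)|\le C(1+|x|^m+|y|^m)|x-y|$ on $\mathbb R^n$ for some $C>0$, $m\in\mathbb N$; and $\mathbb E:\mathcal H\to[-\infty,\infty]$ is monotone, preserves constants, is positively homogeneous, is sub-additive ($\mathbb E[X+Y]\le\mathbb E[X]+\mathbb E[Y]$ unless the right-hand side is of the form $\infty-\infty$), and is countably sub-additive ($\mathbb E X\le\sum_{n}\mathbb E X_n$ whenever $0\le X\le\sum_n X_n$, $X_n\ge0$, $X,X_n\in\mathcal H$). Put $\mathbb V(A)=\mathbb E[I_A]$ for $A\in\mathcal F$ and $C_{\mathbb V}(Y)=\int_0^\infty\mathbb V(Y>x)\,dx+\int_{-\infty}^0(\mathbb V(Y>x)-1)\,dx$. A random vector $\mathbf Y$ with components in $\mathcal H$ is independent of such a vector $\mathbf X$ if, for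 each Borel function $\psi$ with $\psi(\mathbf X,\mathbf Y)\in\mathcal H$ and $\psi(\mathbf x,\mathbf Y)\in\mathcal H$ for all $\mathbf x$, $\mathbb E[\psi(\mathbf X,\mathbf Y)]=\mathbb E\big[\mathbb E[\psi(\mathbf x,\mathbf Y)]|_{\mathbf x=\mathbf X}\big]$ whenever $\bar\psi(\mathbf x):=\mathbb E|\psi(\mathbf x,\mathbf Y)|<\infty$ for all $\mathbf x$ and $\mathbb E|\bar\psi(\mathbf X)|<\infty$ (both $\bar\psi(\mathbf X)$ and $\mathbb E[\psi(\mathbf x,\mathbf Y)]|_{\mathbf x=\mathbf X}$ being in $\mathcal H$). Random variables $X,Y\in\mathcal H$ are identically distributed if $\mathbb E[\psi(X)]=\mathbb E[\psi(Y)]$ for every Borel $\psi$ with $\psi(X),\psi(Y)\in\mathcal H$ for which both expectations are finite. Let $X\in\mathcal H$, and let $X_1,X_2,\dots\in\mathcal H$ be such that $X_{n+1}$ is independent of $(X_1,\dots,X_n)$ for every $n\ge1$ and each $X_n$ is identically distributed as $X$. Let $r>1$, $q>\frac12$, $-q<\beta<-q/r$, $p>0$, and suppose that $\mathbb E X=-\mathbb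 E(-X)=0$ in case $\frac12<q\le1$. Let $(a_{ni})_{1\le i\le n,\,n\ge1}$ be real numbers with $a_{ni}\approx(i/n)^\beta n^{-q}$, that is, there are $C>0$ and $N$ with $a_{ni}\le C(i/n)^\beta n^{-q}$ and $(i/n)^\beta n^{-q}\le C a_{ni}$ for all $n\ge N$, $1\le i\le n$. Then $$\sum_{n=1}^\infty n^{r-2}\,C_{\mathbb V}\Big(\Big(\max_{1\le k\le n}\Big|\sum_{i=1}^k a_{ni}X_i\Big|^p-\epsilon\Big)^+\Big)<\infty\quad\text{for all }\epsilon>0$$ if and only if $$\begin{cases}C_{\mathbb V}(|X|^p)<\infty,&\text{if }p>(r-1)/(q+\beta),\\ C_{\mathbb V}\big(|X|^{(r-1)/(q+\beta)}\ln|X|\big)<\infty,&\text{if }p=(r-1)/(q+\beta),\\ C_{\mathbb V}\big(|X|^{(r-1)/(q+\beta)}\big)<\infty,&\text{if }p<(r-1)/(q+\beta),\end{cases}$$ where $|X|^{s}\ln|X|$ is read as $0$ where $X=0$. -/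

import Mathlib

open scoped ENNReal

noncomputable section

/-- The class of locally Lipschitz functions of polynomial growth on `ℝⁿ`:
`|φ x - φ y| ≤ C (1 + |x|^m + |y|^m) |x - y|` for some `C > 0`, `m ∈ ℕ` depending on `φ`.
All norms on `ℝⁿ` give the same class; the sup norm of `Fin n → ℝ` is used. -/
def IsLocLip {n : ℕ} (φ : (Fin n → ℝ) → ℝ) : Prop :=
  ∃ C : ℝ, 0 < C ∧ ∃ m : ℕ, ∀ x y : Fin n → ℝ,
    |φ x - φ y| ≤ C * (1 + ‖x‖ ^ m + ‖y‖ ^ m) * ‖x - y‖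

/-- A sublinear expectation space `(Ω, H, E)` whose expectation is countably sub-additive.
`H` is a set of random variables that contains all indicators and is stable under locally
Lipschitz functions of polynomial growth. Only the values of `E` on `H` are meaningful: every
law is stated for members of `H`, and `E` is only ever applied to members of `H`. -/
structure SublinearExpectationSpace (Ω : Type*) [MeasurableSpace Ω] where
  /-- The random variables of the space. -/
  H : Set (Ω → ℝ)
  /-- The sublinear expectation, with values in `[-∞, ∞]`. -/
  E : (Ω → ℝ) → EReal
  measurable_of_mem : ∀ X ∈ H, Measurable X
  indicator_mem : ∀ A : Set Ω, MeasurableSet A → A.indicator (fun _ => (1 : ℝ)) ∈ H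
  comp_mem : ∀ (n : ℕ) (X : Fin n → Ω → ℝ), (∀ i, X i ∈ H) →
    ∀ φ : (Fin n → ℝ) → ℝ, IsLocLip φ → (fun ω => φ (fun i => X i ω)) ∈ H
  /-- Monotonicity. -/
  mono : ∀ X ∈ H, ∀ Y ∈ H, (∀ ω, Y ω ≤ X ω) → E Y ≤ E X
  /-- Constants are preserved. -/
  const : ∀ c : ℝ, E (fun _ => c) = (c : EReal)
  /-- Positive homogeneity. -/
  pos_homog : ∀ X ∈ H, ∀ c : ℝ, 0 ≤ c → E (fun ω => c * X ω) = (c : EReal) * E X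
  /-- Sub-additivity, whenever the right-hand side is not of the form `∞ - ∞` or `-∞ + ∞`. -/
  subadd : ∀ X ∈ H, ∀ Y ∈ H, ¬ (E X = ⊤ ∧ E Y = ⊥) → ¬ (E X = ⊥ ∧ E Y = ⊤) →
    E (fun ω => X ω + Y ω) ≤ E X + E Y
  /-- Countable sub-additivity for non-negative variables. The pointwise series may be infinite;
  the expectations involved are non-negative, so that `toENNReal` does not change them. -/
  countable_subadd : ∀ X ∈ H, ∀ Y : ℕ → Ω → ℝ, (∀ n, Y n ∈ H) →
    (∀ ω, 0 ≤ X ω) → (∀ n ω, 0 ≤ Y n ω) →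
    (∀ ω, ENNReal.ofReal (X ω) ≤ ∑' n, ENNReal.ofReal (Y n ω)) →
    (E X).toENNReal ≤ ∑' n, (E (Y n)).toENNReal

namespace SublinearExpectationSpace

variable {Ω : Type*} [MeasurableSpace Ω]

/-- The capacity `V(A) = E[I_A]` of a measurable set `A`, a number in `[0, 1]`. -/
def V (S : SublinearExpectationSpace Ω) (A : Set Ω) : ℝ≥0∞ :=
  (S.E (A.indicator (fun _ => (1 : ℝ)))).toENNReal

/-- The Choquet expectation
`∫_0^∞ V(Y > x) dx + ∫_{-∞}^0 (V(Y > x) - 1) dx` of a measurable `Y`, with values in `[-∞, ∞]`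
(meaningful unless both integrals are infinite, which cannot happen if `Y` is bounded below). -/
def choquet (S : SublinearExpectationSpace Ω) (Y : Ω → ℝ) : EReal :=
  ((∫⁻ x in Set.Ioi (0 : ℝ), S.V {ω | x < Y ω} : ℝ≥0∞) : EReal) -
    ((∫⁻ x in Set.Iio (0 : ℝ), (1 - S.V {ω | x < Y ω}) : ℝ≥0∞) : EReal)

/-- `Y` is independent of `X`: for Borel `ψ` with `ψ(X, Y), ψ(x, Y) ∈ H` for all `x`,
`E[ψ(X, Y)] = E[E[ψ(x, Y)]|_{x = X}]` whenever `ψ'(x) := E|ψ(x, Y)| < ∞` for all `x` and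
`E|ψ'(X)| < ∞`. The two random variables obtained by substituting `X` for `x` are required to lie
in `H`, which is what gives their expectations a meaning. -/
def IndepOf (S : SublinearExpectationSpace Ω) {m n : ℕ}
    (Y : Fin n → Ω → ℝ) (X : Fin m → Ω → ℝ) : Prop :=
  ∀ ψ : (Fin m → ℝ) × (Fin n → ℝ) → ℝ, Measurable ψ →
    (fun ω => ψ (fun i => X i ω, fun j => Y j ω)) ∈ S.H →
    (∀ x, (fun ω => ψ (x, fun j => Y j ω)) ∈ S.H) →
    (∀ x, S.E (fun ω => |ψ (x, fun j => Y j ω)|) < ⊤) →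
    (fun ω => (S.E (fun ω' => |ψ (fun i => X i ω, fun j => Y j ω')|)).toReal) ∈ S.H →
    S.E (fun ω => |(S.E (fun ω' => |ψ (fun i => X i ω, fun j => Y j ω')|)).toReal|) < ⊤ →
    (fun ω => (S.E (fun ω' => ψ (fun i => X i ω, fun j => Y j ω'))).toReal) ∈ S.H →
    S.E (fun ω => ψ (fun i => X i ω, fun j => Y j ω)) =
      S.E (fun ω => (S.E (fun ω' => ψ (fun i => X i ω, fun j => Y j ω'))).toReal)

/-- `X₁, X₂, …` is a sequence of independent random variables: `X_{n+1}` is independent of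
`(X₁, …, X_n)` for each `n ≥ 1` (the variable with index `0` plays no role). -/
def IndepSeq (S : SublinearExpectationSpace Ω) (X : ℕ → Ω → ℝ) : Prop :=
  ∀ n : ℕ, 1 ≤ n →
    S.IndepOf (fun _ : Fin 1 => X (n + 1)) (fun i : Fin n => X ((i : ℕ) + 1))

/-- `X` and `Y` are identically distributed: `E[ψ(X)] = E[ψ(Y)]` for every Borel `ψ` with
`ψ(X), ψ(Y) ∈ H` whenever both expectations are finite. -/
def IdentDistrib (S : SublinearExpectationSpace Ω) (X Y : Ω → ℝ) : Prop :=
  ∀ ψ : ℝ → ℝ, Measurable ψ → (fun ω => ψ (X ω)) ∈ S.H → (fun ω => ψ (Y ω)) ∈ S.H →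
    S.E (fun ω => ψ (X ω)) ≠ ⊤ → S.E (fun ω => ψ (X ω)) ≠ ⊥ →
    S.E (fun ω => ψ (Y ω)) ≠ ⊤ → S.E (fun ω => ψ (Y ω)) ≠ ⊥ →
    S.E (fun ω => ψ (X ω)) = S.E (fun ω => ψ (Y ω))

end SublinearExpectationSpace

/-- `a_{ni} ≪ b_{ni}` for triangular arrays: `a_{ni} ≤ C b_{ni}` for all `1 ≤ i ≤ n` and all
sufficiently large `n`, with a constant `C > 0`. -/
def ArrayLL (a b : ℕ → ℕ → ℝ) : Prop :=
  ∃ C : ℝ, 0 < C ∧ ∃ N : ℕ, ∀ n, N ≤ n → ∀ i, 1 ≤ i → i ≤ n → a n i ≤ C * b n i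

/-- `a_{ni} ≈ b_{ni}` for triangular arrays. -/
def ArrayApprox (a b : ℕ → ℕ → ℝ) : Prop :=
  ArrayLL a b ∧ ArrayLL b a

/-- `max_{1 ≤ k ≤ n} |∑_{i=1}^k a_{ni} X_i|^p` for `n ≥ 1`. -/
def maxPartialSumPow {Ω : Type*} (a : ℕ → ℕ → ℝ) (X : ℕ → Ω → ℝ) (p : ℝ) (n : ℕ+) (ω : Ω) : ℝ :=
  (Finset.Icc 1 (n : ℕ)).sup' ⟨1, Finset.mem_Icc.mpr ⟨le_refl 1, n.pos⟩⟩
    (fun k => |∑ i ∈ Finset.Icc 1 k, a n i * X i ω| ^ p)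

end

noncomputable section

open MeasureTheory Set Filter Topology

namespace SublinearExpectationSpace

variable {Ω : Type*} [MeasurableSpace Ω] (S : SublinearExpectationSpace Ω)

/-! ### Closure properties of the space of random variables -/

/-! Write α = q + β, s = (r - 1) / α and G(v) = V(|X| > v). Both sides of the equivalence are
statements about tail integrals. The substitution x = u ^ p - ε turns each Choquet expectation of
the series into the integral of p u ^ (p - 1) V(max > u) over u > ε ^ (1 / p)
(`choquet_maxPartialSumPow_toENNReal`), and the three moment conditions together say that z ^ (p -
1) W(z) G(z) is integrable on z > 1, where W is 1, 1 + log z or z ^ (s - p) according to the sign of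
s - p (`moment_conditions_iff`).

Necessity: the maximum dominates its first term, and a_{n1} is at least a constant times n ^ (-α).
After rescaling and Tonelli, w ^ (p - 1) G(w) is multiplied by the sum of n ^ (α (s - p) - 1) over n
< w ^ (1 / α), whose order is W(w) (`tailMoment_lt_top_of_tsum`).

Sufficiency rests on a Fuk–Nagaev inequality (`IndepSeq.V_lt_abs_partialSum_le`): V(max > u) is at
most the sum over i of V(|a_{ni} X| > u / K) plus a constant times Λ ^ (K / 4), where Λ is of order
u ^ (-m) ∑ |a_{ni}| ^ m. It comes from truncating the summands and applying a maximal inequality for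
a stopped exponential supermartingale (`IndepSeq.V_maximal_le`), with exponential moments controlled
by the tail of X (`E_exp_truncate_le`). The exponent m is taken slightly above 1 / q. The condition
β < -q / r says exactly that 1 / q < s, so X has a tail of order v ^ (-m), and q m > 1 makes ∑
|a_{ni}| ^ m decay like a power of n (`exists_sum_weight_rpow_le`). For q ≤ 1 one needs m > 1, which
is why the mean must vanish; q > 1 / 2 keeps m < 2. A large K makes the remainder series converge
(`tsum_remainder_lt_top`), while the single-summand terms add up to the weighted tail integral by
the kernel estimate `exists_kernel_le`, where β s < -1 gives summability over i. -/

theorem const_mem (c : ℝ) : (fun _ => c) ∈ S.H :=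
  S.comp_mem 0 (fun i => i.elim0) (fun i => i.elim0) (fun _ => c)
    ⟨1, one_pos, 0, fun x y => by simp only [sub_self, abs_zero]; positivity⟩

variable {S}

theorem comp_lipschitz_mem {X : Ω → ℝ} (hX : X ∈ S.H) {f : ℝ → ℝ} {K : ℝ}
    (hf : ∀ x y, |f x - f y| ≤ K * |x - y|) : (fun ω => f (X ω)) ∈ S.H := by
  refine S.comp_mem 1 (fun _ => X) (fun _ => hX) (fun x => f (x 0)) ⟨|K| + 1, by positivity, 0, ?_⟩
  intro x y
  have h1 : |x 0 - y 0| ≤ ‖x - y‖ := norm_le_pi_norm (x - y) 0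
  have h2 := hf (x 0) (y 0)
  have h3 : K * |x 0 - y 0| ≤ (|K| + 1) * ‖x - y‖ := by
    apply mul_le_mul _ h1 (abs_nonneg _) (by positivity)
    linarith [le_abs_self K]
  have h4 : 0 ≤ (|K| + 1) * ‖x - y‖ := by positivity
  simp only [pow_zero]
  nlinarith

theorem add_mem {X Y : Ω → ℝ} (hX : X ∈ S.H) (hY : Y ∈ S.H) : (fun ω => X ω + Y ω) ∈ S.H := by
  refine S.comp_mem 2 ![X, Y] ?_ (fun x => x 0 + x 1) ⟨1, one_pos, 0, ?_⟩
  · intro i; fin_cases i <;> assumption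
  intro x y
  have h1 : |x 0 - y 0| ≤ ‖x - y‖ := norm_le_pi_norm (x - y) 0
  have h2 : |x 1 - y 1| ≤ ‖x - y‖ := norm_le_pi_norm (x - y) 1
  have h3 : |x 0 + x 1 - (y 0 + y 1)| ≤ |x 0 - y 0| + |x 1 - y 1| := by
    rw [add_sub_add_comm]; exact abs_add_le _ _
  simp only [pow_zero]
  have := norm_nonneg (x - y)
  linarith

theorem mul_mem {X Y : Ω → ℝ} (hX : X ∈ S.H) (hY : Y ∈ S.H) : (fun ω => X ω * Y ω) ∈ S.H := by
  refine S.comp_mem 2 ![X, Y] ?_ (fun x => x 0 * x 1) ⟨1, one_pos, 1, ?_⟩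
  · intro i; fin_cases i <;> assumption
  intro x y
  have h1 : |x 0 - y 0| ≤ ‖x - y‖ := norm_le_pi_norm (x - y) 0
  have h2 : |x 1 - y 1| ≤ ‖x - y‖ := norm_le_pi_norm (x - y) 1
  have h3 : |x 0 * x 1 - y 0 * y 1| ≤ |x 0| * |x 1 - y 1| + |y 1| * |x 0 - y 0| := by
    rw [← abs_mul, ← abs_mul]
    refine le_trans (le_of_eq ?_) (abs_add_le _ _)
    congr 1; ring
  have h4 : |x 0| ≤ ‖x‖ := norm_le_pi_norm x 0
  have h5 : |y 1| ≤ ‖y‖ := norm_le_pi_norm y 1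
  have h6 : |x 0| * |x 1 - y 1| ≤ ‖x‖ * ‖x - y‖ := by gcongr
  have h7 : |y 1| * |x 0 - y 0| ≤ ‖y‖ * ‖x - y‖ := by gcongr
  simp only [pow_one]
  have := norm_nonneg (x - y)
  linarith

theorem smul_mem {X : Ω → ℝ} (hX : X ∈ S.H) (c : ℝ) : (fun ω => c * X ω) ∈ S.H :=
  mul_mem (S.const_mem c) hX

theorem neg_mem {X : Ω → ℝ} (hX : X ∈ S.H) : (fun ω => -X ω) ∈ S.H := by
  simpa using smul_mem hX (-1)

theorem sum_mem {ι : Type*} {s : Finset ι} {X : ι → Ω → ℝ} (hX : ∀ i ∈ s, X i ∈ S.H) :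
    (fun ω => ∑ i ∈ s, X i ω) ∈ S.H := by
  classical
  induction s using Finset.induction_on with
  | empty => simpa using S.const_mem 0
  | insert a s ha ih =>
    simp only [Finset.sum_insert ha]
    exact add_mem (hX a (Finset.mem_insert_self a s))
      (ih fun i hi => hX i (Finset.mem_insert_of_mem hi))

theorem abs_mem {X : Ω → ℝ} (hX : X ∈ S.H) : (fun ω => |X ω|) ∈ S.H :=
  comp_lipschitz_mem (f := fun x => |x|) (K := 1) hX fun x y => by
    simpa using abs_abs_sub_abs_le_abs_sub x y

/-! ### Rules for the expectation -/

theorem E_nonneg {X : Ω → ℝ} (hX : X ∈ S.H) (h : ∀ ω, 0 ≤ X ω) : 0 ≤ S.E X := by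
  have := S.mono X hX _ (S.const_mem 0) h
  rwa [S.const 0] at this

theorem E_le_of_le {X : Ω → ℝ} (hX : X ∈ S.H) {c : ℝ} (h : ∀ ω, X ω ≤ c) : S.E X ≤ c := by
  rw [← S.const c]
  exact S.mono _ (S.const_mem c) X hX h

theorem le_E_of_le {X : Ω → ℝ} (hX : X ∈ S.H) {c : ℝ} (h : ∀ ω, c ≤ X ω) : c ≤ S.E X := by
  rw [← S.const c]
  exact S.mono X hX _ (S.const_mem c) h

theorem E_add_le {X Y : Ω → ℝ} (hX : X ∈ S.H) (hY : Y ∈ S.H) {a b : ℝ} (ha : S.E X ≤ a)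
    (hb : S.E Y ≤ b) : S.E (fun ω => X ω + Y ω) ≤ ((a + b : ℝ) : EReal) := by
  have h1 : S.E X ≠ ⊤ := (ha.trans_lt (EReal.coe_lt_top a)).ne
  have h2 : S.E Y ≠ ⊤ := (hb.trans_lt (EReal.coe_lt_top b)).ne
  refine (S.subadd X hX Y hY (fun h => h1 h.1) (fun h => h2 h.2)).trans ?_
  rw [EReal.coe_add]
  exact add_le_add ha hb

theorem E_smul_le {X : Ω → ℝ} (hX : X ∈ S.H) {a c : ℝ} (hc : 0 ≤ c) (ha : S.E X ≤ a) :
    S.E (fun ω => c * X ω) ≤ ((c * a : ℝ) : EReal) := by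
  rw [S.pos_homog X hX c hc, EReal.coe_mul]
  exact mul_le_mul_of_nonneg_left ha (by exact_mod_cast hc)

theorem E_sum_le {ι : Type*} {s : Finset ι} {X : ι → Ω → ℝ} (hX : ∀ i ∈ s, X i ∈ S.H)
    {a : ι → ℝ} (ha : ∀ i ∈ s, S.E (X i) ≤ a i) :
    S.E (fun ω => ∑ i ∈ s, X i ω) ≤ ((∑ i ∈ s, a i : ℝ) : EReal) := by
  classical
  induction s using Finset.induction_on with
  | empty => simpa using (S.const 0).le
  | insert i s hi ih =>
    simp only [Finset.sum_insert hi]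
    exact E_add_le (hX i (Finset.mem_insert_self i s))
      (sum_mem fun j hj => hX j (Finset.mem_insert_of_mem hj)) (ha i (Finset.mem_insert_self i s))
      (ih (fun j hj => hX j (Finset.mem_insert_of_mem hj))
        fun j hj => ha j (Finset.mem_insert_of_mem hj))

/-- On bounded random variables the expectation is a real number. -/
theorem exists_E_eq_coe {X : Ω → ℝ} (hX : X ∈ S.H) {c d : ℝ} (hc : ∀ ω, c ≤ X ω)
    (hd : ∀ ω, X ω ≤ d) : ∃ e : ℝ, c ≤ e ∧ e ≤ d ∧ S.E X = e := by
  have h1 := le_E_of_le hX hc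
  have h2 := E_le_of_le hX hd
  induction h : S.E X with
  | bot => rw [h] at h1; exact absurd h1 (not_le.2 (EReal.bot_lt_coe c))
  | top => rw [h] at h2; exact absurd h2 (not_le.2 (EReal.coe_lt_top d))
  | coe e =>
    rw [h] at h1 h2
    exact ⟨e, by exact_mod_cast h1, by exact_mod_cast h2, rfl⟩

/-- Sub-additivity gives one inequality; applied again after adding -c it gives the other. A real
number strictly in between is used because the left-hand side is not yet known to differ from -∞.
Exactness matters: it computes the inner expectation in the definition of independence. -/
theorem E_const_add {X : Ω → ℝ} (hX : X ∈ S.H) {e : ℝ} (he : S.E X = e) (c : ℝ) :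
    S.E (fun ω => c + X ω) = ((c + e : ℝ) : EReal) := by
  apply le_antisymm
  · exact E_add_le (S.const_mem c) hX (S.const c).le he.le
  · by_contra hlt
    rw [not_le] at hlt
    obtain ⟨b, hb1, hb2⟩ := EReal.lt_iff_exists_real_btwn.1 hlt
    have h1 := E_add_le (S.const_mem (-c)) (add_mem (S.const_mem c) hX) (S.const (-c)).le hb1.le
    simp only [neg_add_cancel_left] at h1
    rw [he] at h1
    have h2 : e ≤ -c + b := by exact_mod_cast h1
    have h3 : b < c + e := by exact_mod_cast hb2
    linarith

/-! ### Rules for the capacity -/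

theorem V_le_ofReal {A : Set Ω} {c : ℝ}
    (h : S.E (A.indicator fun _ => (1 : ℝ)) ≤ c) : S.V A ≤ ENNReal.ofReal c := by
  unfold V
  calc _ ≤ (c : EReal).toENNReal := EReal.toENNReal_le_toENNReal h
    _ = _ := by rw [EReal.toENNReal_of_ne_top (EReal.coe_ne_top c), EReal.toReal_coe]

theorem V_le_one {A : Set Ω} (hA : MeasurableSet A) : S.V A ≤ 1 := by
  have := V_le_ofReal (S := S) (A := A) (c := 1)
    (E_le_of_le (S.indicator_mem A hA) fun ω => by
      by_cases h : ω ∈ A <;> simp [h])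
  simpa using this

theorem E_indicator_eq {A : Set Ω} (hA : MeasurableSet A) :
    S.E (A.indicator fun _ => (1 : ℝ)) = ((S.V A).toReal : ℝ) := by
  obtain ⟨e, h0, -, he⟩ := exists_E_eq_coe (S.indicator_mem A hA) (c := 0) (d := 1)
    (fun ω => indicator_nonneg (fun _ _ => zero_le_one) ω)
    (fun ω => by by_cases h : ω ∈ A <;> simp [h])
  unfold V
  rw [he, EReal.toENNReal_of_ne_top (EReal.coe_ne_top e), EReal.toReal_coe,
    ENNReal.toReal_ofReal h0]

theorem V_ne_top {A : Set Ω} (hA : MeasurableSet A) : S.V A ≠ ⊤ :=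
  ((V_le_one hA).trans_lt ENNReal.one_lt_top).ne

@[simp] theorem V_univ : S.V univ = 1 := by
  unfold V
  rw [indicator_univ, S.const 1, EReal.toENNReal_of_ne_top (EReal.coe_ne_top 1), EReal.toReal_coe,
    ENNReal.ofReal_one]

@[simp] theorem V_empty : S.V ∅ = 0 := by
  unfold V
  rw [indicator_empty, S.const 0]
  simp

theorem V_mono {A B : Set Ω} (hA : MeasurableSet A) (hB : MeasurableSet B) (h : A ⊆ B) :
    S.V A ≤ S.V B := by
  apply EReal.toENNReal_le_toENNReal
  exact S.mono _ (S.indicator_mem B hB) _ (S.indicator_mem A hA) fun ω =>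
    indicator_le_indicator_of_subset h (fun _ => zero_le_one) ω

theorem V_biUnion_le {ι : Type*} (s : Finset ι) {A : ι → Set Ω}
    (hA : ∀ i ∈ s, MeasurableSet (A i)) : S.V (⋃ i ∈ s, A i) ≤ ∑ i ∈ s, S.V (A i) := by
  have hU : MeasurableSet (⋃ i ∈ s, A i) := s.measurableSet_biUnion hA
  have h := E_sum_le (S := S) (s := s) (fun i hi => S.indicator_mem (A i) (hA i hi))
    (fun i hi => (E_indicator_eq (hA i hi)).le)
  have h2 : S.E ((⋃ i ∈ s, A i).indicator fun _ => (1 : ℝ)) ≤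
      ((∑ i ∈ s, (S.V (A i)).toReal : ℝ) : EReal) := by
    refine le_trans (S.mono _ (sum_mem fun i hi => S.indicator_mem (A i) (hA i hi)) _
      (S.indicator_mem _ hU) fun ω => ?_) h
    have hn : ∀ i ∈ s, 0 ≤ (A i).indicator (fun _ => (1 : ℝ)) ω := fun i _ =>
      indicator_nonneg (fun _ _ => zero_le_one) ω
    by_cases hω : ω ∈ ⋃ i ∈ s, A i
    · rw [indicator_of_mem hω]
      simp only [mem_iUnion] at hω
      obtain ⟨i, hi, hωi⟩ := hω
      calc (1 : ℝ) = (A i).indicator (fun _ => (1 : ℝ)) ω := by rw [indicator_of_mem hωi]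
        _ ≤ _ := Finset.single_le_sum hn hi
    · rw [indicator_of_notMem hω]
      exact Finset.sum_nonneg hn
  refine (V_le_ofReal h2).trans (le_of_eq ?_)
  rw [ENNReal.ofReal_sum_of_nonneg fun _ _ => ENNReal.toReal_nonneg]
  exact Finset.sum_congr rfl fun i hi => ENNReal.ofReal_toReal (V_ne_top (hA i hi))

theorem V_union_le {A B : Set Ω} (hA : MeasurableSet A) (hB : MeasurableSet B) :
    S.V (A ∪ B) ≤ S.V A + S.V B := by
  have := V_biUnion_le (S := S) (Finset.univ : Finset Bool) (A := fun b => cond b A B)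
    (by intro b _; cases b <;> assumption)
  simpa [← union_eq_iUnion] using this

theorem measurableSet_lt_abs {X : Ω → ℝ} (hX : X ∈ S.H) (v : ℝ) :
    MeasurableSet {ω | v < |X ω|} :=
  measurableSet_lt measurable_const (by simpa using (S.measurable_of_mem X hX).norm)

/-- The expectation of a non-negative random variable is at most the integral of its tail. -/
theorem E_toENNReal_le_lintegral {Y : Ω → ℝ} (hY : Y ∈ S.H) (h0 : ∀ ω, 0 ≤ Y ω) :
    (S.E Y).toENNReal ≤ ∫⁻ v in Ioi (0 : ℝ), S.V {ω | v < Y ω} := by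
  have hm : ∀ v : ℝ, MeasurableSet {ω | v < Y ω} := fun v =>
    measurableSet_lt measurable_const (S.measurable_of_mem Y hY)
  -- Slice Y into layers of height δ: Y is at most the infinite sum of δ times the indicators of {Y
  -- > n δ}. Countable sub-additivity then bounds the expectation by a Riemann sum of the tail.
  apply ENNReal.le_of_forall_pos_le_add
  intro δ hδ _
  have hδ' : (0 : ℝ) < δ := by exact_mod_cast hδ
  have key := S.countable_subadd Y hY
    (fun n ω => (δ : ℝ) * ({ω | (n : ℝ) * δ < Y ω}.indicator (fun _ => (1 : ℝ)) ω))
    (fun n => smul_mem (S.indicator_mem _ (hm _)) _) h0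
    (fun n ω => mul_nonneg hδ'.le (indicator_nonneg (fun _ _ => zero_le_one) ω)) ?_
  · have hterm : ∀ n : ℕ, (S.E (fun ω => (δ : ℝ) *
        ({ω | (n : ℝ) * δ < Y ω}.indicator (fun _ => (1 : ℝ)) ω))).toENNReal =
        δ * S.V {ω | (n : ℝ) * δ < Y ω} := by
      intro n
      rw [S.pos_homog _ (S.indicator_mem _ (hm _)) _ hδ'.le, E_indicator_eq (hm _),
        ← EReal.coe_mul, EReal.toENNReal_of_ne_top (EReal.coe_ne_top _), EReal.toReal_coe,
        ENNReal.ofReal_mul hδ'.le, ENNReal.ofReal_coe_nnreal,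
        ENNReal.ofReal_toReal (V_ne_top (hm _))]
    simp only [hterm] at key
    refine key.trans ?_
    -- The layer n = 0 costs at most δ. By monotonicity of the tail, layer n + 1 is below the
    -- integral over (n δ, (n + 1) δ].
    rw [tsum_eq_zero_add' ENNReal.summable, add_comm]
    apply add_le_add
    · have hdisj : Pairwise (Function.onFun Disjoint fun n : ℕ => Ioc ((n : ℝ) * δ) ((n + 1) * δ)) := by
        intro i j hij
        rw [Function.onFun, Set.disjoint_left]
        rintro x ⟨h1, h2⟩ ⟨h3, h4⟩
        have h5 : (i : ℝ) < j + 1 := lt_of_mul_lt_mul_right (h1.trans_le h4) hδ'.le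
        have h6 : (j : ℝ) < i + 1 := lt_of_mul_lt_mul_right (h3.trans_le h2) hδ'.le
        have h5 : i < j + 1 := by exact_mod_cast h5
        have h6 : j < i + 1 := by exact_mod_cast h6
        omega
      calc ∑' n : ℕ, δ * S.V {ω | ((n + 1 : ℕ) : ℝ) * δ < Y ω}
          ≤ ∑' n : ℕ, ∫⁻ v in Ioc ((n : ℝ) * δ) ((n + 1) * δ), S.V {ω | v < Y ω} := by
            refine ENNReal.tsum_le_tsum fun n => ?_
            calc δ * S.V {ω | ((n + 1 : ℕ) : ℝ) * δ < Y ω}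
                = ∫⁻ v in Ioc ((n : ℝ) * δ) ((n + 1) * δ),
                    S.V {ω | ((n + 1 : ℕ) : ℝ) * δ < Y ω} := by
                  rw [setLIntegral_const, Real.volume_Ioc, mul_comm]
                  congr 1
                  rw [add_mul, one_mul, add_sub_cancel_left, ENNReal.ofReal_coe_nnreal]
              _ ≤ _ := by
                  refine setLIntegral_mono' measurableSet_Ioc fun v hv => ?_
                  refine V_mono (hm _) (hm _) fun ω hω => ?_
                  simp only [mem_ofPred_eq] at hω ⊢
                  push_cast at hω
                  exact hv.2.trans_lt hω
        _ = ∫⁻ v in ⋃ n : ℕ, Ioc ((n : ℝ) * δ) ((n + 1) * δ), S.V {ω | v < Y ω} :=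
            (lintegral_iUnion (fun _ => measurableSet_Ioc) hdisj _).symm
        _ ≤ _ := by
            refine lintegral_mono_set (iUnion_subset fun n v hv => ?_)
            exact lt_of_le_of_lt (by positivity) hv.1
    · calc (δ : ℝ≥0∞) * _ ≤ δ * 1 := by gcongr; exact V_le_one (hm _)
        _ = δ := mul_one _
  · intro ω
    refine le_trans ?_ (ENNReal.sum_le_tsum (Finset.range (⌈Y ω / δ⌉₊)))
    rw [← ENNReal.ofReal_sum_of_nonneg]
    · apply ENNReal.ofReal_le_ofReal
      calc Y ω ≤ ∑ i ∈ Finset.range ⌈Y ω / δ⌉₊, (δ : ℝ) := by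
            rw [Finset.sum_const, Finset.card_range, nsmul_eq_mul, ← div_le_iff₀ hδ']
            exact Nat.le_ceil _
        _ ≤ _ := by
            refine Finset.sum_le_sum fun i hi => ?_
            have : (i : ℝ) < Y ω / δ := Nat.lt_ceil.1 (Finset.mem_range.1 hi)
            rw [indicator_of_mem, mul_one]
            exact (lt_div_iff₀ hδ').1 this
    · exact fun n _ => mul_nonneg hδ'.le (indicator_nonneg (fun _ _ => zero_le_one) ω)

/-- A real upper bound for the tail integral bounds the expectation. -/
theorem E_le_of_lintegral_le {Y : Ω → ℝ} (hY : Y ∈ S.H) (h0 : ∀ ω, 0 ≤ Y ω) {c : ℝ} (hc : 0 ≤ c)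
    (h : ∫⁻ v in Ioi (0 : ℝ), S.V {ω | v < Y ω} ≤ ENNReal.ofReal c) : S.E Y ≤ c := by
  have h1 := (E_toENNReal_le_lintegral hY h0).trans h
  calc S.E Y = ((S.E Y).toENNReal : EReal) := (EReal.coe_toENNReal (E_nonneg hY h0)).symm
    _ ≤ ((ENNReal.ofReal c : ℝ≥0∞) : EReal) := by exact_mod_cast h1
    _ = c := by rw [EReal.coe_ennreal_ofReal, max_eq_left hc]

end SublinearExpectationSpace

/-! ### Stopping at the first passage of a level -/

/-- Extension by zero of a vector to a sequence whose coordinates `1, …, m` are the given ones. -/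
def extendSeq {m : ℕ} (x : Fin m → ℝ) (j : ℕ) : ℝ :=
  if h : 1 ≤ j ∧ j ≤ m then x ⟨j - 1, by omega⟩ else 0

theorem measurable_extendSeq {m : ℕ} : Measurable (extendSeq : (Fin m → ℝ) → ℕ → ℝ) := by
  refine measurable_pi_iff.2 fun j => ?_
  unfold extendSeq
  by_cases h : 1 ≤ j ∧ j ≤ m
  · simp only [h, and_self, dite_true]
    exact measurable_pi_apply _
  · simp only [h, dite_false]
    exact measurable_const

theorem extendSeq_shift {m : ℕ} (ρ : ℕ → ℝ) {j : ℕ} (h1 : 1 ≤ j) (h2 : j ≤ m) :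
    extendSeq (fun i : Fin m => ρ ((i : ℕ) + 1)) j = ρ j := by
  simp only [extendSeq, h1, h2, and_self, dite_true]
  congr 1
  omega

/-- The indicator that the partial sums of `ζ i (ρ i)` stay below `x` strictly before time `i`. -/
def staysBelow (ζ : ℕ → ℝ → ℝ) (x : ℝ) (i : ℕ) (ρ : ℕ → ℝ) : ℝ :=
  {ρ : ℕ → ℝ | ∀ k, 1 ≤ k → k < i → ∑ j ∈ Finset.Icc 1 k, ζ j (ρ j) < x}.indicator (fun _ => 1) ρ

/-- The exponential supermartingale, stopped when the partial sums first reach `x`. -/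
def stoppedExp (ζ : ℕ → ℝ → ℝ) (b : ℕ → ℝ) (x : ℝ) (m : ℕ) (ρ : ℕ → ℝ) : ℝ :=
  Real.exp (∑ i ∈ Finset.Icc 1 m, staysBelow ζ x i ρ * (ζ i (ρ i) - b i))

section Stopping

variable {ζ : ℕ → ℝ → ℝ} {b : ℕ → ℝ} {x : ℝ}

theorem staysBelow_eq_zero_or_one (i : ℕ) (ρ : ℕ → ℝ) :
    staysBelow ζ x i ρ = 0 ∨ staysBelow ζ x i ρ = 1 := by
  unfold staysBelow
  exact indicator_eq_zero_or_self _ _ _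

theorem measurableSet_staysBelow (hζ : ∀ i, Measurable (ζ i)) (i : ℕ) :
    MeasurableSet {ρ : ℕ → ℝ | ∀ k, 1 ≤ k → k < i → ∑ j ∈ Finset.Icc 1 k, ζ j (ρ j) < x} := by
  simp only [ofPred_forall]
  refine MeasurableSet.iInter fun k => MeasurableSet.iInter fun _ => MeasurableSet.iInter fun _ => ?_
  exact measurableSet_lt (Finset.measurable_sum _ fun j _ =>
    (hζ j).comp (measurable_pi_apply j)) measurable_const

theorem measurable_staysBelow (hζ : ∀ i, Measurable (ζ i)) (i : ℕ) :
    Measurable (staysBelow ζ x i) :=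
  measurable_const.indicator (measurableSet_staysBelow hζ i)

theorem staysBelow_congr {i : ℕ} {ρ ρ' : ℕ → ℝ} (h : ∀ j, 1 ≤ j → j < i → ρ j = ρ' j) :
    staysBelow ζ x i ρ = staysBelow ζ x i ρ' := by
  unfold staysBelow
  have : (∀ k, 1 ≤ k → k < i → ∑ j ∈ Finset.Icc 1 k, ζ j (ρ j) < x) ↔
      (∀ k, 1 ≤ k → k < i → ∑ j ∈ Finset.Icc 1 k, ζ j (ρ' j) < x) := by
    refine forall_congr' fun k => forall_congr' fun _ => forall_congr' fun hk => ?_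
    rw [Finset.sum_congr rfl fun j hj => ?_]
    rw [Finset.mem_Icc] at hj
    rw [h j hj.1 (by omega)]
  by_cases h' : ∀ k, 1 ≤ k → k < i → ∑ j ∈ Finset.Icc 1 k, ζ j (ρ j) < x
  · rw [indicator_of_mem (by exact h'), indicator_of_mem (by exact this.1 h')]
  · rw [indicator_of_notMem (by exact h'), indicator_of_notMem (by exact fun h => h' (this.2 h))]

theorem measurable_stoppedExp (hζ : ∀ i, Measurable (ζ i)) (m : ℕ) :
    Measurable (stoppedExp ζ b x m) :=
  Real.measurable_exp.comp (Finset.measurable_sum _ fun i _ =>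
    (measurable_staysBelow hζ i).mul (((hζ i).comp (measurable_pi_apply i)).sub_const _))

theorem stoppedExp_congr {m : ℕ} {ρ ρ' : ℕ → ℝ} (h : ∀ j, 1 ≤ j → j ≤ m → ρ j = ρ' j) :
    stoppedExp ζ b x m ρ = stoppedExp ζ b x m ρ' := by
  unfold stoppedExp
  congr 1
  refine Finset.sum_congr rfl fun i hi => ?_
  rw [Finset.mem_Icc] at hi
  rw [h i hi.1 hi.2, staysBelow_congr fun j hj hj' => h j hj (by omega)]

/-- The stopping factor is 0 or 1, so the new exponential is affine in the newest factor, with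
coefficients depending on the past. This is the shape required by `IndepSeq.E_add_mul_le`, and it
shows membership in `H` from indicators and products alone. -/
theorem stoppedExp_succ (m : ℕ) (ρ : ℕ → ℝ) :
    stoppedExp ζ b x (m + 1) ρ = stoppedExp ζ b x m ρ * (1 - staysBelow ζ x (m + 1) ρ) +
      stoppedExp ζ b x m ρ * staysBelow ζ x (m + 1) ρ *
        Real.exp (ζ (m + 1) (ρ (m + 1)) - b (m + 1)) := by
  have : stoppedExp ζ b x (m + 1) ρ = stoppedExp ζ b x m ρ *
      Real.exp (staysBelow ζ x (m + 1) ρ * (ζ (m + 1) (ρ (m + 1)) - b (m + 1))) := by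
    unfold stoppedExp
    rw [Finset.sum_Icc_succ_top (by omega), Real.exp_add]
  rw [this]
  rcases staysBelow_eq_zero_or_one (ζ := ζ) (x := x) (m + 1) ρ with h | h <;> simp [h]

theorem stoppedExp_le {c : ℝ} (hc : ∀ i v, ζ i v ≤ c) (hb : ∀ i, 0 ≤ b i) (h0 : 0 ≤ c) (m : ℕ)
    (ρ : ℕ → ℝ) : stoppedExp ζ b x m ρ ≤ Real.exp (m * c) := by
  unfold stoppedExp
  rw [Real.exp_le_exp]
  calc _ ≤ ∑ i ∈ Finset.Icc 1 m, c := by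
        refine Finset.sum_le_sum fun i _ => ?_
        have := hc i (ρ i)
        have := hb i
        rcases staysBelow_eq_zero_or_one (ζ := ζ) (x := x) i ρ with h | h <;> rw [h] <;> linarith
    _ = m * c := by simp

/-- Once a partial sum has reached `x`, the stopped exponential is at least `exp (x - ∑ b)`. -/
theorem le_stoppedExp (hb : ∀ i, 0 ≤ b i) {n k : ℕ} (hk1 : 1 ≤ k) (hkn : k ≤ n) {ρ : ℕ → ℝ}
    (hk : x ≤ ∑ j ∈ Finset.Icc 1 k, ζ j (ρ j)) :
    Real.exp (x - ∑ i ∈ Finset.Icc 1 n, b i) ≤ stoppedExp ζ b x n ρ := by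
  classical
  have hex : ∃ k, 1 ≤ k ∧ x ≤ ∑ j ∈ Finset.Icc 1 k, ζ j (ρ j) := ⟨k, hk1, hk⟩
  -- The first passage time: the exponent is frozen after τ, so its value is the partial sum at τ,
  -- at least x, minus the b's up to τ. Nonnegativity of b allows the full sum of b to be
  -- subtracted.
  set τ := Nat.find hex with hτ
  obtain ⟨h1, h2⟩ := Nat.find_spec hex
  rw [← hτ] at h1 h2
  have hτn : τ ≤ n := (Nat.find_min' hex ⟨hk1, hk⟩).trans hkn
  have hone : ∀ i, i ≤ τ → staysBelow ζ x i ρ = 1 := fun i hi => by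
    unfold staysBelow
    rw [indicator_of_mem]
    intro k hk hki
    by_contra hcon
    exact Nat.find_min hex (lt_of_lt_of_le hki hi) ⟨hk, not_lt.1 hcon⟩
  have hzero : ∀ i, τ < i → staysBelow ζ x i ρ = 0 := fun i hi => by
    unfold staysBelow
    rw [indicator_of_notMem]
    intro hcon
    exact absurd (hcon τ h1 hi) (not_lt.2 h2)
  unfold stoppedExp
  rw [Real.exp_le_exp]
  have hsub : Finset.Icc 1 τ ⊆ Finset.Icc 1 n := Finset.Icc_subset_Icc le_rfl hτn
  have e1 : ∑ i ∈ Finset.Icc 1 n, staysBelow ζ x i ρ * (ζ i (ρ i) - b i) =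
      ∑ i ∈ Finset.Icc 1 τ, (ζ i (ρ i) - b i) := by
    rw [← Finset.sum_subset hsub]
    · refine Finset.sum_congr rfl fun i hi => ?_
      rw [hone i (Finset.mem_Icc.1 hi).2, one_mul]
    · intro i hi hi'
      rw [Finset.mem_Icc] at hi hi'
      rw [hzero i (by omega), zero_mul]
  rw [e1, Finset.sum_sub_distrib]
  have := Finset.sum_le_sum_of_subset_of_nonneg hsub (f := b) fun i _ _ => hb i
  linarith

end Stopping

/-! ### Independence and the exponential maximal inequality -/

namespace SublinearExpectationSpace

variable {Ω : Type*} [MeasurableSpace Ω] {S : SublinearExpectationSpace Ω}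

/-- One supermartingale step. With the past frozen, the inner expectation is exactly f + g e with e
= E ξ ≤ 1, because g is nonnegative. This explicit form settles the membership conditions in the
definition of independence, and boundedness of f and g settles the finiteness conditions. -/
theorem IndepSeq.E_add_mul_le {X : ℕ → Ω → ℝ} (hindep : S.IndepSeq X) {m : ℕ} (hm : 1 ≤ m) {f g : (ℕ → ℝ) → ℝ} (hf : Measurable f)
    (hg : Measurable g)
    (hfd : ∀ ρ ρ' : ℕ → ℝ, (∀ i, 1 ≤ i → i ≤ m → ρ i = ρ' i) → f ρ = f ρ')
    (hgd : ∀ ρ ρ' : ℕ → ℝ, (∀ i, 1 ≤ i → i ≤ m → ρ i = ρ' i) → g ρ = g ρ')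
    (hfH : (fun ω => f (fun i => X i ω)) ∈ S.H) (hgH : (fun ω => g (fun i => X i ω)) ∈ S.H)
    (hf0 : ∀ ρ, 0 ≤ f ρ) (hg0 : ∀ ρ, 0 ≤ g ρ) {c : ℝ} (hfc : ∀ ρ, f ρ ≤ c) (hgc : ∀ ρ, g ρ ≤ c)
    {ξ : ℝ → ℝ} (hξ : Measurable ξ) (hξH : (fun ω => ξ (X (m + 1) ω)) ∈ S.H)
    (hξ0 : ∀ v, 0 ≤ ξ v) {c' : ℝ} (hξc : ∀ v, ξ v ≤ c')
    (hE : S.E (fun ω => ξ (X (m + 1) ω)) ≤ 1) :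
    S.E (fun ω => f (fun i => X i ω) + g (fun i => X i ω) * ξ (X (m + 1) ω)) ≤
      S.E (fun ω => f (fun i => X i ω) + g (fun i => X i ω)) := by
  obtain ⟨e, he0, -, he⟩ := exists_E_eq_coe hξH (fun ω => hξ0 _) (fun ω => hξc _)
  rw [he] at hE
  have he1 : e ≤ 1 := by exact_mod_cast hE
  let ψ : (Fin m → ℝ) × (Fin 1 → ℝ) → ℝ := fun z => f (extendSeq z.1) + g (extendSeq z.1) * ξ (z.2 0)
  have hψm : Measurable ψ := by
    have h1 : Measurable fun z : (Fin m → ℝ) × (Fin 1 → ℝ) => extendSeq z.1 :=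
      measurable_extendSeq.comp measurable_fst
    exact (hf.comp h1).add ((hg.comp h1).mul
      (hξ.comp ((measurable_pi_apply 0).comp measurable_snd)))
  have hval : ∀ u v : ℝ, 0 ≤ v →
      S.E (fun ω => u + v * ξ (X (m + 1) ω)) = ((u + v * e : ℝ) : EReal) := by
    intro u v hv
    refine E_const_add (smul_mem hξH v) ?_ u
    rw [S.pos_homog _ hξH v hv, he, EReal.coe_mul]
  have hXf : ∀ ω, f (extendSeq fun i : Fin m => X ((i : ℕ) + 1) ω) = f (fun i => X i ω) := fun ω =>
    hfd _ _ fun i h1 h2 => extendSeq_shift (fun i => X i ω) h1 h2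
  have hXg : ∀ ω, g (extendSeq fun i : Fin m => X ((i : ℕ) + 1) ω) = g (fun i => X i ω) := fun ω =>
    hgd _ _ fun i h1 h2 => extendSeq_shift (fun i => X i ω) h1 h2
  have hψ0 : ∀ z, 0 ≤ ψ z := fun z => add_nonneg (hf0 _) (mul_nonneg (hg0 _) (hξ0 _))
  have hEψ : ∀ y, S.E (fun ω => ψ (y, fun _ => X (m + 1) ω)) =
      ((f (extendSeq y) + g (extendSeq y) * e : ℝ) : EReal) := fun y => hval (f (extendSeq y)) _ (hg0 (extendSeq y))
  have hmem : (fun ω => f (fun i => X i ω) + g (fun i => X i ω) * e) ∈ S.H :=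
    add_mem hfH (mul_mem hgH (S.const_mem e))
  have key := hindep m hm ψ hψm ?_ ?_ ?_ ?_ ?_ ?_
  · simp only [hEψ, EReal.toReal_coe] at key
    simp only [ψ, hXf, hXg] at key
    rw [key]
    refine S.mono _ (add_mem hfH hgH) _ hmem fun ω => ?_
    have := mul_le_mul_of_nonneg_left he1 (hg0 (fun i => X i ω))
    linarith
  · simp only [ψ, hXf, hXg]
    exact add_mem hfH (mul_mem hgH hξH)
  · exact fun y => add_mem (S.const_mem (f (extendSeq y))) (smul_mem hξH (g (extendSeq y)))
  · intro y
    simp only [abs_of_nonneg (hψ0 _), hEψ]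
    exact EReal.coe_lt_top _
  · simp only [abs_of_nonneg (hψ0 _), hEψ, EReal.toReal_coe, hXf, hXg]
    exact hmem
  · simp only [abs_of_nonneg (hψ0 _), hEψ, EReal.toReal_coe, hXf, hXg]
    refine lt_of_le_of_lt (E_le_of_le (c := c + c * e) (abs_mem hmem) fun ω => ?_)
      (EReal.coe_lt_top _)
    rw [abs_of_nonneg (add_nonneg (hf0 _) (mul_nonneg (hg0 _) he0))]
    exact add_le_add (hfc _) (mul_le_mul_of_nonneg_right (hgc _) he0)
  · simp only [hEψ, EReal.toReal_coe, hXf, hXg]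
    exact hmem

/-- Exponential maximal inequality for partial sums of independent bounded variables. -/
theorem IndepSeq.V_maximal_le {X : ℕ → Ω → ℝ} (hindep : S.IndepSeq X)
    (hX : ∀ n, 1 ≤ n → X n ∈ S.H) {ζ : ℕ → ℝ → ℝ} {b : ℕ → ℝ} {c : ℝ}
    (hζ : ∀ i, Measurable (ζ i)) (hc : ∀ i v, ζ i v ≤ c) (hb : ∀ i, 0 ≤ b i)
    (hH : ∀ i, 1 ≤ i → (fun ω => Real.exp (ζ i (X i ω))) ∈ S.H)
    (hE : ∀ i, 1 ≤ i → S.E (fun ω => Real.exp (ζ i (X i ω))) ≤ (Real.exp (b i) : ℝ))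
    {n : ℕ} (hn : 1 ≤ n) (x : ℝ) :
    S.V {ω | ∃ k, 1 ≤ k ∧ k ≤ n ∧ x ≤ ∑ i ∈ Finset.Icc 1 k, ζ i (X i ω)} ≤
      ENNReal.ofReal (Real.exp (∑ i ∈ Finset.Icc 1 n, b i - x)) := by
  wlog h0 : 0 ≤ c generalizing c
  · exact this (c := 0) (fun i v => (hc i v).trans (not_le.1 h0).le) le_rfl
  have hmX : ∀ i, 1 ≤ i → Measurable (X i) := fun i hi => S.measurable_of_mem _ (hX i hi)
  have hstay : ∀ i, (fun ω => staysBelow ζ x i (fun j => X j ω)) ∈ S.H := by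
    intro i
    have : MeasurableSet {ω | ∀ k, 1 ≤ k → k < i → ∑ j ∈ Finset.Icc 1 k, ζ j (X j ω) < x} := by
      simp only [ofPred_forall]
      refine MeasurableSet.iInter fun k => MeasurableSet.iInter fun _ =>
        MeasurableSet.iInter fun _ => ?_
      exact measurableSet_lt (Finset.measurable_sum _ fun j hj =>
        (hζ j).comp (hmX j (Finset.mem_Icc.1 hj).1)) measurable_const
    exact S.indicator_mem _ this
  have hexp : ∀ i, 1 ≤ i → (fun ω => Real.exp (ζ i (X i ω) - b i)) ∈ S.H := by
    intro i hi
    have := smul_mem (hH i hi) (Real.exp (-b i))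
    simpa [← Real.exp_add, neg_add_eq_sub] using this
  have hexpE : ∀ i, 1 ≤ i → S.E (fun ω => Real.exp (ζ i (X i ω) - b i)) ≤ 1 := by
    intro i hi
    have := E_smul_le (hH i hi) (Real.exp_nonneg (-b i)) (hE i hi)
    simpa [← Real.exp_add, neg_add_eq_sub] using this
  have hone : ∀ m, (fun ω => (1 : ℝ) - staysBelow ζ x m (fun j => X j ω)) ∈ S.H := fun m => by
    simpa [sub_eq_add_neg] using add_mem (S.const_mem 1) (neg_mem (hstay m))
  have hDH : ∀ m, (fun ω => stoppedExp ζ b x m (fun j => X j ω)) ∈ S.H := by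
    intro m
    induction m with
    | zero => simpa [stoppedExp] using S.const_mem 1
    | succ m ih =>
      simp only [stoppedExp_succ]
      exact add_mem (mul_mem ih (hone _)) (mul_mem (mul_mem ih (hstay _)) (hexp (m + 1) (by omega)))
  have hD0 : ∀ m ρ, 0 ≤ stoppedExp ζ b x m ρ := fun m ρ => (Real.exp_pos _).le
  have hst0 : ∀ m ρ, 0 ≤ staysBelow ζ x m ρ := fun m ρ => by
    rcases staysBelow_eq_zero_or_one (ζ := ζ) (x := x) m ρ with h | h <;> simp [h]
  have hst1 : ∀ m ρ, staysBelow ζ x m ρ ≤ 1 := fun m ρ => by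
    rcases staysBelow_eq_zero_or_one (ζ := ζ) (x := x) m ρ with h | h <;> simp [h]
  have hDE : ∀ m, 1 ≤ m → S.E (fun ω => stoppedExp ζ b x m (fun j => X j ω)) ≤ 1 := by
    intro m hm
    induction m, hm using Nat.le_induction with
    -- At time 1 nothing can have been stopped, so only the first factor is left. The induction
    -- starts here because independence requires at least one past variable.
    | base =>
      refine le_trans (le_of_eq ?_) (hexpE 1 le_rfl)
      congr 1
      funext ω
      have : staysBelow ζ x 1 (fun j => X j ω) = 1 := by
        unfold staysBelow
        rw [indicator_of_mem]
        intro k hk hk'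
        omega
      simp [stoppedExp, this]
    | succ m hm ih =>
      refine le_trans ?_ ih
      have hms := measurable_staysBelow (ζ := ζ) (x := x) hζ (m + 1)
      have hmD := measurable_stoppedExp (ζ := ζ) (b := b) (x := x) hζ m
      have key := hindep.E_add_mul_le hm
        (f := fun ρ => stoppedExp ζ b x m ρ * (1 - staysBelow ζ x (m + 1) ρ))
        (g := fun ρ => stoppedExp ζ b x m ρ * staysBelow ζ x (m + 1) ρ)
        (hmD.mul (measurable_const.sub hms)) (hmD.mul hms) ?_ ?_
        (mul_mem (hDH m) (hone (m + 1))) (mul_mem (hDH m) (hstay (m + 1)))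
        (fun ρ => mul_nonneg (hD0 _ _) (sub_nonneg.2 (hst1 _ _)))
        (fun ρ => mul_nonneg (hD0 _ _) (hst0 _ _))
        (c := Real.exp (m * c)) ?_ ?_
        (ξ := fun v => Real.exp (ζ (m + 1) v - b (m + 1)))
        (Real.measurable_exp.comp ((hζ _).sub_const _)) (hexp (m + 1) (by omega))
        (fun v => (Real.exp_pos _).le) (c' := Real.exp c) ?_ (hexpE (m + 1) (by omega))
      · simp only [stoppedExp_succ]
        refine key.trans (le_of_eq ?_)
        congr 1
        funext ω
        ring
      · intro ρ ρ' h
        rw [stoppedExp_congr h, staysBelow_congr fun j h1 h2 => h j h1 (by omega)]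
      · intro ρ ρ' h
        rw [stoppedExp_congr h, staysBelow_congr fun j h1 h2 => h j h1 (by omega)]
      · intro ρ
        refine le_trans ?_ (stoppedExp_le (x := x) hc hb h0 m ρ)
        exact mul_le_of_le_one_right (hD0 _ _) (by linarith [hst0 (m + 1) ρ])
      · intro ρ
        refine le_trans ?_ (stoppedExp_le (x := x) hc hb h0 m ρ)
        exact mul_le_of_le_one_right (hD0 _ _) (hst1 _ _)
      · intro v
        rw [Real.exp_le_exp]
        linarith [hc (m + 1) v, hb (m + 1)]
  have hA : MeasurableSet {ω | ∃ k, 1 ≤ k ∧ k ≤ n ∧ x ≤ ∑ i ∈ Finset.Icc 1 k, ζ i (X i ω)} := by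
    simp only [ofPred_exists, ofPred_and]
    refine MeasurableSet.iUnion fun k => ?_
    refine MeasurableSet.inter (MeasurableSet.const _) (MeasurableSet.inter (MeasurableSet.const _) ?_)
    exact measurableSet_le measurable_const (Finset.measurable_sum _ fun j hj =>
        (hζ j).comp (hmX j (Finset.mem_Icc.1 hj).1))
  apply V_le_ofReal
  set B := ∑ i ∈ Finset.Icc 1 n, b i
  -- Markov's inequality for the stopped exponential, which is at least exp (x - B) on the event.
  have h1 := E_smul_le (hDH n) (Real.exp_nonneg (B - x)) (a := 1) (by exact_mod_cast hDE n hn)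
  rw [mul_one] at h1
  refine le_trans (S.mono _ (smul_mem (hDH n) _) _ (S.indicator_mem _ hA) fun ω => ?_) h1
  by_cases hω : ω ∈ {ω | ∃ k, 1 ≤ k ∧ k ≤ n ∧ x ≤ ∑ i ∈ Finset.Icc 1 k, ζ i (X i ω)}
  · rw [indicator_of_mem hω]
    obtain ⟨k, hk1, hk2, hk⟩ := hω
    have h2 := le_stoppedExp (ζ := ζ) (b := b) (x := x) (ρ := fun j => X j ω) hb hk1 hk2 hk
    calc (1 : ℝ) = Real.exp (B - x) * Real.exp (x - B) := by rw [← Real.exp_add]; simp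
      _ ≤ _ := by gcongr
  · rw [indicator_of_notMem hω]
    exact mul_nonneg (Real.exp_nonneg _) (hD0 _ _)

end SublinearExpectationSpace

/-! ### Integrals of powers -/

theorem lintegral_Ioc_rpow {e y : ℝ} (he : -1 < e) (hy : 0 ≤ y) :
    ∫⁻ v in Ioc 0 y, ENNReal.ofReal (v ^ e) = ENNReal.ofReal (y ^ (e + 1) / (e + 1)) := by
  have hint := (intervalIntegral.intervalIntegrable_rpow' (a := 0) (b := y) he)
  rw [intervalIntegrable_iff_integrableOn_Ioc_of_le hy] at hint
  rw [← ofReal_integral_eq_lintegral_ofReal hint, ← intervalIntegral.integral_of_le hy,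
    integral_rpow (Or.inl he), Real.zero_rpow (by linarith), sub_zero]
  filter_upwards [ae_restrict_mem measurableSet_Ioc] with v hv
  exact Real.rpow_nonneg hv.1.le e

theorem lintegral_Ioi_rpow {e y : ℝ} (he : e < -1) (hy : 0 < y) :
    ∫⁻ v in Ioi y, ENNReal.ofReal (v ^ e) = ENNReal.ofReal (-y ^ (e + 1) / (e + 1)) := by
  rw [← ofReal_integral_eq_lintegral_ofReal (integrableOn_Ioi_rpow_of_lt he hy),
    integral_Ioi_rpow_of_lt he hy]
  filter_upwards [ae_restrict_mem measurableSet_Ioi] with v hv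
  exact Real.rpow_nonneg (hy.trans hv).le e

theorem lintegral_Ioi_add_right (f : ℝ → ℝ≥0∞) (y : ℝ) :
    ∫⁻ v in Ioi (0 : ℝ), f (v + y) = ∫⁻ v in Ioi y, f v := by
  have h := (measurePreserving_add_right (volume : Measure ℝ) y).setLIntegral_comp_preimage_emb
    (MeasurableEquiv.addRight y).measurableEmbedding f (Ioi y)
  rw [← h]
  congr 2
  ext v
  simp

/-! ### Elementary bounds -/

theorem Real.exp_le_one_add_abs_mul_exp (v : ℝ) : Real.exp v ≤ 1 + |v| * Real.exp |v| := by
  have h1 : Real.exp v - 1 ≤ v * Real.exp v := by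
    have := Real.add_one_le_exp (-v)
    have h2 : Real.exp (-v) * Real.exp v = 1 := by rw [← Real.exp_add]; simp
    nlinarith [Real.exp_pos v]
  have h3 : v * Real.exp v ≤ |v| * Real.exp |v| := by
    apply mul_le_mul (le_abs_self v) (Real.exp_le_exp.2 (le_abs_self v)) (Real.exp_pos _).le
      (abs_nonneg v)
  linarith

/-- The linear term is kept with coefficient one, so that a nonpositive mean can be exploited. -/
theorem Real.exp_le_one_add_add_sq_mul_exp (v : ℝ) :
    Real.exp v ≤ 1 + v + v ^ 2 * Real.exp |v| := by
  have h0 := Real.add_one_le_exp v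
  have h1 : Real.exp v - 1 ≤ v * Real.exp v := by
    have := Real.add_one_le_exp (-v)
    have h2 : Real.exp (-v) * Real.exp v = 1 := by rw [← Real.exp_add]; simp
    nlinarith [Real.exp_pos v]
  rcases le_total 0 v with h | h
  · rw [abs_of_nonneg h]
    nlinarith
  · have h2 : (1 : ℝ) ≤ Real.exp |v| := Real.one_le_exp (abs_nonneg v)
    nlinarith [sq_nonneg v]

theorem Real.abs_exp_sub_exp_le {a b c : ℝ} (ha : a ≤ c) (hb : b ≤ c) :
    |Real.exp a - Real.exp b| ≤ Real.exp c * |a - b| := by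
  wlog h : a ≤ b generalizing a b
  · rw [abs_sub_comm, abs_sub_comm a]
    exact this hb ha (not_le.1 h).le
  rw [abs_of_nonpos (by linarith [Real.exp_le_exp.2 h]), abs_of_nonpos (by linarith)]
  have h1 := Real.add_one_le_exp (a - b)
  have h2 : Real.exp (a - b) * Real.exp b = Real.exp a := by rw [← Real.exp_add]; simp
  have h3 := Real.exp_le_exp.2 hb
  nlinarith [Real.exp_pos b]

/-! ### Truncation -/

/-- Truncation of a real number at the levels `-y` and `y`. -/
def truncate (y v : ℝ) : ℝ := max (-y) (min v y)

section Truncate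

variable {y : ℝ}

theorem abs_truncate_le (hy : 0 ≤ y) (v : ℝ) : |truncate y v| ≤ y := by
  unfold truncate
  rw [abs_le]
  exact ⟨le_max_left _ _, max_le (by linarith) (min_le_right _ _)⟩

theorem abs_truncate_le_abs (hy : 0 ≤ y) (v : ℝ) : |truncate y v| ≤ |v| := by
  unfold truncate
  rcases le_total v y with h | h
  · rw [min_eq_left h]
    rcases le_total (-y) v with h' | h'
    · rw [max_eq_right h']
    · rw [max_eq_left h', abs_neg, abs_of_nonneg hy, abs_of_nonpos (by linarith)]
      linarith
  · rw [min_eq_right h, max_eq_right (by linarith), abs_of_nonneg hy]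
    exact h.trans (le_abs_self v)

theorem truncate_of_abs_le {v : ℝ} (h : |v| ≤ y) : truncate y v = v := by
  rw [abs_le] at h
  unfold truncate
  rw [min_eq_left h.2, max_eq_right h.1]

/-- Truncation raises v only below -y, and then by |v| - y. Hence the mean of a truncated variable
exceeds the original mean by at most the expected excess. -/
theorem truncate_le_add (v : ℝ) : truncate y v ≤ v + max (|v| - y) 0 := by
  unfold truncate
  apply max_le
  · have h1 := le_max_left (|v| - y) 0
    have h2 := neg_abs_le v
    linarith
  · have h1 := le_max_right (|v| - y) 0
    have h2 := min_le_left v y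
    linarith

theorem abs_truncate_sub_le (u v : ℝ) : |truncate y u - truncate y v| ≤ |u - v| := by
  unfold truncate
  have h1 : |max (-y) (min u y) - max (-y) (min v y)| ≤ |min u y - min v y| := by
    rw [max_comm (-y), max_comm (-y)]
    exact abs_max_sub_max_le_abs _ _ _
  have h2 : |min u y - min v y| ≤ |u - v| := by
    have := abs_min_sub_min_le_max u y v y
    simpa using this
  exact h1.trans h2

theorem measurable_truncate : Measurable (truncate y) :=
  measurable_const.max (measurable_id.min measurable_const)

end Truncate

/-! ### Moments and exponential moments under a power tail -/

namespace SublinearExpectationSpace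

variable {Ω : Type*} [MeasurableSpace Ω] {S : SublinearExpectationSpace Ω}

theorem IdentDistrib.E_eq_of_bounded {X Y : Ω → ℝ} (h : S.IdentDistrib X Y) {ψ : ℝ → ℝ}
    (hψ : Measurable ψ) (hX : (fun ω => ψ (X ω)) ∈ S.H) (hY : (fun ω => ψ (Y ω)) ∈ S.H)
    {c d : ℝ} (hc : ∀ v, c ≤ ψ v) (hd : ∀ v, ψ v ≤ d) :
    S.E (fun ω => ψ (X ω)) = S.E (fun ω => ψ (Y ω)) := by
  obtain ⟨e, -, -, he⟩ := exists_E_eq_coe hX (fun ω => hc _) (fun ω => hd _)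
  obtain ⟨e', -, -, he'⟩ := exists_E_eq_coe hY (fun ω => hc _) (fun ω => hd _)
  refine h ψ hψ hX hY ?_ ?_ ?_ ?_
  · rw [he]; exact EReal.coe_ne_top _
  · rw [he]; exact EReal.coe_ne_bot _
  · rw [he']; exact EReal.coe_ne_top _
  · rw [he']; exact EReal.coe_ne_bot _

theorem IdentDistrib.V_lt_abs {X Y : Ω → ℝ} (h : S.IdentDistrib X Y) (hX : X ∈ S.H)
    (hY : Y ∈ S.H) (v : ℝ) : S.V {ω | v < |X ω|} = S.V {ω | v < |Y ω|} := by
  have hm : MeasurableSet {x : ℝ | v < |x|} :=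
    measurableSet_lt measurable_const measurable_id.abs
  unfold V
  congr 1
  exact h.E_eq_of_bounded (ψ := {x : ℝ | v < |x|}.indicator fun _ => (1 : ℝ))
    (measurable_const.indicator hm) (S.indicator_mem _ (measurableSet_lt_abs hX v))
    (S.indicator_mem _ (measurableSet_lt_abs hY v)) (c := 0) (d := 1)
    (fun x => indicator_nonneg (fun _ _ => zero_le_one) x)
    (fun x => by by_cases h : x ∈ {x : ℝ | v < |x|} <;> simp [h])

/-- A bounded random variable with a power tail. -/
theorem E_le_of_tail_of_le {W : Ω → ℝ} (hW : W ∈ S.H) (h0 : ∀ ω, 0 ≤ W ω) {w A θ : ℝ}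
    (hw0 : 0 ≤ w) (hw : ∀ ω, W ω ≤ w) (hA : 0 ≤ A) (hθ : θ < 1)
    (htail : ∀ v, 0 < v → S.V {ω | v < W ω} ≤ ENNReal.ofReal (A * v ^ (-θ))) :
    S.E W ≤ ((A * (w ^ (1 - θ) / (1 - θ)) : ℝ) : EReal) := by
  have h1 : 0 < 1 - θ := by linarith
  refine E_le_of_lintegral_le hW h0 (by positivity) ?_
  calc ∫⁻ v in Ioi (0 : ℝ), S.V {ω | v < W ω}
      ≤ ∫⁻ v in Ioc 0 w, ENNReal.ofReal (A * v ^ (-θ)) := by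
        rw [← lintegral_indicator measurableSet_Ioi, ← lintegral_indicator measurableSet_Ioc]
        refine lintegral_mono fun v => ?_
        by_cases hv : v ∈ Ioi (0 : ℝ)
        · rw [indicator_of_mem hv]
          by_cases hv' : v ≤ w
          · rw [indicator_of_mem (show v ∈ Ioc 0 w from ⟨hv, hv'⟩)]
            exact htail v hv
          · have : {ω | v < W ω} = ∅ := by
              ext ω
              simp only [mem_ofPred_eq, mem_empty_iff_false, iff_false, not_lt]
              exact (hw ω).trans (not_le.1 hv').le
            rw [this, V_empty]
            exact zero_le
        · rw [indicator_of_notMem hv]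
          exact zero_le
    _ = ENNReal.ofReal A * ∫⁻ v in Ioc 0 w, ENNReal.ofReal (v ^ (-θ)) := by
        simp_rw [ENNReal.ofReal_mul hA]
        rw [lintegral_const_mul' _ _ ENNReal.ofReal_ne_top]
    _ = _ := by
        rw [lintegral_Ioc_rpow (by linarith) hw0, ← ENNReal.ofReal_mul hA, neg_add_eq_sub]

/-- The expected excess over a level of a random variable with a power tail. -/
theorem E_excess_le_of_tail {Y : Ω → ℝ} (hY : Y ∈ S.H) {y A m : ℝ} (hy : 0 < y)
    (hA : 0 ≤ A) (hm : 1 < m)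
    (htail : ∀ v, 0 < v → S.V {ω | v < |Y ω|} ≤ ENNReal.ofReal (A * v ^ (-m))) :
    S.E (fun ω => max (|Y ω| - y) 0) ≤ ((A * (y ^ (1 - m) / (m - 1)) : ℝ) : EReal) := by
  have h1 : 0 < m - 1 := by linarith
  have hH : (fun ω => max (|Y ω| - y) 0) ∈ S.H :=
    comp_lipschitz_mem (f := fun x => max (|x| - y) 0) (K := 1) hY fun u v => by
      have := abs_max_sub_max_le_abs (|u| - y) (|v| - y) 0
      have h2 := abs_abs_sub_abs_le_abs_sub u v
      rw [sub_sub_sub_cancel_right] at this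
      linarith
  refine E_le_of_lintegral_le hH (fun ω => le_max_right _ _) (by positivity) ?_
  calc ∫⁻ v in Ioi (0 : ℝ), S.V {ω | v < max (|Y ω| - y) 0}
      ≤ ∫⁻ v in Ioi (0 : ℝ), ENNReal.ofReal (A * (v + y) ^ (-m)) := by
        refine setLIntegral_mono' measurableSet_Ioi fun v hv => ?_
        have hv' : 0 < v := hv
        have : {ω | v < max (|Y ω| - y) 0} = {ω | v + y < |Y ω|} := by
          ext ω
          simp only [mem_ofPred_eq, lt_max_iff]
          constructor
          · rintro (h | h) <;> linarith
          · intro h; left; linarith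
        rw [this]
        exact htail _ (by linarith)
    _ = ENNReal.ofReal A * ∫⁻ v in Ioi y, ENNReal.ofReal (v ^ (-m)) := by
        rw [lintegral_Ioi_add_right (fun v => ENNReal.ofReal (A * v ^ (-m)))]
        simp_rw [ENNReal.ofReal_mul hA]
        rw [lintegral_const_mul' _ _ ENNReal.ofReal_ne_top]
    _ = _ := by
        rw [lintegral_Ioi_rpow (by linarith) hy, ← ENNReal.ofReal_mul hA, neg_add_eq_sub, neg_div,
          ← div_neg, neg_sub]

/-- The exponential itself is outside the polynomial-growth class, but truncation keeps the exponent
below t y, where the exponential is Lipschitz. -/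
theorem exp_truncate_mem {Y : Ω → ℝ} (hY : Y ∈ S.H) {t y : ℝ} (ht : 0 ≤ t) (hy : 0 ≤ y) :
    (fun ω => Real.exp (t * truncate y (Y ω))) ∈ S.H := by
  refine comp_lipschitz_mem (f := fun x => Real.exp (t * truncate y x)) (K := Real.exp (t * y) * t)
    hY fun u v => ?_
  have hle : ∀ x, t * truncate y x ≤ t * y := fun x =>
    mul_le_mul_of_nonneg_left ((le_abs_self _).trans (abs_truncate_le hy x)) ht
  refine (Real.abs_exp_sub_exp_le (hle u) (hle v)).trans ?_
  rw [← mul_sub, abs_mul, abs_of_nonneg ht, mul_assoc]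
  have := abs_truncate_sub_le (y := y) u v
  gcongr

/-- Exponential moments of truncations of a variable with a power tail. -/
theorem E_exp_truncate_le {Y : Ω → ℝ} (hY : Y ∈ S.H) {A m : ℝ} (hA : 0 ≤ A)
    (hm : m < 1 ∨ (1 < m ∧ m < 2 ∧ S.E Y ≤ 0))
    (htail : ∀ v, 0 < v → S.V {ω | v < |Y ω|} ≤ ENNReal.ofReal (A * v ^ (-m)))
    {y T : ℝ} (hy : 0 < y) (hT : 1 ≤ T) :
    S.E (fun ω => Real.exp (T / y * truncate y (Y ω))) ≤
      (Real.exp ((1 / |1 - m| + 2 / (2 - m)) * (A * (y ^ (-m) * Real.exp (4 * T)))) : ℝ) := by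
  have hT0 : 0 < T := by linarith
  have hZH : (fun ω => truncate y (Y ω)) ∈ S.H :=
    comp_lipschitz_mem (f := truncate y) (K := 1) hY fun u v => by
      simpa using abs_truncate_sub_le u v
  have hexpH := exp_truncate_mem hY (t := T / y) (y := y) (by positivity) hy.le
  have hTe : T ≤ Real.exp T := by linarith [Real.add_one_le_exp T]
  have hle : ∀ ω, |T / y * truncate y (Y ω)| ≤ T := fun ω => by
    rw [abs_mul, abs_of_nonneg (by positivity : 0 ≤ T / y)]
    calc T / y * |truncate y (Y ω)| ≤ T / y * y := by
          gcongr; exact abs_truncate_le hy.le _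
      _ = T := by field_simp
  have hE4 : Real.exp T * Real.exp T ≤ Real.exp (4 * T) := by
    rw [← Real.exp_add, Real.exp_le_exp]; linarith
  have hE4' : Real.exp T * Real.exp T * Real.exp T ≤ Real.exp (4 * T) := by
    rw [← Real.exp_add, ← Real.exp_add, Real.exp_le_exp]; linarith
  have hE1 : Real.exp T ≤ Real.exp (4 * T) := by
    rw [Real.exp_le_exp]; linarith
  have hym : 0 < y ^ (-m) := Real.rpow_pos_of_pos hy _
  have hm2 : m < 2 := by rcases hm with h | ⟨-, h, -⟩ <;> linarith
  have h2m : 0 < 2 - m := by linarith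
  -- Both cases end with 1 + c ≤ exp c. The common constant covers the first-moment and
  -- second-moment contributions, and exp (4 T) absorbs every polynomial factor in T.
  have hfin : ∀ c : ℝ, c ≤ (1 / |1 - m| + 2 / (2 - m)) * (A * (y ^ (-m) * Real.exp (4 * T))) →
      ((1 + c : ℝ) : EReal) ≤
      (Real.exp ((1 / |1 - m| + 2 / (2 - m)) * (A * (y ^ (-m) * Real.exp (4 * T)))) : ℝ) := by
    intro c hc
    rw [EReal.coe_le_coe_iff]
    linarith [Real.add_one_le_exp ((1 / |1 - m| + 2 / (2 - m)) * (A * (y ^ (-m) * Real.exp (4 * T))))]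
  rcases hm with hm | ⟨hm1, -, hEY⟩
  · have h1m : 0 < 1 - m := by linarith
    -- For m < 1 the tail is integrable at 0, so a first-order expansion suffices and no centering
    -- is needed.
    have hZ : S.E (fun ω => |truncate y (Y ω)|) ≤ ((A * (y ^ (1 - m) / (1 - m)) : ℝ) : EReal) := by
      refine E_le_of_tail_of_le (abs_mem hZH) (fun ω => abs_nonneg _) hy.le
        (fun ω => abs_truncate_le hy.le _) hA hm fun v hv => ?_
      refine le_trans (V_mono (measurableSet_lt_abs hZH v) (measurableSet_lt_abs hY v) ?_)
        (htail v hv)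
      exact fun ω hω => lt_of_lt_of_le hω (abs_truncate_le_abs hy.le _)
    have hstep := E_add_le (S.const_mem 1) (smul_mem (abs_mem hZH) (T / y * Real.exp T))
      (S.const 1).le (E_smul_le (abs_mem hZH) (by positivity) hZ)
    refine le_trans (S.mono _ (add_mem (S.const_mem 1)
      (smul_mem (abs_mem hZH) (T / y * Real.exp T))) _ hexpH fun ω => ?_)
      (hstep.trans (hfin _ ?_))
    · refine (Real.exp_le_one_add_abs_mul_exp _).trans ?_
      have h1 : Real.exp |T / y * truncate y (Y ω)| ≤ Real.exp T := Real.exp_le_exp.2 (hle ω)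
      calc 1 + |T / y * truncate y (Y ω)| * Real.exp |T / y * truncate y (Y ω)|
          ≤ 1 + |T / y * truncate y (Y ω)| * Real.exp T := by gcongr
        _ = _ := by rw [abs_mul, abs_of_nonneg (by positivity : 0 ≤ T / y)]; ring
    · have hrw : y ^ (1 - m) = y ^ (-m) * y := by
        rw [sub_eq_neg_add, Real.rpow_add hy, Real.rpow_one]
      have habs : |1 - m| = 1 - m := abs_of_pos h1m
      calc T / y * Real.exp T * (A * (y ^ (1 - m) / (1 - m)))
          = 1 / (1 - m) * (A * (y ^ (-m) * (T * Real.exp T))) := by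
            rw [hrw]; field_simp
        _ ≤ (1 / (1 - m) + 2 / (2 - m)) * (A * (y ^ (-m) * Real.exp (4 * T))) := by
            have h1 : T * Real.exp T ≤ Real.exp (4 * T) :=
              le_trans (mul_le_mul_of_nonneg_right hTe (Real.exp_pos T).le) hE4
            have h2 : 0 ≤ 2 / (2 - m) := by positivity
            gcongr
            linarith
        _ = _ := by rw [habs]
  · have h1m : 0 < m - 1 := by linarith
    have hexc := E_excess_le_of_tail hY hy hA hm1 htail
    have hexcH : (fun ω => max (|Y ω| - y) 0) ∈ S.H :=
      comp_lipschitz_mem (f := fun x => max (|x| - y) 0) (K := 1) hY fun u v => by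
        have := abs_max_sub_max_le_abs (|u| - y) (|v| - y) 0
        have h2 := abs_abs_sub_abs_le_abs_sub u v
        rw [sub_sub_sub_cancel_right] at this
        linarith
    -- For m > 1 the mean of the truncation is controlled by the excess above y, because the mean of
    -- Y is nonpositive.
    have hZ : S.E (fun ω => truncate y (Y ω)) ≤ ((0 + A * (y ^ (1 - m) / (m - 1)) : ℝ) : EReal) :=
      le_trans (S.mono _ (add_mem hY hexcH) _ hZH fun ω => truncate_le_add _)
        (E_add_le hY hexcH (a := 0) (by exact_mod_cast hEY) hexc)
    rw [zero_add] at hZ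
    -- The square is bounded by y ^ 2 and has tail exponent m / 2 < 1; this is where m < 2 enters.
    have hZ2 : S.E (fun ω => truncate y (Y ω) * truncate y (Y ω)) ≤
        ((A * ((y ^ 2) ^ (1 - m / 2) / (1 - m / 2)) : ℝ) : EReal) := by
      refine E_le_of_tail_of_le (mul_mem hZH hZH) (fun ω => mul_self_nonneg _) (by positivity)
        (fun ω => ?_) hA (by linarith) fun v hv => ?_
      · rw [← sq, ← sq_abs]
        exact pow_le_pow_left₀ (abs_nonneg _) (abs_truncate_le hy.le _) 2
      · have hset : {ω | v < truncate y (Y ω) * truncate y (Y ω)} ⊆ {ω | √v < |Y ω|} := by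
          intro ω hω
          simp only [mem_ofPred_eq] at hω ⊢
          rw [← sq, ← sq_abs] at hω
          exact lt_of_lt_of_le ((Real.sqrt_lt' (abs_pos.2 fun h0 => by
            rw [h0] at hω; simp at hω; linarith)).2 hω) (abs_truncate_le_abs hy.le _)
        refine (V_mono (measurableSet_lt measurable_const
          (S.measurable_of_mem _ (mul_mem hZH hZH))) (measurableSet_lt_abs hY _) hset).trans ?_
        refine (htail _ (Real.sqrt_pos.2 hv)).trans (le_of_eq ?_)
        rw [Real.sqrt_eq_rpow, ← Real.rpow_mul hv.le]
        congr 3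
        ring
    have hstep := E_add_le (add_mem (S.const_mem 1) (smul_mem hZH (T / y)))
      (smul_mem (mul_mem hZH hZH) ((T / y) ^ 2 * Real.exp T))
      (E_add_le (S.const_mem 1) (smul_mem hZH (T / y)) (S.const 1).le
        (E_smul_le hZH (by positivity) hZ))
      (E_smul_le (mul_mem hZH hZH) (by positivity) hZ2)
    rw [add_assoc] at hstep
    refine le_trans (S.mono _ (add_mem (add_mem (S.const_mem 1) (smul_mem hZH (T / y)))
      (smul_mem (mul_mem hZH hZH) ((T / y) ^ 2 * Real.exp T))) _ hexpH fun ω => ?_)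
      (hstep.trans (hfin _ ?_))
    · refine (Real.exp_le_one_add_add_sq_mul_exp _).trans ?_
      have h1 : Real.exp |T / y * truncate y (Y ω)| ≤ Real.exp T := Real.exp_le_exp.2 (hle ω)
      calc 1 + T / y * truncate y (Y ω) +
            (T / y * truncate y (Y ω)) ^ 2 * Real.exp |T / y * truncate y (Y ω)|
          ≤ 1 + T / y * truncate y (Y ω) + (T / y * truncate y (Y ω)) ^ 2 * Real.exp T := by gcongr
        _ = _ := by ring
    · have hrw : y ^ (1 - m) = y ^ (-m) * y := by
        rw [sub_eq_neg_add, Real.rpow_add hy, Real.rpow_one]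
      have hrw2 : (y ^ 2) ^ (1 - m / 2) = y ^ (-m) * y ^ 2 := by
        rw [← Real.rpow_natCast y 2, ← Real.rpow_mul hy.le, ← Real.rpow_add hy]
        congr 1
        push_cast
        ring
      have habs : |1 - m| = m - 1 := by rw [abs_sub_comm]; exact abs_of_pos h1m
      have h2 : (1 - m / 2) = (2 - m) / 2 := by ring
      calc T / y * (A * (y ^ (1 - m) / (m - 1))) +
            (T / y) ^ 2 * Real.exp T * (A * ((y ^ 2) ^ (1 - m / 2) / (1 - m / 2)))
          = 1 / (m - 1) * (A * (y ^ (-m) * T)) +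
            2 / (2 - m) * (A * (y ^ (-m) * (T * T * Real.exp T))) := by
            rw [hrw, hrw2, h2]; field_simp
        _ ≤ 1 / (m - 1) * (A * (y ^ (-m) * Real.exp (4 * T))) +
            2 / (2 - m) * (A * (y ^ (-m) * Real.exp (4 * T))) := by
            have h3 : T * T * Real.exp T ≤ Real.exp (4 * T) :=
              le_trans (by gcongr) hE4'
            have h4 : T ≤ Real.exp (4 * T) := hTe.trans hE1
            gcongr
        _ = _ := by rw [habs]; ring

/-! ### Tail bound for weighted sums -/

theorem V_lt_abs_smul_le {Y : Ω → ℝ} {A m : ℝ}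
    (htail : ∀ v, 0 < v → S.V {ω | v < |Y ω|} ≤ ENNReal.ofReal (A * v ^ (-m))) (w : ℝ) {v : ℝ}
    (hv : 0 < v) : S.V {ω | v < |w * Y ω|} ≤ ENNReal.ofReal (A * |w| ^ m * v ^ (-m)) := by
  rcases eq_or_ne w 0 with rfl | hw
  · have : {ω | v < |0 * Y ω|} = ∅ := by
      ext ω; simp [hv.le]
    rw [this, V_empty]
    exact zero_le
  have hw' : 0 < |w| := abs_pos.2 hw
  have : {ω | v < |w * Y ω|} = {ω | v / |w| < |Y ω|} := by
    ext ω
    simp only [mem_ofPred_eq, abs_mul, div_lt_iff₀' hw']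
  rw [this]
  refine (htail _ (by positivity)).trans (le_of_eq ?_)
  rw [Real.div_rpow hv.le hw'.le, Real.rpow_neg hw'.le]
  congr 1
  field_simp

variable {X : ℕ → Ω → ℝ} {X₀ : Ω → ℝ}

/-- Homogeneity is only positive, so both signs of the variable are needed. Both are used even for
positive weights, since the lower deviations are treated by negating the weights. -/
theorem E_smul_nonpos (hX₀ : X₀ ∈ S.H) (h1 : S.E X₀ ≤ 0) (h2 : S.E (fun ω => -X₀ ω) ≤ 0) (w : ℝ) :
    S.E (fun ω => w * X₀ ω) ≤ 0 := by
  rcases le_total 0 w with hw | hw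
  · have := E_smul_le hX₀ hw (a := 0) (by exact_mod_cast h1)
    simpa using this
  · have := E_smul_le (neg_mem hX₀) (neg_nonneg.2 hw) (a := 0) (by exact_mod_cast h2)
    simpa using this

/-- The maximal inequality with exponential parameter T / y. Identical distribution transfers the
exponential moment from X₀, since truncation makes the test function bounded. -/
theorem IndepSeq.V_sum_truncate_ge_le (hindep : S.IndepSeq X) (hX : ∀ n, 1 ≤ n → X n ∈ S.H)
    (hX₀ : X₀ ∈ S.H) (hident : ∀ n, 1 ≤ n → S.IdentDistrib (X n) X₀) {A m : ℝ} (hA : 0 ≤ A)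
    (hm : m < 1 ∨ (1 < m ∧ m < 2 ∧ S.E X₀ ≤ 0 ∧ S.E (fun ω => -X₀ ω) ≤ 0))
    (htail : ∀ v, 0 < v → S.V {ω | v < |X₀ ω|} ≤ ENNReal.ofReal (A * v ^ (-m)))
    {y T u : ℝ} (hy : 0 < y) (hT : 1 ≤ T) (w : ℕ → ℝ) {n : ℕ} (hn : 1 ≤ n) :
    S.V {ω | ∃ k, 1 ≤ k ∧ k ≤ n ∧ u ≤ ∑ i ∈ Finset.Icc 1 k, truncate y (w i * X i ω)} ≤
      ENNReal.ofReal (Real.exp ((1 / |1 - m| + 2 / (2 - m)) * A * y ^ (-m) *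
        (∑ i ∈ Finset.Icc 1 n, |w i| ^ m) * Real.exp (4 * T) - T * u / y)) := by
  have hTy : 0 < T / y := by positivity
  have h2m : 0 < 2 - m := by rcases hm with h | ⟨-, h, -⟩ <;> linarith
  have hmeas : ∀ i, Measurable fun v => T / y * truncate y (w i * v) := fun i =>
    (measurable_truncate.comp (measurable_const_mul (w i))).const_mul _
  have hub : ∀ i v, T / y * truncate y (w i * v) ≤ T / y * y := fun i v =>
    mul_le_mul_of_nonneg_left ((le_abs_self _).trans (abs_truncate_le hy.le _)) hTy.le
  have hmemX : ∀ (Z : Ω → ℝ) (_ : Z ∈ S.H) (i : ℕ),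
      (fun ω => Real.exp (T / y * truncate y (w i * Z ω))) ∈ S.H := fun Z hZ i =>
    exp_truncate_mem (smul_mem hZ (w i)) hTy.le hy.le
  have key := hindep.V_maximal_le hX (ζ := fun i v => T / y * truncate y (w i * v))
    (b := fun i => (1 / |1 - m| + 2 / (2 - m)) * (A * |w i| ^ m * (y ^ (-m) * Real.exp (4 * T))))
    (c := T / y * y) hmeas hub (fun i => by positivity)
    (fun i hi => hmemX _ (hX i hi) i) (fun i hi => ?_) hn (T / y * u)
  · simp only [← Finset.mul_sum, mul_le_mul_iff_right₀ hTy] at key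
    refine key.trans (le_of_eq ?_)
    congr 2
    rw [← Finset.sum_mul, ← Finset.mul_sum]
    ring
  · have hEq := (hident i hi).E_eq_of_bounded
      (ψ := fun v => Real.exp (T / y * truncate y (w i * v)))
      (Real.measurable_exp.comp (hmeas i)) (hmemX _ (hX i hi) i) (hmemX _ hX₀ i) (c := 0)
      (d := Real.exp (T / y * y)) (fun v => (Real.exp_pos _).le)
      (fun v => Real.exp_le_exp.2 (hub i v))
    rw [hEq]
    refine E_exp_truncate_le (smul_mem hX₀ (w i)) (by positivity) ?_
      (fun v hv => V_lt_abs_smul_le htail (w i) hv) hy hT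
    rcases hm with h | ⟨h1, h2, h3, h4⟩
    · exact Or.inl h
    · exact Or.inr ⟨h1, h2, E_smul_nonpos hX₀ h3 h4 (w i)⟩

theorem measurableSet_exists_partialSum (hX : ∀ n, 1 ≤ n → X n ∈ S.H) {f : ℕ → ℝ → ℝ}
    {s : Set ℝ} (hf : ∀ i, Measurable (f i)) (hs : MeasurableSet s) (n : ℕ) :
    MeasurableSet {ω | ∃ k, 1 ≤ k ∧ k ≤ n ∧ ∑ i ∈ Finset.Icc 1 k, f i (X i ω) ∈ s} := by
  simp only [ofPred_exists, ofPred_and]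
  refine MeasurableSet.iUnion fun k => ?_
  refine MeasurableSet.inter (MeasurableSet.const _) (MeasurableSet.inter (MeasurableSet.const _) ?_)
  exact (Finset.measurable_sum _ fun j hj =>
    (hf j).comp (S.measurable_of_mem _ (hX j (Finset.mem_Icc.1 hj).1))) hs

theorem measurableSet_lt_abs_partialSum (hX : ∀ n, 1 ≤ n → X n ∈ S.H) (w : ℕ → ℝ) (n : ℕ) (u : ℝ) :
    MeasurableSet {ω | ∃ k, 1 ≤ k ∧ k ≤ n ∧ u < |∑ i ∈ Finset.Icc 1 k, w i * X i ω|} :=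
  measurableSet_exists_partialSum hX (f := fun i v => w i * v) (s := {v | u < |v|})
    (fun i => measurable_const_mul (w i)) (measurableSet_lt measurable_const measurable_id.abs) n

/-- Fuk–Nagaev type bound for the maximal weighted partial sum. -/
theorem IndepSeq.V_lt_abs_partialSum_le (hindep : S.IndepSeq X) (hX : ∀ n, 1 ≤ n → X n ∈ S.H)
    (hX₀ : X₀ ∈ S.H) (hident : ∀ n, 1 ≤ n → S.IdentDistrib (X n) X₀) {A m : ℝ} (hA : 0 ≤ A)
    (hm : m < 1 ∨ (1 < m ∧ m < 2 ∧ S.E X₀ ≤ 0 ∧ S.E (fun ω => -X₀ ω) ≤ 0))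
    (htail : ∀ v, 0 < v → S.V {ω | v < |X₀ ω|} ≤ ENNReal.ofReal (A * v ^ (-m)))
    {K u Λ : ℝ} (hK : 0 < K) (hu : 0 < u) (w : ℕ → ℝ) {n : ℕ} (hn : 1 ≤ n) (hΛ0 : 0 < Λ)
    (hΛ : (1 / |1 - m| + 2 / (2 - m)) * A * (u / K) ^ (-m) * ∑ i ∈ Finset.Icc 1 n, |w i| ^ m ≤ Λ) :
    S.V {ω | ∃ k, 1 ≤ k ∧ k ≤ n ∧ u < |∑ i ∈ Finset.Icc 1 k, w i * X i ω|} ≤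
      ∑ i ∈ Finset.Icc 1 n, S.V {ω | u / K < |w i * X₀ ω|} +
        ENNReal.ofReal (2 * Real.exp (K + 1) * Λ ^ (K / 4)) := by
  have hlog := Real.exp_log hΛ0
  have hpow : Λ ^ (K / 4) = Real.exp (Real.log Λ * (K / 4)) := Real.rpow_def_of_pos hΛ0 _
  -- If log Λ ≥ -4, then Λ ^ (K / 4) ≥ exp (-K), so the claimed remainder already exceeds 1. The
  -- factor exp K in the statement serves only this case.
  rcases le_or_gt (-4) (Real.log Λ) with hbig | hsmall
  · refine (V_le_one (measurableSet_lt_abs_partialSum hX w n u)).trans (le_add_left ?_)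
    rw [← ENNReal.ofReal_one]
    apply ENNReal.ofReal_le_ofReal
    rw [hpow, mul_assoc, ← Real.exp_add]
    have : (1 : ℝ) ≤ Real.exp (K + 1 + Real.log Λ * (K / 4)) := by
      apply Real.one_le_exp
      nlinarith
    linarith
  set y := u / K with hy_def
  have hy : 0 < y := by positivity
  -- Chosen so that Λ exp (4 T) = 1. With truncation level y = u / K the exponent becomes at most 1
  -- - T K, which yields e Λ ^ (K / 4).
  set T := -Real.log Λ / 4 with hT_def
  have hT : 1 ≤ T := by rw [hT_def]; linarith
  have hside : ∀ w' : ℕ → ℝ, (∀ i, |w' i| = |w i|) →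
      S.V {ω | ∃ k, 1 ≤ k ∧ k ≤ n ∧ u ≤ ∑ i ∈ Finset.Icc 1 k, truncate y (w' i * X i ω)} ≤
      ENNReal.ofReal (Real.exp (K + 1) * Λ ^ (K / 4)) := by
    intro w' hw'
    refine (hindep.V_sum_truncate_ge_le hX hX₀ hident hA hm htail hy hT w' hn).trans ?_
    apply ENNReal.ofReal_le_ofReal
    rw [hpow, ← Real.exp_add, Real.exp_le_exp]
    simp only [hw']
    have h1 : Λ * Real.exp (4 * T) = 1 := by
      nth_rewrite 1 [← hlog]
      rw [← Real.exp_add, hT_def]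
      simp only [Real.exp_eq_one_iff]
      ring
    have h2 := mul_le_mul_of_nonneg_right hΛ (Real.exp_pos (4 * T)).le
    have h3 : T * u / y = T * K := by rw [hy_def]; field_simp
    have h4 : T * K = -(Real.log Λ * (K / 4)) := by rw [hT_def]; ring
    rw [h3, h4]
    linarith
  have hmt : ∀ w' : ℕ → ℝ, MeasurableSet
      {ω | ∃ k, 1 ≤ k ∧ k ≤ n ∧ u ≤ ∑ i ∈ Finset.Icc 1 k, truncate y (w' i * X i ω)} := fun w' =>
    measurableSet_exists_partialSum hX (f := fun i v => truncate y (w' i * v)) (s := Ici u)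
      (fun i => measurable_truncate.comp (measurable_const_mul (w' i))) measurableSet_Ici n
  have hmX : ∀ i ∈ Finset.Icc 1 n, MeasurableSet {ω | y < |w i * X i ω|} := fun i hi =>
    measurableSet_lt_abs (smul_mem (hX i (Finset.mem_Icc.1 hi).1) (w i)) y
  have hmU : MeasurableSet (⋃ i ∈ Finset.Icc 1 n, {ω | y < |w i * X i ω|}) :=
    Finset.measurableSet_biUnion _ hmX
  -- Either some summand exceeds y, or truncation changes nothing and the truncated sums of w or of
  -- -w reach u.
  have hcover : {ω | ∃ k, 1 ≤ k ∧ k ≤ n ∧ u < |∑ i ∈ Finset.Icc 1 k, w i * X i ω|} ⊆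
      (⋃ i ∈ Finset.Icc 1 n, {ω | y < |w i * X i ω|}) ∪
      ({ω | ∃ k, 1 ≤ k ∧ k ≤ n ∧ u ≤ ∑ i ∈ Finset.Icc 1 k, truncate y (w i * X i ω)} ∪
      {ω | ∃ k, 1 ≤ k ∧ k ≤ n ∧ u ≤ ∑ i ∈ Finset.Icc 1 k, truncate y (-w i * X i ω)}) := by
    rintro ω ⟨k, hk1, hkn, hk⟩
    by_cases hbig : ω ∈ ⋃ i ∈ Finset.Icc 1 n, {ω | y < |w i * X i ω|}
    · exact Or.inl hbig
    right
    have hsmall : ∀ i ∈ Finset.Icc 1 k, |w i * X i ω| ≤ y := by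
      intro i hi
      by_contra hcon
      refine hbig (mem_iUnion₂.2 ⟨i, ?_, not_le.1 hcon⟩)
      rw [Finset.mem_Icc] at hi ⊢
      exact ⟨hi.1, hi.2.trans hkn⟩
    rcases lt_abs.1 hk with h | h
    · refine Or.inl ⟨k, hk1, hkn, h.le.trans (le_of_eq ?_)⟩
      exact Finset.sum_congr rfl fun i hi => (truncate_of_abs_le (hsmall i hi)).symm
    · refine Or.inr ⟨k, hk1, hkn, h.le.trans (le_of_eq ?_)⟩
      rw [← Finset.sum_neg_distrib]
      refine Finset.sum_congr rfl fun i hi => ?_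
      rw [truncate_of_abs_le (by rw [neg_mul, abs_neg]; exact hsmall i hi), neg_mul]
  refine (V_mono (measurableSet_lt_abs_partialSum hX w n u)
    (hmU.union ((hmt w).union (hmt fun i => -w i))) hcover).trans ?_
  refine (V_union_le hmU ((hmt w).union (hmt fun i => -w i))).trans (add_le_add ?_ ?_)
  · refine (V_biUnion_le _ hmX).trans (Finset.sum_le_sum fun i hi => le_of_eq ?_)
    have hi1 := (Finset.mem_Icc.1 hi).1
    rcases eq_or_ne (w i) 0 with h0 | h0
    · simp [h0]
    · have hw' : 0 < |w i| := abs_pos.2 h0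
      simp only [abs_mul, ← div_lt_iff₀' hw']
      exact (hident i hi1).V_lt_abs (hX i hi1) hX₀ _
  · refine (V_union_le (hmt w) (hmt fun i => -w i)).trans
      ((add_le_add (hside w fun i => rfl) (hside (fun i => -w i) fun i => abs_neg _)).trans
        (le_of_eq ?_))
    rw [← ENNReal.ofReal_add (by positivity) (by positivity)]
    congr 1
    ring

end SublinearExpectationSpace

/-! ### Change of variables on half-lines -/

theorem lintegral_Ioi_comp {h h' : ℝ → ℝ} {c d : ℝ} (hd : ∀ z ∈ Ioi c, HasDerivAt h (h' z) z)
    (hmono : StrictMonoOn h (Ici c)) (hcont : ContinuousOn h (Ici c)) (hc : h c = d)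
    (htop : Tendsto h atTop atTop) (f : ℝ → ℝ≥0∞) :
    ∫⁻ x in Ioi d, f x = ∫⁻ z in Ioi c, ENNReal.ofReal |h' z| * f (h z) := by
  have himg : h '' Ioi c = Ioi d := by
    ext x
    constructor
    · rintro ⟨z, hz, rfl⟩
      rw [← hc]
      exact hmono self_mem_Ici (Ioi_subset_Ici_self hz) hz
    · intro hx
      obtain ⟨M, hM1, hM2⟩ := ((htop.eventually_ge_atTop x).and (eventually_ge_atTop c)).exists
      have := intermediate_value_Icc hM2 (hcont.mono Icc_subset_Ici_self)
      obtain ⟨z, hz, rfl⟩ := this (show x ∈ Icc (h c) (h M) from ⟨by rw [hc]; exact le_of_lt hx, hM1⟩)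
      refine ⟨z, lt_of_le_of_ne hz.1 fun hcz => ?_, rfl⟩
      rw [← hcz, hc] at hx
      exact lt_irrefl d hx
  rw [← himg, lintegral_image_eq_lintegral_abs_deriv_mul measurableSet_Ioi
    (fun z hz => (hd z hz).hasDerivWithinAt) (hmono.mono Ioi_subset_Ici_self).injOn]

theorem lintegral_Ioi_scale {k : ℝ} (hk : 0 < k) (c : ℝ) (f : ℝ → ℝ≥0∞) :
    ∫⁻ x in Ioi (k * c), f x = ENNReal.ofReal k * ∫⁻ z in Ioi c, f (k * z) := by
  rw [← lintegral_const_mul' _ _ ENNReal.ofReal_ne_top]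
  have := lintegral_Ioi_comp (h := fun z => k * z) (h' := fun _ => k) (c := c) (d := k * c)
    (fun z _ => by simpa using (hasDerivAt_id z).const_mul k)
    (fun x _ y _ hxy => mul_lt_mul_of_pos_left hxy hk) (by fun_prop) rfl
    (tendsto_id.const_mul_atTop hk) f
  rw [this, abs_of_pos hk]

theorem lintegral_Ioi_rpow_sub {p ε : ℝ} (hp : 0 < p) (hε : 0 ≤ ε) (f : ℝ → ℝ≥0∞) :
    ∫⁻ x in Ioi (0 : ℝ), f x =
      ∫⁻ u in Ioi (ε ^ (1 / p)), ENNReal.ofReal (p * u ^ (p - 1)) * f (u ^ p - ε) := by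
  have hδ : 0 ≤ ε ^ (1 / p) := Real.rpow_nonneg hε _
  rw [lintegral_Ioi_comp (h := fun u => u ^ p - ε) (h' := fun u => p * u ^ (p - 1))
    (c := ε ^ (1 / p)) (d := 0)]
  · refine setLIntegral_congr_fun measurableSet_Ioi fun u hu => ?_
    have hu0 : 0 < u := lt_of_le_of_lt hδ hu
    rw [abs_of_nonneg (by positivity)]
  · intro u hu
    have hu0 : 0 < u := lt_of_le_of_lt hδ hu
    exact (Real.hasDerivAt_rpow_const (Or.inl hu0.ne')).sub_const ε
  · intro x hx y _ hxy
    exact sub_lt_sub_right (Real.rpow_lt_rpow (hδ.trans hx) hxy hp) _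
  · exact ((Real.continuous_rpow_const hp.le).sub continuous_const).continuousOn
  · rw [← Real.rpow_mul hε, one_div_mul_cancel hp.ne', Real.rpow_one, sub_self]
  · exact tendsto_atTop_add_const_right _ _ (tendsto_rpow_atTop hp)

theorem strictMonoOn_rpow_mul_log {s : ℝ} (hs : 0 < s) :
    StrictMonoOn (fun z : ℝ => z ^ s * Real.log z) (Ici 1) := by
  intro x hx y _ hxy
  have hx0 : (0 : ℝ) < x := lt_of_lt_of_le one_pos hx
  have h1 : x ^ s < y ^ s := Real.rpow_lt_rpow hx0.le hxy hs
  have h2 : Real.log x < Real.log y := Real.log_lt_log hx0 hxy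
  have h3 : 0 ≤ Real.log x := Real.log_nonneg hx
  have h4 : 0 < x ^ s := Real.rpow_pos_of_pos hx0 s
  nlinarith

/-- The substitution x = z ^ s log z, which maps z > 1 increasingly onto x > 0; its derivative
produces the logarithmic weight of the critical case. -/
theorem lintegral_Ioi_rpow_mul_log {s : ℝ} (hs : 0 < s) (f : ℝ → ℝ≥0∞) :
    ∫⁻ x in Ioi (0 : ℝ), f x =
      ∫⁻ z in Ioi (1 : ℝ), ENNReal.ofReal (z ^ (s - 1) * (1 + s * Real.log z)) *
        f (z ^ s * Real.log z) := by
  rw [lintegral_Ioi_comp (h := fun z => z ^ s * Real.log z)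
    (h' := fun z => z ^ (s - 1) * (1 + s * Real.log z)) (c := 1) (d := 0)]
  · refine setLIntegral_congr_fun measurableSet_Ioi fun u hu => ?_
    have hu1 : (1 : ℝ) < u := hu
    have := Real.log_pos hu1
    rw [abs_of_nonneg (by positivity)]
  · intro z hz
    have hz0 : (0 : ℝ) < z := lt_trans one_pos hz
    have := (Real.hasDerivAt_rpow_const (p := s) (Or.inl hz0.ne')).mul (Real.hasDerivAt_log hz0.ne')
    refine this.congr_deriv ?_
    rw [Real.rpow_sub_one hz0.ne']
    field_simp
    ring
  · exact strictMonoOn_rpow_mul_log hs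
  · intro z hz
    have hz0 : (0 : ℝ) < z := lt_of_lt_of_le one_pos hz
    exact ((Real.continuousAt_rpow_const _ _ (Or.inl hz0.ne')).mul
      (Real.continuousAt_log hz0.ne')).continuousWithinAt
  · simp
  · exact (tendsto_rpow_atTop hs).atTop_mul_atTop₀ Real.tendsto_log_atTop

/-- The substitution `u = δ b w` in an integral against `p u ^ (p - 1) du`. -/
theorem lintegral_Ioi_rpow_scale {p δ b : ℝ} (hp : 0 < p) (hδ : 0 < δ) (hb : 0 < b)
    (f : ℝ → ℝ≥0∞) :
    ∫⁻ u in Ioi δ, ENNReal.ofReal (p * u ^ (p - 1)) * f (u / (δ * b)) =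
      ENNReal.ofReal (p * δ ^ p) * (ENNReal.ofReal (b ^ p) *
        ∫⁻ w in Ioi (1 / b), ENNReal.ofReal (w ^ (p - 1)) * f w) := by
  have h1 : δ = δ * b * (1 / b) := by field_simp
  have hk : 0 < δ * b := by positivity
  nth_rewrite 1 [h1]
  rw [lintegral_Ioi_scale hk, ← mul_assoc, ← ENNReal.ofReal_mul (by positivity),
    ← lintegral_const_mul' _ _ ENNReal.ofReal_ne_top,
    ← lintegral_const_mul' _ _ ENNReal.ofReal_ne_top]
  refine setLIntegral_congr_fun measurableSet_Ioi fun w hw => ?_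
  have hw0 : 0 < w := lt_trans (by positivity) hw
  rw [mul_div_cancel_left₀ _ hk.ne', ← mul_assoc, ← mul_assoc, ← ENNReal.ofReal_mul hk.le,
    ← ENNReal.ofReal_mul (by positivity)]
  congr 2
  rw [Real.mul_rpow hk.le hw0.le, Real.mul_rpow hδ.le hb.le, Real.rpow_sub_one hδ.ne',
    Real.rpow_sub_one hb.ne']
  field_simp

/-! ### The moment weight -/

/-- The weight `1`, `1 + log z` or `z ^ d`, according to the sign of `d`. -/
def momentWeight (d z : ℝ) : ℝ :=
  if d < 0 then 1 else if d = 0 then 1 + Real.log z else z ^ d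

theorem one_le_momentWeight {d z : ℝ} (hz : 1 ≤ z) : 1 ≤ momentWeight d z := by
  unfold momentWeight
  split_ifs with h1 h2
  · exact le_rfl
  · linarith [Real.log_nonneg hz]
  · exact Real.one_le_rpow hz (not_lt.1 h1)

/-- In the logarithmic case, (1 + a) (1 + b) ≥ 1 + a + b. Submultiplicativity makes finiteness of
the tail moment insensitive to rescaling. -/
theorem momentWeight_mul_le {d y z : ℝ} (hy : 1 ≤ y) (hz : 1 ≤ z) :
    momentWeight d (y * z) ≤ momentWeight d y * momentWeight d z := by
  unfold momentWeight
  have hy0 : 0 < y := by linarith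
  have hz0 : 0 < z := by linarith
  split_ifs with h1 h2
  · norm_num
  · rw [Real.log_mul hy0.ne' hz0.ne']
    nlinarith [mul_nonneg (Real.log_nonneg hy) (Real.log_nonneg hz)]
  · rw [Real.mul_rpow hy0.le hz0.le]

theorem momentWeight_mono {d y z : ℝ} (hy : 1 ≤ y) (hyz : y ≤ z) :
    momentWeight d y ≤ momentWeight d z := by
  unfold momentWeight
  have hy0 : 0 < y := by linarith
  split_ifs with h1 h2
  · exact le_rfl
  · linarith [Real.log_le_log hy0 hyz]
  · exact Real.rpow_le_rpow hy0.le hyz (not_lt.1 h1)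

theorem lintegral_lt_top_of_le_const_mul {f g : ℝ → ℝ≥0∞} {s : Set ℝ} (hs : MeasurableSet s) {C : ℝ}
    (hfg : ∀ z ∈ s, f z ≤ ENNReal.ofReal C * g z) (hg : ∫⁻ z in s, g z < ⊤) :
    ∫⁻ z in s, f z < ⊤ := by
  refine (setLIntegral_mono' hs hfg).trans_lt ?_
  rw [lintegral_const_mul' _ _ ENNReal.ofReal_ne_top]
  exact ENNReal.mul_lt_top ENNReal.ofReal_lt_top hg

/-- The tail integral of `z ^ (p - 1)` times the moment weight against a tail function. -/
def tailMoment (p d : ℝ) (G : ℝ → ℝ≥0∞) : ℝ≥0∞ :=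
  ∫⁻ z in Ioi (1 : ℝ), ENNReal.ofReal (z ^ (p - 1) * momentWeight d z) * G z

section Tail

variable {G : ℝ → ℝ≥0∞}

theorem lintegral_Ioc_rpow_mul_lt_top (hG1 : ∀ v, G v ≤ 1) {p y : ℝ} (hp : 0 < p) (hy : 0 ≤ y) :
    ∫⁻ z in Ioc 0 y, ENNReal.ofReal (z ^ (p - 1)) * G z < ⊤ := by
  calc _ ≤ ∫⁻ z in Ioc 0 y, ENNReal.ofReal (z ^ (p - 1)) :=
        lintegral_mono fun z => mul_le_of_le_one_right' (hG1 z)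
    _ < ⊤ := by
        rw [lintegral_Ioc_rpow (by linarith) hy]
        exact ENNReal.ofReal_lt_top

theorem lintegral_Ioi_zero_lt_top_iff (hG1 : ∀ v, G v ≤ 1) {p y : ℝ} (hp : 0 < p) (hy : 0 ≤ y) :
    ∫⁻ z in Ioi (0 : ℝ), ENNReal.ofReal (z ^ (p - 1)) * G z < ⊤ ↔
      ∫⁻ z in Ioi y, ENNReal.ofReal (z ^ (p - 1)) * G z < ⊤ := by
  constructor
  · exact fun h => (lintegral_mono_set (Ioi_subset_Ioi hy)).trans_lt h
  · intro h
    rw [← Ioc_union_Ioi_eq_Ioi hy]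
    refine (lintegral_union_le _ _ _).trans_lt ?_
    exact ENNReal.add_lt_top.2 ⟨lintegral_Ioc_rpow_mul_lt_top hG1 hp hy, h⟩

theorem lintegral_rpow_lt_top_of_tailMoment (hG1 : ∀ v, G v ≤ 1) {p d : ℝ} (hp : 0 < p)
    (h : tailMoment p d G < ⊤) :
    ∫⁻ z in Ioi (0 : ℝ), ENNReal.ofReal (z ^ (p - 1)) * G z < ⊤ := by
  rw [lintegral_Ioi_zero_lt_top_iff hG1 hp zero_le_one]
  refine lt_of_le_of_lt (setLIntegral_mono' measurableSet_Ioi fun z hz => ?_) h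
  have hz0 : (0 : ℝ) < z := lt_trans one_pos hz
  gcongr
  exact le_mul_of_one_le_right (by positivity) (one_le_momentWeight (le_of_lt hz))

/-- For c ≥ 1 monotonicity of G is enough. For c < 1 substitute z / c: the part up to 1 is finite
since G ≤ 1, and beyond 1 the weight at z / c is at most a constant times the weight at z. -/
theorem tailMoment_scale_lt_top (hG : Antitone G) (hG1 : ∀ v, G v ≤ 1) {p d c : ℝ} (hp : 0 < p)
    (hc : 0 < c) (h : tailMoment p d G < ⊤) : tailMoment p d (fun z => G (c * z)) < ⊤ := by
  rcases le_total 1 c with h1 | h1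
  · refine lt_of_le_of_lt (setLIntegral_mono' measurableSet_Ioi fun z hz => ?_) h
    have hz0 : (0 : ℝ) < z := lt_trans one_pos hz
    gcongr
    exact hG (le_mul_of_one_le_left hz0.le h1)
  have hI := lintegral_Ioi_scale hc 1 fun z => ENNReal.ofReal ((z / c) ^ (p - 1) *
    momentWeight d (z / c)) * G z
  simp only [mul_div_cancel_left₀ _ hc.ne', mul_one] at hI
  have hfin : ∫⁻ z in Ioi c, ENNReal.ofReal ((z / c) ^ (p - 1) *
    momentWeight d (z / c)) * G z < ⊤ := by
    have hc1 : 1 ≤ 1 / c := (one_le_div hc).2 h1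
    have hrw : ∀ z, 0 < z → (z / c) ^ (p - 1) = (1 / c) ^ (p - 1) * z ^ (p - 1) := fun z hz => by
      rw [← Real.mul_rpow (by positivity) hz.le]
      congr 1
      ring
    rw [← Ioc_union_Ioi_eq_Ioi h1]
    refine (lintegral_union_le _ _ _).trans_lt (ENNReal.add_lt_top.2 ⟨?_, ?_⟩)
    · refine lintegral_lt_top_of_le_const_mul measurableSet_Ioc
        (C := (1 / c) ^ (p - 1) * momentWeight d (1 / c))
        (g := fun z => ENNReal.ofReal (z ^ (p - 1)) * G z) (fun z hz => ?_)
        ((lintegral_mono_set (Ioc_subset_Ioc_left hc.le)).trans_lt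
          (lintegral_Ioc_rpow_mul_lt_top hG1 hp zero_le_one))
      have hz0 : 0 < z := hc.trans hz.1
      have hw := one_le_momentWeight (d := d) hc1
      rw [← mul_assoc, ← ENNReal.ofReal_mul (by positivity), hrw z hz0]
      refine mul_le_mul' (ENNReal.ofReal_le_ofReal ?_) le_rfl
      calc (1 / c) ^ (p - 1) * z ^ (p - 1) * momentWeight d (z / c)
          ≤ (1 / c) ^ (p - 1) * z ^ (p - 1) * momentWeight d (1 / c) := by
            gcongr
            refine momentWeight_mono ((one_le_div hc).2 hz.1.le) ?_
            gcongr
            exact hz.2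
        _ = _ := by ring
    · refine lintegral_lt_top_of_le_const_mul measurableSet_Ioi
        (C := (1 / c) ^ (p - 1) * momentWeight d (1 / c))
        (g := fun z => ENNReal.ofReal (z ^ (p - 1) * momentWeight d z) * G z) (fun z hz => ?_) h
      have hz0 : (0 : ℝ) < z := lt_trans one_pos hz
      have hw := one_le_momentWeight (d := d) hc1
      rw [← mul_assoc, ← ENNReal.ofReal_mul (by positivity), hrw z hz0]
      refine mul_le_mul' (ENNReal.ofReal_le_ofReal ?_) le_rfl
      have hmul := momentWeight_mul_le (d := d) hc1 (le_of_lt hz)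
      calc (1 / c) ^ (p - 1) * z ^ (p - 1) * momentWeight d (z / c)
          ≤ (1 / c) ^ (p - 1) * z ^ (p - 1) * (momentWeight d (1 / c) * momentWeight d z) := by
            gcongr
            rwa [one_div_mul_eq_div] at hmul
        _ = _ := by ring
  rw [hI] at hfin
  unfold tailMoment
  by_contra hcon
  rw [not_lt, top_le_iff] at hcon
  rw [hcon, ENNReal.mul_top (by simpa using hc)] at hfin
  exact lt_irrefl _ hfin

/-- A finite moment gives a power tail. -/
theorem exists_tail_le_rpow (hG : Antitone G) (hG1 : ∀ v, G v ≤ 1) {s m : ℝ} (hs : 0 < s)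
    (hm0 : 0 < m) (hm : m ≤ s)
    (h : ∫⁻ z in Ioi (0 : ℝ), ENNReal.ofReal (z ^ (s - 1)) * G z < ⊤) :
    ∃ A : ℝ, 0 ≤ A ∧ ∀ v, 0 < v → G v ≤ ENNReal.ofReal (A * v ^ (-m)) := by
  set I := ∫⁻ z in Ioi (0 : ℝ), ENNReal.ofReal (z ^ (s - 1)) * G z with hI
  refine ⟨max 1 (s * I.toReal), by positivity, fun v hv => ?_⟩
  rcases le_total v 1 with hv1 | hv1
  · refine (hG1 v).trans ?_
    rw [← ENNReal.ofReal_one]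
    apply ENNReal.ofReal_le_ofReal
    have h1 : 1 ≤ v ^ (-m) := Real.one_le_rpow_of_pos_of_le_one_of_nonpos hv hv1 (by linarith)
    have h2 : (1 : ℝ) ≤ max 1 (s * I.toReal) := le_max_left _ _
    nlinarith
  -- Markov's inequality for a decreasing tail: G v is at most G z for every z ≤ v.
  · have h1 : ENNReal.ofReal (v ^ s / s) * G v ≤ I := by
      calc ENNReal.ofReal (v ^ s / s) * G v
          = ∫⁻ z in Ioc 0 v, ENNReal.ofReal (z ^ (s - 1)) * G v := by
            rw [lintegral_mul_const' _ _ ((hG1 v).trans_lt ENNReal.one_lt_top).ne,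
              lintegral_Ioc_rpow (by linarith) hv.le, sub_add_cancel]
        _ ≤ ∫⁻ z in Ioc 0 v, ENNReal.ofReal (z ^ (s - 1)) * G z := by
            refine setLIntegral_mono' measurableSet_Ioc fun z hz => ?_
            gcongr
            exact hG hz.2
        _ ≤ I := lintegral_mono_set Ioc_subset_Ioi_self
    have hvs : 0 < v ^ s / s := by positivity
    rw [← ENNReal.ofReal_toReal h.ne, mul_comm,
      ← ENNReal.le_div_iff_mul_le (Or.inl (by simpa using hvs)) (Or.inl ENNReal.ofReal_ne_top),
      ← ENNReal.ofReal_div_of_pos hvs] at h1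
    refine h1.trans (ENNReal.ofReal_le_ofReal ?_)
    have h3 : v ^ (-s) ≤ v ^ (-m) := Real.rpow_le_rpow_of_exponent_le hv1 (by linarith)
    calc I.toReal / (v ^ s / s) = s * I.toReal * v ^ (-s) := by
          rw [Real.rpow_neg hv.le]; field_simp
      _ ≤ max 1 (s * I.toReal) * v ^ (-m) := by
          gcongr
          exact le_max_right _ _

end Tail

/-! ### Power sums -/

theorem tsum_pnat_ofReal_rpow_lt_top {η : ℝ} (hη : 0 < η) :
    ∑' i : ℕ+, ENNReal.ofReal ((i : ℝ) ^ (-1 - η)) < ⊤ := by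
  have h : Summable fun i : ℕ => (i : ℝ) ^ (-1 - η) := Real.summable_nat_rpow.2 (by linarith)
  have h2 : Summable fun i : ℕ+ => ((i : ℕ) : ℝ) ^ (-1 - η) :=
    h.comp_injective PNat.coe_injective
  exact h2.tsum_ofReal_lt_top

/-- With t = 1 / (n + 1), factor out (n + 1) ^ e. Bernoulli's inequality and monotonicity in the
exponent place 1 - (1 - t) ^ e between t and e t, in an order depending on whether e ≥ 1.
Telescoping then gives the power sums. -/
theorem exists_rpow_sub_rpow_bounds {e : ℝ} (he : 0 < e) :
    ∃ C : ℝ, 0 < C ∧ ∀ n : ℕ,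
      ((n : ℝ) + 1) ^ (e - 1) ≤ C * (((n : ℝ) + 1) ^ e - (n : ℝ) ^ e) ∧
      ((n : ℝ) + 1) ^ e - (n : ℝ) ^ e ≤ C * ((n : ℝ) + 1) ^ (e - 1) := by
  refine ⟨max e (1 / e), by positivity, fun n => ?_⟩
  have hn : (0 : ℝ) < (n : ℝ) + 1 := by positivity
  set t : ℝ := 1 / ((n : ℝ) + 1) with ht
  have ht0 : 0 < t := by positivity
  have ht1 : t ≤ 1 := by rw [ht, div_le_one hn]; linarith [n.cast_nonneg (α := ℝ)]
  have hpow : ((n : ℝ) + 1) ^ (e - 1) = ((n : ℝ) + 1) ^ e * t := by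
    rw [Real.rpow_sub_one hn.ne', ht]; ring
  have hsub : (n : ℝ) ^ e = ((n : ℝ) + 1) ^ e * (1 + -t) ^ e := by
    rw [← Real.mul_rpow hn.le (by linarith)]
    congr 1
    rw [ht]; field_simp; ring
  have hne : 0 < ((n : ℝ) + 1) ^ e := Real.rpow_pos_of_pos hn e
  have hbase : 0 ≤ 1 + -t := by linarith
  have key : t ≤ max e (1 / e) * (1 - (1 + -t) ^ e) ∧ 1 - (1 + -t) ^ e ≤ max e (1 / e) * t := by
    have m1 : e ≤ max e (1 / e) := le_max_left _ _
    have m2 : 1 / e ≤ max e (1 / e) := le_max_right _ _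
    rcases le_total 1 e with h | h
    · have h1 := one_add_mul_self_le_rpow_one_add (s := -t) (by linarith) h
      have h2 : (1 + -t) ^ e ≤ 1 + -t := by
        simpa using Real.rpow_le_rpow_of_exponent_ge' hbase (by linarith) zero_le_one h
      constructor
      · nlinarith
      · nlinarith
    · have h1 := rpow_one_add_le_one_add_mul_self (s := -t) (by linarith) he.le h
      have h2 : 1 + -t ≤ (1 + -t) ^ e := by
        simpa using Real.rpow_le_rpow_of_exponent_ge' hbase (by linarith) he.le h
      have m3 : 1 ≤ 1 / e := (one_le_div he).2 h
      constructor
      · have h3 : e * t ≤ 1 - (1 + -t) ^ e := by linarith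
        calc t = 1 / e * (e * t) := by field_simp
          _ ≤ max e (1 / e) * (1 - (1 + -t) ^ e) := by gcongr
      · nlinarith
  rw [hpow, hsub]
  have e1 : ((n : ℝ) + 1) ^ e - ((n : ℝ) + 1) ^ e * (1 + -t) ^ e =
      ((n : ℝ) + 1) ^ e * (1 - (1 + -t) ^ e) := by ring
  rw [e1]
  constructor
  · calc _ ≤ ((n : ℝ) + 1) ^ e * (max e (1 / e) * (1 - (1 + -t) ^ e)) := by gcongr; exact key.1
      _ = _ := by ring
  · calc _ ≤ ((n : ℝ) + 1) ^ e * (max e (1 / e) * t) := by gcongr; exact key.2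
      _ = _ := by ring

/-- Two-sided bounds for `∑_{n ≤ M} n ^ (e - 1)`, `e > 0`. -/
theorem exists_sum_rpow_bounds {e : ℝ} (he : 0 < e) :
    ∃ C : ℝ, 0 < C ∧ ∀ M : ℕ,
      ∑ n ∈ Finset.range M, ((n : ℝ) + 1) ^ (e - 1) ≤ C * (M : ℝ) ^ e ∧
      (M : ℝ) ^ e ≤ C * ∑ n ∈ Finset.range M, ((n : ℝ) + 1) ^ (e - 1) := by
  obtain ⟨C, hC, h⟩ := exists_rpow_sub_rpow_bounds he
  refine ⟨C, hC, fun M => ?_⟩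
  have htel : ∑ n ∈ Finset.range M, (((n : ℝ) + 1) ^ e - (n : ℝ) ^ e) = (M : ℝ) ^ e := by
    have := Finset.sum_range_sub (fun n : ℕ => (n : ℝ) ^ e) M
    simpa [Real.zero_rpow he.ne'] using this
  rw [← htel, Finset.mul_sum, Finset.mul_sum]
  exact ⟨Finset.sum_le_sum fun n _ => (h n).1, Finset.sum_le_sum fun n _ => (h n).2⟩

theorem sum_inv_le_one_add_log (M : ℕ) :
    ∑ n ∈ Finset.range M, ((n : ℝ) + 1) ^ ((0 : ℝ) - 1) ≤ 1 + Real.log M := by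
  have := harmonic_le_one_add_log M
  simp only [harmonic] at this
  push_cast at this
  simpa [Real.rpow_neg_one] using this

theorem log_add_one_le_sum_inv (M : ℕ) :
    Real.log (M + 1) ≤ ∑ n ∈ Finset.range M, ((n : ℝ) + 1) ^ ((0 : ℝ) - 1) := by
  have := log_add_one_le_harmonic M
  simp only [harmonic] at this
  push_cast at this
  simpa [Real.rpow_neg_one] using this

/-- Upper bound for `∑_{n ≤ v} n ^ (e - 1)`, `e ≥ 0`, by the moment weight. -/
theorem exists_tsum_le_momentWeight {e : ℝ} (he : 0 ≤ e) :
    ∃ C : ℝ, 0 < C ∧ ∀ v : ℝ, 1 ≤ v →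
      ∑' n : ℕ+, (if (n : ℝ) ≤ v then ENNReal.ofReal ((n : ℝ) ^ (e - 1)) else 0) ≤
        ENNReal.ofReal (C * momentWeight e v) := by
  have hsum : ∀ v : ℝ, 1 ≤ v →
      ∑' n : ℕ+, (if (n : ℝ) ≤ v then ENNReal.ofReal ((n : ℝ) ^ (e - 1)) else 0) =
      ENNReal.ofReal (∑ n ∈ Finset.range ⌊v⌋₊, ((n : ℝ) + 1) ^ (e - 1)) := by
    intro v hv
    rw [tsum_pnat_eq_tsum_succ
      (f := fun n : ℕ => if (n : ℝ) ≤ v then ENNReal.ofReal ((n : ℝ) ^ (e - 1)) else 0),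
      tsum_eq_sum (s := Finset.range ⌊v⌋₊), ENNReal.ofReal_sum_of_nonneg]
    · refine Finset.sum_congr rfl fun n hn => ?_
      have : ((n + 1 : ℕ) : ℝ) ≤ v :=
        (Nat.le_floor_iff (by linarith)).1 (Finset.mem_range.1 hn)
      rw [if_pos this]
      push_cast
      rfl
    · intro n _; positivity
    · intro n hn
      rw [if_neg]
      intro hcon
      exact hn (Finset.mem_range.2 ((Nat.le_floor_iff (by linarith)).2 hcon))
  have hfl : ∀ v : ℝ, 1 ≤ v → (1 : ℝ) ≤ ⌊v⌋₊ ∧ (⌊v⌋₊ : ℝ) ≤ v := fun v hv =>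
    ⟨by exact_mod_cast (Nat.one_le_floor_iff v).2 hv, Nat.floor_le (by linarith)⟩
  rcases he.eq_or_lt with rfl | he
  · refine ⟨1, one_pos, fun v hv => ?_⟩
    rw [hsum v hv]
    apply ENNReal.ofReal_le_ofReal
    refine (sum_inv_le_one_add_log _).trans ?_
    obtain ⟨h1, h2⟩ := hfl v hv
    simp only [momentWeight, lt_irrefl, if_false, if_true, one_mul]
    linarith [Real.log_le_log (by linarith) h2]
  · obtain ⟨C, hC, h⟩ := exists_sum_rpow_bounds he
    refine ⟨C, hC, fun v hv => ?_⟩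
    rw [hsum v hv]
    apply ENNReal.ofReal_le_ofReal
    refine (h _).1.trans ?_
    obtain ⟨h1, h2⟩ := hfl v hv
    simp only [momentWeight, not_lt.2 he.le, if_false, he.ne']
    gcongr

/-- Lower bound for `∑_{N ≤ n < v} n ^ (e - 1)` by the moment weight, up to a constant. -/
theorem exists_momentWeight_le_tsum (e : ℝ) (N : ℕ) :
    ∃ C : ℝ, 0 < C ∧ ∀ v : ℝ, 1 < v → ENNReal.ofReal (momentWeight e v) ≤ ENNReal.ofReal C *
      (∑' n : ℕ+, (if N ≤ (n : ℕ) ∧ (n : ℝ) < v then ENNReal.ofReal ((n : ℝ) ^ (e - 1)) else 0)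
        + 1) := by
  rcases lt_or_ge e 0 with he | he
  · refine ⟨1, one_pos, fun v _ => ?_⟩
    simp [momentWeight, he]
  have hlow : ∀ M : ℕ, ∀ v : ℝ, (M : ℝ) < v →
      ENNReal.ofReal (∑ n ∈ Finset.range M, ((n : ℝ) + 1) ^ (e - 1)) ≤
      (∑' n : ℕ+, (if N ≤ (n : ℕ) ∧ (n : ℝ) < v then ENNReal.ofReal ((n : ℝ) ^ (e - 1)) else 0))
        + ENNReal.ofReal (∑ n ∈ Finset.range N, ((n : ℝ) + 1) ^ (e - 1)) := by
    intro M v hM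
    rw [tsum_pnat_eq_tsum_succ (f := fun n : ℕ =>
      if N ≤ n ∧ (n : ℝ) < v then ENNReal.ofReal ((n : ℝ) ^ (e - 1)) else 0),
      ENNReal.ofReal_sum_of_nonneg fun n _ => by positivity,
      ENNReal.ofReal_sum_of_nonneg fun n _ => by positivity,
      ← Finset.sum_filter_add_sum_filter_not (Finset.range M) (fun n => N ≤ n + 1)]
    refine add_le_add ?_ ?_
    · refine le_trans (le_of_eq ?_) (ENNReal.sum_le_tsum ((Finset.range M).filter
        (fun n => N ≤ n + 1)))
      refine Finset.sum_congr rfl fun n hn => ?_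
      rw [Finset.mem_filter, Finset.mem_range] at hn
      have : ((n + 1 : ℕ) : ℝ) < v := lt_of_le_of_lt (by exact_mod_cast hn.1) hM
      rw [if_pos ⟨hn.2, this⟩]
      push_cast
      rfl
    · refine Finset.sum_le_sum_of_subset fun n hn => ?_
      rw [Finset.mem_filter] at hn
      rw [Finset.mem_range]
      omega
  -- D dominates the omitted terms with index below N; the summand 1 on the right-hand side of the
  -- claim pays for it.
  set D := ∑ n ∈ Finset.range N, ((n : ℝ) + 1) ^ (e - 1) with hD
  have hD0 : 0 ≤ D := Finset.sum_nonneg fun n _ => by positivity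
  have hfin : ∀ (c : ℝ) (_ : 0 < c) (M : ℕ) (v : ℝ) (_ : (M : ℝ) < v)
      (_ : momentWeight e v ≤ c * (∑ n ∈ Finset.range M, ((n : ℝ) + 1) ^ (e - 1) + 1)),
      ENNReal.ofReal (momentWeight e v) ≤ ENNReal.ofReal (c * (1 + D)) *
      (∑' n : ℕ+, (if N ≤ (n : ℕ) ∧ (n : ℝ) < v then ENNReal.ofReal ((n : ℝ) ^ (e - 1)) else 0)
        + 1) := by
    intro c hc M v hM hv
    have hs0 : 0 ≤ ∑ n ∈ Finset.range M, ((n : ℝ) + 1) ^ (e - 1) :=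
      Finset.sum_nonneg fun n _ => by positivity
    set W := ∑' n : ℕ+, (if N ≤ (n : ℕ) ∧ (n : ℝ) < v then
      ENNReal.ofReal ((n : ℝ) ^ (e - 1)) else 0) with hS
    refine (ENNReal.ofReal_le_ofReal hv).trans ?_
    rw [ENNReal.ofReal_mul hc.le, ENNReal.ofReal_mul hc.le, mul_assoc,
      ENNReal.ofReal_add hs0 zero_le_one, ENNReal.ofReal_one]
    refine mul_le_mul' le_rfl ?_
    calc _ ≤ W + ENNReal.ofReal D + 1 := add_le_add (hlow M v hM) le_rfl
      _ ≤ ENNReal.ofReal (1 + D) * W + ENNReal.ofReal (1 + D) := by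
          rw [ENNReal.ofReal_add zero_le_one hD0, ENNReal.ofReal_one, add_assoc,
            add_comm (ENNReal.ofReal D)]
          refine add_le_add ?_ le_rfl
          exact le_mul_of_one_le_left' (le_add_right le_rfl)
      _ = _ := by rw [mul_add, mul_one]
  have hM : ∀ v : ℝ, 1 < v → ∃ M : ℕ, 1 ≤ M ∧ (M : ℝ) < v ∧ v ≤ M + 1 := by
    intro v hv
    have h1 : 1 < ⌈v⌉₊ := Nat.lt_ceil.2 (by exact_mod_cast hv)
    obtain ⟨M, hM⟩ := Nat.exists_eq_add_of_lt h1
    refine ⟨1 + M, by omega, ?_, ?_⟩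
    · exact Nat.lt_ceil.1 (by omega)
    · have := Nat.le_ceil v
      rw [hM] at this
      exact_mod_cast this
  rcases he.eq_or_lt with rfl | he
  · refine ⟨1 * (1 + D), by positivity, fun v hv => ?_⟩
    obtain ⟨M, hM1, hM2, hM3⟩ := hM v hv
    refine hfin 1 one_pos M v hM2 ?_
    have h1 := log_add_one_le_sum_inv M
    have h2 := Real.log_le_log (by linarith) hM3
    simp only [momentWeight, lt_irrefl, if_false, if_true, one_mul]
    linarith
  · obtain ⟨C, hC, h⟩ := exists_sum_rpow_bounds he
    -- The factor 2 ^ e comes from v ≤ M + 1 ≤ 2 M, where M is the largest integer strictly below v.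
    refine ⟨2 ^ e * C * (1 + D), by positivity, fun v hv => ?_⟩
    obtain ⟨M, hM1, hM2, hM3⟩ := hM v hv
    refine hfin (2 ^ e * C) (by positivity) M v hM2 ?_
    have hM1' : (1 : ℝ) ≤ M := by exact_mod_cast hM1
    simp only [momentWeight, not_lt.2 he.le, if_false, he.ne']
    calc v ^ e ≤ (2 * M) ^ e := by gcongr; linarith
      _ = 2 ^ e * (M : ℝ) ^ e := Real.mul_rpow (by norm_num) (by positivity)
      _ ≤ 2 ^ e * (C * ∑ n ∈ Finset.range M, ((n : ℝ) + 1) ^ (e - 1)) := by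
          gcongr; exact (h M).2
      _ ≤ 2 ^ e * C * (∑ n ∈ Finset.range M, ((n : ℝ) + 1) ^ (e - 1) + 1) := by
          have : 0 < (2 : ℝ) ^ e * C := by positivity
          nlinarith

/-- Summation over n sees the scale w ^ (1 / α), the tail integral sees w. For d ≠ 0 the two weights
agree; for d = 0 only the coefficient of the logarithm changes. -/
theorem momentWeight_rpow_le {α d w : ℝ} (hα : 0 < α) (hw : 1 ≤ w) :
    momentWeight (α * d) (w ^ (1 / α)) ≤ (1 + 1 / α) * momentWeight d w := by
  have hw0 : 0 < w := by linarith
  have h1 : 0 < 1 / α := by positivity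
  unfold momentWeight
  rcases lt_trichotomy d 0 with h | h | h
  · have : α * d < 0 := mul_neg_of_pos_of_neg hα h
    simp only [h, this, if_true]
    linarith
  · subst h
    simp only [mul_zero, lt_irrefl, if_false, if_true, Real.log_rpow hw0]
    nlinarith [Real.log_nonneg hw]
  · have : 0 < α * d := by positivity
    simp only [not_lt.2 h.le, not_lt.2 this.le, h.ne', this.ne', if_false]
    rw [← Real.rpow_mul hw0.le, ← mul_assoc, one_div_mul_cancel hα.ne', one_mul]
    nlinarith [Real.rpow_pos_of_pos hw0 d]

theorem momentWeight_le_rpow {α d w : ℝ} (hα : 0 < α) (hw : 1 ≤ w) :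
    momentWeight d w ≤ (1 + α) * momentWeight (α * d) (w ^ (1 / α)) := by
  have h1 : 1 ≤ w ^ (1 / α) := Real.one_le_rpow hw (by positivity)
  have := momentWeight_rpow_le (α := 1 / α) (d := α * d) (by positivity) h1
  rw [← mul_assoc, one_div_mul_cancel hα.ne', one_mul, one_div_one_div, ← Real.rpow_mul (by linarith),
    one_div_mul_cancel hα.ne', Real.rpow_one] at this
  exact this

/-! ### Sums over the array of weights -/

/-- The kernel of the series, summed over `n ≥ i`, bounded by the moment weight. -/
theorem exists_kernel_le {r q β p : ℝ} (hr : 1 < r) (hβ₁ : -q < β) (hβ₂ : β < -q / r)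
    (hq : 0 < q) :
    ∃ C : ℝ, 0 < C ∧ ∀ w : ℝ, 1 < w →
      ∑' n : ℕ+, ENNReal.ofReal ((n : ℝ) ^ (r - 2)) * ∑ i ∈ Finset.Icc 1 (n : ℕ),
        (if 1 < w * ((i : ℝ) ^ β * (n : ℝ) ^ (-(q + β))) then
          ENNReal.ofReal (((i : ℝ) ^ β * (n : ℝ) ^ (-(q + β))) ^ p) else 0) ≤
        ENNReal.ofReal (C * momentWeight ((r - 1) / (q + β) - p) w) := by
  set α := q + β with hα_def
  set s := (r - 1) / α with hs_def
  have hα : 0 < α := by linarith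
  have hr0 : 0 < r := by linarith
  -- This is β < -q / r rewritten. Since (q + β) s = r - 1, it also gives β s < -1, the summability
  -- of i ^ (β s).
  have hs : r < q * s := by
    rw [hs_def, mul_div_assoc', lt_div_iff₀ hα]
    have h1 : β * r < -q := by rwa [lt_div_iff₀ hr0] at hβ₂
    rw [hα_def]
    nlinarith
  have hαs : α * s = r - 1 := by rw [hs_def]; field_simp
  have hβs : β * s < -1 := by
    have : (q + β) * s = r - 1 := hαs
    nlinarith
  have hβ0 : β < 0 := by
    have : -q / r < 0 := div_neg_of_neg_of_pos (by linarith) hr0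
    linarith
  -- Interchange the sums: for fixed i the condition on n becomes i ≤ n and n ^ α < w i ^ β.
  have hrearr : ∀ w : ℝ,
      ∑' n : ℕ+, ENNReal.ofReal ((n : ℝ) ^ (r - 2)) * ∑ i ∈ Finset.Icc 1 (n : ℕ),
        (if 1 < w * ((i : ℝ) ^ β * (n : ℝ) ^ (-α)) then
          ENNReal.ofReal (((i : ℝ) ^ β * (n : ℝ) ^ (-α)) ^ p) else 0) =
      ∑' i : ℕ+, ∑' n : ℕ+, (if i ≤ n ∧ (n : ℝ) ^ α < w * (i : ℝ) ^ β then
        ENNReal.ofReal ((i : ℝ) ^ (β * p)) * ENNReal.ofReal ((n : ℝ) ^ (r - 1 - α * p - 1))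
          else 0) := by
    intro w
    rw [ENNReal.tsum_comm]
    refine tsum_congr fun n => ?_
    have hn0 : (0 : ℝ) < n := by exact_mod_cast n.pos
    rw [tsum_eq_sum (s := Finset.Icc 1 n), Finset.mul_sum]
    · have hI : Finset.Icc 1 (n : ℕ) = (Finset.Icc 1 n).map ⟨PNat.val, PNat.coe_injective⟩ :=
        (PNat.map_subtype_embedding_Icc 1 n).symm
      rw [hI, Finset.sum_map]
      refine Finset.sum_congr rfl fun i hi => ?_
      have hi0 : (0 : ℝ) < i := by exact_mod_cast i.pos
      simp only [Function.Embedding.coeFn_mk]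
      have hiff : 1 < w * ((i : ℝ) ^ β * (n : ℝ) ^ (-α)) ↔
          i ≤ n ∧ (n : ℝ) ^ α < w * (i : ℝ) ^ β := by
        rw [and_iff_right (Finset.mem_Icc.1 hi).2, Real.rpow_neg hn0.le, ← mul_assoc,
          ← div_eq_mul_inv, one_lt_div (Real.rpow_pos_of_pos hn0 α)]
      by_cases hc : i ≤ n ∧ (n : ℝ) ^ α < w * (i : ℝ) ^ β
      · rw [if_pos hc, if_pos (hiff.2 hc), ← ENNReal.ofReal_mul (by positivity),
          ← ENNReal.ofReal_mul (by positivity), Real.mul_rpow (by positivity) (by positivity),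
          ← Real.rpow_mul hi0.le, ← Real.rpow_mul hn0.le, mul_left_comm, ← Real.rpow_add hn0]
        congr 3
        ring
      · rw [if_neg hc, if_neg (fun h => hc (hiff.1 h)), mul_zero]
    · intro i hi
      rw [if_neg]
      rintro ⟨h, -⟩
      exact hi (Finset.mem_Icc.2 ⟨one_le, h⟩)
  simp only [hrearr]
  rcases lt_or_ge (s - p) 0 with hd | hd
  -- Here the double series converges without the constraint involving w. The first bound on η lets
  -- a nonpositive power of n pass to i (as i ≤ n), leaving n ^ (-1 - η); the second brings the
  -- total power of i down to -1 - η.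
  · set η := min (α * p - (r - 1)) ((q * p - r) / 2) with hη_def
    have hη : 0 < η := by
      apply lt_min
      · have : α * s < α * p := mul_lt_mul_of_pos_left (by linarith) hα
        linarith
      · have : q * s < q * p := mul_lt_mul_of_pos_left (by linarith) hq
        linarith
    have hη1 : η ≤ α * p - (r - 1) := min_le_left _ _
    have hη2 : η ≤ (q * p - r) / 2 := min_le_right _ _
    have hT := tsum_pnat_ofReal_rpow_lt_top hη
    set T := ∑' i : ℕ+, ENNReal.ofReal ((i : ℝ) ^ (-1 - η)) with hT_def
    refine ⟨(T * T).toReal + 1, by positivity, fun w hw => ?_⟩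
    have hTT : T * T ≠ ⊤ := (ENNReal.mul_lt_top hT hT).ne
    have hmw : momentWeight (s - p) w = 1 := by simp [momentWeight, hd]
    rw [hmw, mul_one, ENNReal.ofReal_add ENNReal.toReal_nonneg zero_le_one,
      ENNReal.ofReal_toReal hTT]
    refine le_add_right ?_
    rw [hT_def, ← ENNReal.tsum_mul_right]
    refine ENNReal.tsum_le_tsum fun i => ?_
    rw [← ENNReal.tsum_mul_left]
    refine ENNReal.tsum_le_tsum fun n => ?_
    split_ifs with hc
    · have hn0 : (0 : ℝ) < n := by exact_mod_cast n.pos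
      have hi0 : (0 : ℝ) < i := by exact_mod_cast i.pos
      have hi1 : (1 : ℝ) ≤ i := by exact_mod_cast Nat.succ_le_of_lt i.pos
      have hin : (i : ℝ) ≤ n := by exact_mod_cast hc.1
      rw [← ENNReal.ofReal_mul (by positivity), ← ENNReal.ofReal_mul (by positivity)]
      apply ENNReal.ofReal_le_ofReal
      have h1 : (n : ℝ) ^ (r - 1 - α * p - 1) =
          (n : ℝ) ^ (r - 1 - α * p + η) * (n : ℝ) ^ (-1 - η) := by
        rw [← Real.rpow_add hn0]; congr 1; ring
      have h2 : (n : ℝ) ^ (r - 1 - α * p + η) ≤ (i : ℝ) ^ (r - 1 - α * p + η) :=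
        Real.rpow_le_rpow_of_nonpos hi0 hin (by linarith)
      have h3 : (i : ℝ) ^ (β * p) * (i : ℝ) ^ (r - 1 - α * p + η) ≤ (i : ℝ) ^ (-1 - η) := by
        rw [← Real.rpow_add hi0]
        refine Real.rpow_le_rpow_of_exponent_le hi1 ?_
        rw [hα_def]
        nlinarith
      calc (i : ℝ) ^ (β * p) * (n : ℝ) ^ (r - 1 - α * p - 1)
          ≤ (i : ℝ) ^ (β * p) * ((i : ℝ) ^ (r - 1 - α * p + η) * (n : ℝ) ^ (-1 - η)) := by
            rw [h1]; gcongr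
        _ ≤ (i : ℝ) ^ (-1 - η) * (n : ℝ) ^ (-1 - η) := by
            rw [← mul_assoc]; gcongr
    · exact zero_le
  -- Here the constraint is essential. Summing n ^ (e - 1) up to (w i ^ β) ^ (1 / α) gives the
  -- weight at w i ^ β, and multiplying by i ^ (β p) leaves at most i ^ (β s) times the weight at w.
  · set e := r - 1 - α * p with he_def
    have hed : e = α * (s - p) := by rw [mul_sub, hαs]
    have he : 0 ≤ e := by rw [hed]; positivity
    obtain ⟨C, hC, hCv⟩ := exists_tsum_le_momentWeight he
    have hT := tsum_pnat_ofReal_rpow_lt_top (η := -(β * s) - 1) (by linarith)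
    set T := ∑' i : ℕ+, ENNReal.ofReal ((i : ℝ) ^ (-1 - (-(β * s) - 1))) with hT_def
    refine ⟨(T.toReal + 1) * (C * (1 + 1 / α)), by positivity, fun w hw => ?_⟩
    have hw0 : 0 < w := by linarith
    have hmw1 := one_le_momentWeight (d := s - p) hw.le
    calc _ ≤ ∑' i : ℕ+, ENNReal.ofReal ((i : ℝ) ^ (-1 - (-(β * s) - 1))) *
          ENNReal.ofReal (C * ((1 + 1 / α) * momentWeight (s - p) w)) := by
          refine ENNReal.tsum_le_tsum fun i => ?_
          have hi0 : (0 : ℝ) < i := by exact_mod_cast i.pos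
          have hi1 : (1 : ℝ) ≤ i := by exact_mod_cast Nat.succ_le_of_lt i.pos
          have hib : (i : ℝ) ^ β ≤ 1 := Real.rpow_le_one_of_one_le_of_nonpos hi1 hβ0.le
          have hib0 : 0 < (i : ℝ) ^ β := Real.rpow_pos_of_pos hi0 β
          rcases lt_or_ge (w * (i : ℝ) ^ β) 1 with hsmall | hbig
          · have hz : ∀ n : ℕ+, ¬ (i ≤ n ∧ (n : ℝ) ^ α < w * (i : ℝ) ^ β) := by
              rintro n ⟨-, h⟩
              have : 1 ≤ (n : ℝ) ^ α := Real.one_le_rpow (by exact_mod_cast Nat.succ_le_of_lt n.pos) hα.le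
              linarith
            simp [hz]
          have hstep : ∑' n : ℕ+, (if i ≤ n ∧ (n : ℝ) ^ α < w * (i : ℝ) ^ β then
              ENNReal.ofReal ((i : ℝ) ^ (β * p)) * ENNReal.ofReal ((n : ℝ) ^ (e - 1)) else 0) ≤
              ENNReal.ofReal ((i : ℝ) ^ (β * p)) *
                ENNReal.ofReal (C * momentWeight e ((w * (i : ℝ) ^ β) ^ (1 / α))) := by
            refine le_trans ?_ (mul_le_mul' le_rfl (hCv _ (Real.one_le_rpow hbig (by positivity))))
            rw [← ENNReal.tsum_mul_left]
            refine ENNReal.tsum_le_tsum fun n => ?_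
            have hn0 : (0 : ℝ) < n := by exact_mod_cast n.pos
            split_ifs with h1 h2
            · exact le_rfl
            · refine absurd ?_ h2
              rw [← Real.rpow_le_rpow_iff hn0.le (by positivity) hα, ← Real.rpow_mul (by positivity),
                one_div_mul_cancel hα.ne', Real.rpow_one]
              exact h1.2.le
            · exact zero_le
            · simp
          refine hstep.trans ?_
          rw [← ENNReal.ofReal_mul (by positivity), ← ENNReal.ofReal_mul (by positivity)]
          apply ENNReal.ofReal_le_ofReal
          have h1 : momentWeight e ((w * (i : ℝ) ^ β) ^ (1 / α)) ≤
              (1 + 1 / α) * momentWeight (s - p) (w * (i : ℝ) ^ β) := by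
            rw [hed]; exact momentWeight_rpow_le hα hbig
          have h2 : (i : ℝ) ^ (β * p) * momentWeight (s - p) (w * (i : ℝ) ^ β) ≤
              (i : ℝ) ^ (-1 - (-(β * s) - 1)) * momentWeight (s - p) w := by
            rcases hd.eq_or_lt with hd0 | hd0
            · have h3 : (i : ℝ) ^ (β * p) = (i : ℝ) ^ (-1 - (-(β * s) - 1)) := by
                congr 1
                have : p = s := by linarith
                rw [this]; ring
              rw [h3]
              have := momentWeight_mono (d := s - p) hbig
                (mul_le_of_le_one_right hw0.le hib)
              gcongr
            · simp only [momentWeight, not_lt.2 hd0.le, hd0.ne', if_false]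
              rw [Real.mul_rpow hw0.le hib0.le, ← Real.rpow_mul hi0.le, mul_left_comm,
                ← Real.rpow_add hi0, mul_comm]
              apply le_of_eq
              congr 2
              ring
          calc (i : ℝ) ^ (β * p) * (C * momentWeight e ((w * (i : ℝ) ^ β) ^ (1 / α)))
              ≤ (i : ℝ) ^ (β * p) * (C * ((1 + 1 / α) * momentWeight (s - p) (w * (i : ℝ) ^ β))) := by
                gcongr
            _ = C * (1 + 1 / α) * ((i : ℝ) ^ (β * p) * momentWeight (s - p) (w * (i : ℝ) ^ β)) := by
                ring
            _ ≤ C * (1 + 1 / α) * ((i : ℝ) ^ (-1 - (-(β * s) - 1)) * momentWeight (s - p) w) := by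
                gcongr
            _ = _ := by ring
      _ = T * ENNReal.ofReal (C * ((1 + 1 / α) * momentWeight (s - p) w)) := by
          rw [ENNReal.tsum_mul_right]
      _ ≤ ENNReal.ofReal (T.toReal + 1) *
          ENNReal.ofReal (C * ((1 + 1 / α) * momentWeight (s - p) w)) := by
          refine mul_le_mul' ?_ le_rfl
          rw [ENNReal.ofReal_add ENNReal.toReal_nonneg zero_le_one, ENNReal.ofReal_toReal hT.ne]
          exact le_add_right le_rfl
      _ = _ := by
          rw [← ENNReal.ofReal_mul (by positivity)]
          congr 1
          ring

/-- The sums of the `m`-th powers of the weights decay like a power of `n`. -/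
theorem exists_sum_weight_rpow_le {q β m : ℝ} (hα : 0 < q + β) (hm : 0 < m) (hqm : 1 < q * m) :
    ∃ C γ : ℝ, 0 < C ∧ 0 < γ ∧ ∀ n : ℕ, 1 ≤ n →
      ∑ i ∈ Finset.Icc 1 n, ((i : ℝ) ^ β * (n : ℝ) ^ (-(q + β))) ^ m ≤ C * (n : ℝ) ^ (-γ) := by
  set η := (q * m - 1) / 2 with hη_def
  have hη : 0 < η := by linarith
  -- Extract a summable i ^ (-1 - η) and bound the rest by n ^ θ. The choice of η leaves (q + β) m -
  -- θ equal to η or to (q + β) m, both positive.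
  set θ := max (β * m + 1 + η) 0 with hθ_def
  have hθ1 : β * m + 1 + η ≤ θ := le_max_left _ _
  have hθ0 : 0 ≤ θ := le_max_right _ _
  have hγ : 0 < (q + β) * m - θ := by
    rcases max_choice (β * m + 1 + η) 0 with h | h <;> rw [hθ_def, h]
    · linarith
    · rw [sub_zero]; positivity
  have hsum : Summable fun i : ℕ => (i : ℝ) ^ (-1 - η) := Real.summable_nat_rpow.2 (by linarith)
  have hnn : ∀ i : ℕ, 0 ≤ (i : ℝ) ^ (-1 - η) := fun i => by positivity
  refine ⟨∑' i : ℕ, (i : ℝ) ^ (-1 - η) + 1, (q + β) * m - θ,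
    add_pos_of_nonneg_of_pos (tsum_nonneg hnn) one_pos, hγ, fun n hn => ?_⟩
  have hn0 : (0 : ℝ) < n := by exact_mod_cast hn
  have hn1 : (1 : ℝ) ≤ n := by exact_mod_cast hn
  calc _ ≤ ∑ i ∈ Finset.Icc 1 n, (i : ℝ) ^ (-1 - η) * (n : ℝ) ^ (-((q + β) * m - θ)) := by
        refine Finset.sum_le_sum fun i hi => ?_
        rw [Finset.mem_Icc] at hi
        have hi0 : (0 : ℝ) < i := by exact_mod_cast hi.1
        have hi1 : (1 : ℝ) ≤ i := by exact_mod_cast hi.1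
        have hin : (i : ℝ) ≤ n := by exact_mod_cast hi.2
        rw [Real.mul_rpow (by positivity) (by positivity), ← Real.rpow_mul hi0.le,
          ← Real.rpow_mul hn0.le]
        have h1 : (i : ℝ) ^ (β * m) = (i : ℝ) ^ (-1 - η) * (i : ℝ) ^ (β * m + 1 + η) := by
          rw [← Real.rpow_add hi0]; congr 1; ring
        have h2 : (i : ℝ) ^ (β * m + 1 + η) ≤ (n : ℝ) ^ θ :=
          (Real.rpow_le_rpow_of_exponent_le hi1 hθ1).trans (Real.rpow_le_rpow hi0.le hin hθ0)
        have h3 : (n : ℝ) ^ (-((q + β) * m - θ)) = (n : ℝ) ^ θ * (n : ℝ) ^ (-(q + β) * m) := by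
          rw [← Real.rpow_add hn0]; congr 1; ring
        rw [h1, h3, mul_assoc]
        gcongr
    _ = (∑ i ∈ Finset.Icc 1 n, (i : ℝ) ^ (-1 - η)) * (n : ℝ) ^ (-((q + β) * m - θ)) := by
        rw [Finset.sum_mul]
    _ ≤ _ := by
        gcongr
        linarith [hsum.sum_le_tsum (Finset.Icc 1 n) fun i _ => hnn i]

/-! ### Series of tail integrals -/

theorem ofReal_mul_lintegral_Ioi_one_div {b p : ℝ} (hb : 0 < b) (hb1 : b ≤ 1) (f : ℝ → ℝ≥0∞) :
    ENNReal.ofReal (b ^ p) * ∫⁻ w in Ioi (1 / b), f w =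
      ∫⁻ w in Ioi 1, (if 1 < w * b then ENNReal.ofReal (b ^ p) else 0) * f w := by
  have h1 : 1 ≤ 1 / b := (one_le_div hb).2 hb1
  rw [← lintegral_const_mul' _ _ ENNReal.ofReal_ne_top, ← lintegral_indicator measurableSet_Ioi,
    ← lintegral_indicator measurableSet_Ioi]
  refine lintegral_congr fun w => ?_
  by_cases hw : 1 / b < w
  · have hw' : 1 < w * b := (div_lt_iff₀ hb).1 hw
    rw [indicator_of_mem (show w ∈ Ioi (1 / b) from hw),
      indicator_of_mem (show w ∈ Ioi (1 : ℝ) from h1.trans_lt hw), if_pos hw']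
  · have hw' : ¬ 1 < w * b := fun h => hw ((div_lt_iff₀ hb).2 h)
    rw [indicator_of_notMem (show w ∉ Ioi (1 / b) from hw)]
    simp [indicator_apply, hw']

theorem measurable_ite_mul {b p : ℝ} {f : ℝ → ℝ≥0∞} (hf : Measurable f) :
    Measurable fun w : ℝ => (if 1 < w * b then ENNReal.ofReal (b ^ p) else 0) * f w :=
  (Measurable.ite (measurableSet_lt measurable_const (measurable_id.mul_const b))
    measurable_const measurable_const).mul hf

theorem measurable_rpow_mul {G : ℝ → ℝ≥0∞} (hG : Antitone G) (p : ℝ) {c : ℝ} (hc : 0 ≤ c) :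
    Measurable fun w : ℝ => ENNReal.ofReal (w ^ (p - 1)) * G (c * w) := by
  have h : Antitone fun w : ℝ => G (c * w) := fun x y hxy =>
    hG (mul_le_mul_of_nonneg_left hxy hc)
  exact (measurable_id.pow_const _).ennreal_ofReal.mul h.measurable

theorem weight_pos_le_one {q β : ℝ} (hα : 0 < q + β) (hβ : β < 0) {n i : ℕ} (hi : 1 ≤ i)
    (hn : 1 ≤ n) : 0 < (i : ℝ) ^ β * (n : ℝ) ^ (-(q + β)) ∧
      (i : ℝ) ^ β * (n : ℝ) ^ (-(q + β)) ≤ 1 := by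
  have hi1 : (1 : ℝ) ≤ i := by exact_mod_cast hi
  have hn1 : (1 : ℝ) ≤ n := by exact_mod_cast hn
  refine ⟨by positivity, mul_le_one₀ (Real.rpow_le_one_of_one_le_of_nonpos hi1 hβ.le) (by positivity)
    (Real.rpow_le_one_of_one_le_of_nonpos hn1 (by linarith))⟩

/-- Substituting u = δ b w for each weight b ≤ 1 puts all integrals on w > 1 against the same
integrand. Tonelli collects the coefficients into the kernel of `exists_kernel_le`. -/
theorem tsum_kernel_lt_top {G : ℝ → ℝ≥0∞} (hG : Antitone G) (hG1 : ∀ v, G v ≤ 1) {r q β p : ℝ}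
    (hr : 1 < r) (hβ₁ : -q < β) (hβ₂ : β < -q / r) (hq : 0 < q) (hp : 0 < p)
    (hT : tailMoment p ((r - 1) / (q + β) - p) G < ⊤) {δ c : ℝ} (hδ : 0 < δ) (hc : 0 < c) :
    ∑' n : ℕ+, ENNReal.ofReal ((n : ℝ) ^ (r - 2)) * ∑ i ∈ Finset.Icc 1 (n : ℕ),
      ∫⁻ u in Ioi δ, ENNReal.ofReal (p * u ^ (p - 1)) *
        G (c * (u / (δ * ((i : ℝ) ^ β * (n : ℝ) ^ (-(q + β)))))) < ⊤ := by
  have hα : 0 < q + β := by linarith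
  have hβ0 : β < 0 := hβ₂.trans (div_neg_of_neg_of_pos (by linarith) (by linarith))
  obtain ⟨C, hC, hK⟩ := exists_kernel_le hr hβ₁ hβ₂ hq (p := p)
  set f : ℝ → ℝ≥0∞ := fun w => ENNReal.ofReal (w ^ (p - 1)) * G (c * w) with hf_def
  have hf : Measurable f := measurable_rpow_mul hG p hc.le
  have hterm : ∀ n : ℕ+, ENNReal.ofReal ((n : ℝ) ^ (r - 2)) * ∑ i ∈ Finset.Icc 1 (n : ℕ),
      ∫⁻ u in Ioi δ, ENNReal.ofReal (p * u ^ (p - 1)) *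
        G (c * (u / (δ * ((i : ℝ) ^ β * (n : ℝ) ^ (-(q + β)))))) =
      ENNReal.ofReal (p * δ ^ p) * ∫⁻ w in Ioi 1, (ENNReal.ofReal ((n : ℝ) ^ (r - 2)) *
        ∑ i ∈ Finset.Icc 1 (n : ℕ), (if 1 < w * ((i : ℝ) ^ β * (n : ℝ) ^ (-(q + β))) then
          ENNReal.ofReal (((i : ℝ) ^ β * (n : ℝ) ^ (-(q + β))) ^ p) else 0)) * f w := by
    intro n
    have h1 : ∀ i ∈ Finset.Icc 1 (n : ℕ), ∫⁻ u in Ioi δ, ENNReal.ofReal (p * u ^ (p - 1)) *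
        G (c * (u / (δ * ((i : ℝ) ^ β * (n : ℝ) ^ (-(q + β)))))) =
        ENNReal.ofReal (p * δ ^ p) * ∫⁻ w in Ioi 1,
          (if 1 < w * ((i : ℝ) ^ β * (n : ℝ) ^ (-(q + β))) then
          ENNReal.ofReal (((i : ℝ) ^ β * (n : ℝ) ^ (-(q + β))) ^ p) else 0) * f w := by
      intro i hi
      obtain ⟨hb0, hb1⟩ := weight_pos_le_one hα hβ0 (Finset.mem_Icc.1 hi).1 n.pos
      rw [lintegral_Ioi_rpow_scale hp hδ hb0 (fun x => G (c * x)),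
        ofReal_mul_lintegral_Ioi_one_div hb0 hb1]
    rw [Finset.sum_congr rfl h1, ← Finset.mul_sum,
      ← lintegral_finsetSum _ fun i _ => measurable_ite_mul hf, mul_left_comm,
      ← lintegral_const_mul' _ _ ENNReal.ofReal_ne_top]
    congr 1
    refine lintegral_congr fun w => ?_
    rw [← Finset.sum_mul, mul_assoc]
  simp only [hterm]
  rw [ENNReal.tsum_mul_left, ← lintegral_tsum]
  · refine ENNReal.mul_lt_top ENNReal.ofReal_lt_top ?_
    refine lintegral_lt_top_of_le_const_mul measurableSet_Ioi (C := C) (fun w hw => ?_)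
      (tailMoment_scale_lt_top hG hG1 hp hc hT)
    have hw0 : (0 : ℝ) < w := lt_trans one_pos hw
    have hw1 := one_le_momentWeight (d := (r - 1) / (q + β) - p) (le_of_lt hw)
    rw [ENNReal.tsum_mul_right]
    refine (mul_le_mul' (hK w hw) le_rfl).trans (le_of_eq ?_)
    rw [hf_def, ENNReal.ofReal_mul hC.le, ENNReal.ofReal_mul (by positivity)]
    ring
  · intro n
    refine Measurable.aemeasurable (Measurable.mul ?_ hf)
    refine measurable_const.mul (Finset.measurable_sum _ fun i _ => ?_)
    exact Measurable.ite (measurableSet_lt measurable_const (measurable_id.mul_const _))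
      measurable_const measurable_const

/-- The converse computation with the single weight n ^ (-α): the coefficients left after Tonelli
are bounded below by the moment weight, up to an additive constant. -/
theorem tailMoment_lt_top_of_tsum {G : ℝ → ℝ≥0∞} (hG : Antitone G) (hG1 : ∀ v, G v ≤ 1)
    {r α p : ℝ} (hα : 0 < α) (hp : 0 < p) {δ : ℝ} (hδ : 0 < δ) (N : ℕ)
    (h : ∑' n : ℕ+, (if N ≤ (n : ℕ) then ENNReal.ofReal ((n : ℝ) ^ (r - 2)) *
      ∫⁻ u in Ioi δ, ENNReal.ofReal (p * u ^ (p - 1)) * G (u / (δ * (n : ℝ) ^ (-α))) else 0) < ⊤) :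
    tailMoment p ((r - 1) / α - p) G < ⊤ := by
  set f : ℝ → ℝ≥0∞ := fun w => ENNReal.ofReal (w ^ (p - 1)) * G w with hf_def
  have hf : Measurable f := by
    simpa using measurable_rpow_mul hG p (c := 1) zero_le_one
  have hcpos : 0 < p * δ ^ p := by positivity
  have hb : ∀ n : ℕ+, 0 < (n : ℝ) ^ (-α) ∧ (n : ℝ) ^ (-α) ≤ 1 := fun n =>
    ⟨Real.rpow_pos_of_pos (by exact_mod_cast n.pos) _,
      Real.rpow_le_one_of_one_le_of_nonpos (by exact_mod_cast Nat.succ_le_of_lt n.pos)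
        (by linarith)⟩
  -- One term beyond N already gives the unweighted tail integral, which absorbs the additive
  -- constant in the lower bound for the kernel.
  have hbase : ∫⁻ w in Ioi (1 : ℝ), f w < ⊤ := by
    let n₀ : ℕ+ := ⟨N + 1, by omega⟩
    have h1 := (ENNReal.le_tsum n₀).trans_lt h
    have hn0 : (0 : ℝ) < (n₀ : ℕ) := by exact_mod_cast n₀.pos
    rw [if_pos (show N ≤ (n₀ : ℕ) from Nat.le_succ N), lintegral_Ioi_rpow_scale hp hδ (hb n₀).1] at h1
    have h2 : ∫⁻ w in Ioi (1 / (n₀ : ℝ) ^ (-α)), f w < ⊤ := by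
      by_contra hcon
      rw [not_lt, top_le_iff] at hcon
      rw [hcon, ENNReal.mul_top, ENNReal.mul_top, ENNReal.mul_top] at h1
      · exact lt_irrefl _ h1
      · simpa using Real.rpow_pos_of_pos hn0 _
      · simpa using hcpos
      · simpa using Real.rpow_pos_of_pos (hb n₀).1 p
    have := (hb n₀).1
    rw [hf_def, ← lintegral_Ioi_zero_lt_top_iff hG1 hp (by positivity)] at h2
    exact (lintegral_Ioi_zero_lt_top_iff hG1 hp zero_le_one).1 h2
  have hterm : ∀ n : ℕ+, (if N ≤ (n : ℕ) then ENNReal.ofReal ((n : ℝ) ^ (r - 2)) *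
      ∫⁻ u in Ioi δ, ENNReal.ofReal (p * u ^ (p - 1)) * G (u / (δ * (n : ℝ) ^ (-α))) else 0) =
      ENNReal.ofReal (p * δ ^ p) * ∫⁻ w in Ioi 1, (if N ≤ (n : ℕ) then
        ENNReal.ofReal ((n : ℝ) ^ (r - 2)) else 0) *
        ((if 1 < w * (n : ℝ) ^ (-α) then ENNReal.ofReal (((n : ℝ) ^ (-α)) ^ p) else 0) * f w) := by
    intro n
    split_ifs with hn
    · rw [lintegral_Ioi_rpow_scale hp hδ (hb n).1,
        ofReal_mul_lintegral_Ioi_one_div (hb n).1 (hb n).2, mul_left_comm,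
        lintegral_const_mul' _ _ ENNReal.ofReal_ne_top]
    · simp
  simp only [hterm] at h
  rw [ENNReal.tsum_mul_left, ← lintegral_tsum fun n =>
    ((measurable_ite_mul hf).const_mul _).aemeasurable] at h
  have hkern : ∫⁻ w in Ioi (1 : ℝ), ∑' n : ℕ+, (if N ≤ (n : ℕ) then
      ENNReal.ofReal ((n : ℝ) ^ (r - 2)) else 0) *
      ((if 1 < w * (n : ℝ) ^ (-α) then ENNReal.ofReal (((n : ℝ) ^ (-α)) ^ p) else 0) * f w) < ⊤ := by
    by_contra hcon
    rw [not_lt, top_le_iff] at hcon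
    rw [hcon, ENNReal.mul_top (by simpa using hcpos)] at h
    exact lt_irrefl _ h
  obtain ⟨C, hC, hlow⟩ := exists_momentWeight_le_tsum (α * ((r - 1) / α - p)) N
  have hsum : ∫⁻ w in Ioi (1 : ℝ), (f w + ∑' n : ℕ+, (if N ≤ (n : ℕ) then
      ENNReal.ofReal ((n : ℝ) ^ (r - 2)) else 0) *
      ((if 1 < w * (n : ℝ) ^ (-α) then ENNReal.ofReal (((n : ℝ) ^ (-α)) ^ p) else 0) * f w)) < ⊤ := by
    rw [lintegral_add_left hf]
    exact ENNReal.add_lt_top.2 ⟨hbase, hkern⟩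
  refine lintegral_lt_top_of_le_const_mul measurableSet_Ioi (C := (1 + α) * C) (fun w hw => ?_) hsum
  have hw1 : (1 : ℝ) < w := hw
  have hw0 : (0 : ℝ) < w := lt_trans one_pos hw1
  set d := (r - 1) / α - p with hd
  have hv1 : 1 < w ^ (1 / α) := Real.one_lt_rpow hw1 (by positivity)
  have hm1 := one_le_momentWeight (d := d) hw1.le
  have h1 : ENNReal.ofReal (momentWeight d w) ≤ ENNReal.ofReal ((1 + α) * C) *
      (∑' n : ℕ+, (if N ≤ (n : ℕ) ∧ (n : ℝ) < w ^ (1 / α) then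
        ENNReal.ofReal ((n : ℝ) ^ (α * d - 1)) else 0) + 1) := by
    refine (ENNReal.ofReal_le_ofReal (momentWeight_le_rpow (d := d) hα hw1.le)).trans ?_
    rw [ENNReal.ofReal_mul (by positivity), ENNReal.ofReal_mul (by positivity), mul_assoc]
    exact mul_le_mul' le_rfl (hlow _ hv1)
  have h2 : ∀ n : ℕ+, (if N ≤ (n : ℕ) ∧ (n : ℝ) < w ^ (1 / α) then
      ENNReal.ofReal ((n : ℝ) ^ (α * d - 1)) else 0) = (if N ≤ (n : ℕ) then
      ENNReal.ofReal ((n : ℝ) ^ (r - 2)) else 0) *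
      (if 1 < w * (n : ℝ) ^ (-α) then ENNReal.ofReal (((n : ℝ) ^ (-α)) ^ p) else 0) := by
    intro n
    have hn0 : (0 : ℝ) < n := by exact_mod_cast n.pos
    have hiff : (n : ℝ) < w ^ (1 / α) ↔ 1 < w * (n : ℝ) ^ (-α) := by
      rw [← Real.rpow_lt_rpow_iff hn0.le (by positivity) hα, ← Real.rpow_mul hw0.le,
        one_div_mul_cancel hα.ne', Real.rpow_one, Real.rpow_neg hn0.le, ← div_eq_mul_inv,
        one_lt_div (Real.rpow_pos_of_pos hn0 α)]
    by_cases hN : N ≤ (n : ℕ)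
    · by_cases hnw : (n : ℝ) < w ^ (1 / α)
      · rw [if_pos ⟨hN, hnw⟩, if_pos hN, if_pos (hiff.1 hnw), ← ENNReal.ofReal_mul (by positivity),
          ← Real.rpow_mul hn0.le, ← Real.rpow_add hn0]
        congr 2
        rw [hd]
        field_simp
        ring
      · rw [if_neg (fun h => hnw h.2), if_neg (fun h => hnw (hiff.2 h)), mul_zero]
    · rw [if_neg (fun h => hN h.1), if_neg hN, zero_mul]
  simp only [h2] at h1
  rw [mul_comm (w ^ (p - 1)), ENNReal.ofReal_mul (by linarith), mul_assoc]
  have h3 : ∑' n : ℕ+, (if N ≤ (n : ℕ) then ENNReal.ofReal ((n : ℝ) ^ (r - 2)) else 0) *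
      ((if 1 < w * (n : ℝ) ^ (-α) then ENNReal.ofReal (((n : ℝ) ^ (-α)) ^ p) else 0) * f w) =
      (∑' n : ℕ+, (if N ≤ (n : ℕ) then ENNReal.ofReal ((n : ℝ) ^ (r - 2)) else 0) *
        (if 1 < w * (n : ℝ) ^ (-α) then ENNReal.ofReal (((n : ℝ) ^ (-α)) ^ p) else 0)) * f w := by
    simp only [← mul_assoc]
    exact ENNReal.tsum_mul_right
  rw [h3]
  refine (mul_le_mul' h1 le_rfl).trans (le_of_eq ?_)
  rw [hf_def]
  ring

/-- The remainder series in the exponential bound converges. -/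
theorem tsum_remainder_lt_top {r p δ m γ κ c D : ℝ} (hδ : 0 < δ) (hp : 0 < p) (hc : 0 ≤ c)
    (hD : 0 ≤ D) (hm : p < m * κ) (hγ : r - 1 < γ * κ) :
    ∑' n : ℕ+, ENNReal.ofReal ((n : ℝ) ^ (r - 2)) * ∫⁻ u in Ioi δ,
      ENNReal.ofReal (p * u ^ (p - 1)) *
        ENNReal.ofReal (D * (c * (n : ℝ) ^ (-γ) * u ^ (-m)) ^ κ) < ⊤ := by
  have hterm : ∀ n : ℕ+, ENNReal.ofReal ((n : ℝ) ^ (r - 2)) * ∫⁻ u in Ioi δ,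
      ENNReal.ofReal (p * u ^ (p - 1)) *
        ENNReal.ofReal (D * (c * (n : ℝ) ^ (-γ) * u ^ (-m)) ^ κ) =
      ENNReal.ofReal (p * D * c ^ κ) * (∫⁻ u in Ioi δ, ENNReal.ofReal (u ^ (p - 1 - m * κ))) *
        ENNReal.ofReal ((n : ℝ) ^ (-1 - (γ * κ - (r - 1)))) := by
    intro n
    have hn0 : (0 : ℝ) < n := by exact_mod_cast n.pos
    rw [← lintegral_const_mul' _ _ ENNReal.ofReal_ne_top,
      ← lintegral_const_mul' _ _ ENNReal.ofReal_ne_top,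
      ← lintegral_mul_const' _ _ ENNReal.ofReal_ne_top]
    refine setLIntegral_congr_fun measurableSet_Ioi fun u hu => ?_
    have hu0 : 0 < u := hδ.trans hu
    rw [← ENNReal.ofReal_mul (by positivity), ← ENNReal.ofReal_mul (by positivity),
      ← ENNReal.ofReal_mul (by positivity), ← ENNReal.ofReal_mul (by positivity)]
    congr 1
    rw [Real.mul_rpow (by positivity) (by positivity), Real.mul_rpow hc (by positivity),
      ← Real.rpow_mul hn0.le, ← Real.rpow_mul hu0.le]
    have e1 : (n : ℝ) ^ (-1 - (γ * κ - (r - 1))) = (n : ℝ) ^ (r - 2) * (n : ℝ) ^ (-γ * κ) := by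
      rw [← Real.rpow_add hn0]; congr 1; ring
    have e2 : u ^ (p - 1 - m * κ) = u ^ (p - 1) * u ^ (-m * κ) := by
      rw [← Real.rpow_add hu0]; congr 1; ring
    rw [e1, e2]
    ring
  simp only [hterm]
  rw [ENNReal.tsum_mul_left]
  refine ENNReal.mul_lt_top (ENNReal.mul_lt_top ENNReal.ofReal_lt_top ?_)
    (tsum_pnat_ofReal_rpow_lt_top (by linarith))
  rw [lintegral_Ioi_rpow (by linarith) hδ]
  exact ENNReal.ofReal_lt_top

/-- A series of finite terms that are eventually dominated by a convergent series. -/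
theorem tsum_pnat_lt_top_of_le {f g : ℕ+ → ℝ≥0∞} {N : ℕ} (hf : ∀ n, f n < ⊤)
    (hfg : ∀ n : ℕ+, N ≤ (n : ℕ) → f n ≤ g n) (hg : ∑' n, g n < ⊤) : ∑' n, f n < ⊤ := by
  classical
  let M : ℕ+ := ⟨N + 1, by omega⟩
  calc ∑' n, f n ≤ ∑' n, (g n + if n < M then f n else 0) := by
        refine ENNReal.tsum_le_tsum fun n => ?_
        split_ifs with h
        · exact le_add_left le_rfl
        · rw [add_zero]
          refine hfg n ?_
          have : M ≤ n := not_lt.1 h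
          have h2 : (M : ℕ) ≤ n := this
          have h3 : (M : ℕ) = N + 1 := rfl
          omega
    _ = ∑' n, g n + ∑ n ∈ Finset.Iio M, f n := by
        rw [ENNReal.tsum_add, tsum_eq_sum (s := Finset.Iio M) (f := fun n => if n < M then f n else 0)]
        · congr 1
          refine Finset.sum_congr rfl fun n hn => ?_
          rw [if_pos (Finset.mem_Iio.1 hn)]
        · intro n hn
          rw [if_neg fun h => hn (Finset.mem_Iio.2 h)]
    _ < ⊤ := ENNReal.add_lt_top.2 ⟨hg, ENNReal.sum_lt_top.2 fun n _ => hf n⟩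

namespace SublinearExpectationSpace

variable {Ω : Type*} [MeasurableSpace Ω] {S : SublinearExpectationSpace Ω}

/-! ### Choquet expectations as tail integrals -/

/-- For x < -c the tail is the whole space, so the negative part is an integral of a function
bounded by 1 over a bounded interval. -/
theorem choquet_lt_top_iff {Y : Ω → ℝ} {c : ℝ} (hc : ∀ ω, -c ≤ Y ω) :
    S.choquet Y < ⊤ ↔ ∫⁻ x in Ioi (0 : ℝ), S.V {ω | x < Y ω} < ⊤ := by
  have hB : ∫⁻ x in Iio (0 : ℝ), (1 - S.V {ω | x < Y ω}) < ⊤ := by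
    calc ∫⁻ x in Iio (0 : ℝ), (1 - S.V {ω | x < Y ω})
        ≤ ∫⁻ x, (Icc (-c) 0).indicator (fun _ => (1 : ℝ≥0∞)) x := by
          rw [← lintegral_indicator measurableSet_Iio]
          refine lintegral_mono fun x => ?_
          by_cases hx : x ∈ Icc (-c) 0
          · rw [indicator_of_mem hx]
            exact indicator_apply_le' (fun _ => tsub_le_self) (fun _ => zero_le_one)
          · rw [indicator_of_notMem hx]
            refine indicator_apply_le' (fun h0 => ?_) fun _ => le_rfl
            have hxc : x < -c := not_le.1 fun h => hx ⟨h, le_of_lt h0⟩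
            have : {ω | x < Y ω} = univ := eq_univ_of_forall fun ω => hxc.trans_le (hc ω)
            rw [this, V_univ, tsub_self]
      _ < ⊤ := by
          rw [lintegral_indicator measurableSet_Icc, setLIntegral_const, Real.volume_Icc, one_mul]
          exact ENNReal.ofReal_lt_top
  unfold choquet
  generalize (∫⁻ x in Ioi (0 : ℝ), S.V {ω | x < Y ω}) = A
  generalize (∫⁻ x in Iio (0 : ℝ), (1 - S.V {ω | x < Y ω})) = B at hB
  have hB' : (B : EReal) = ((B.toReal : ℝ) : EReal) := (EReal.coe_ennreal_toReal hB.ne).symm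
  rw [hB']
  rcases eq_or_ne A ⊤ with rfl | hA
  · simp
  · have hA' : (A : EReal) = ((A.toReal : ℝ) : EReal) := (EReal.coe_ennreal_toReal hA).symm
    rw [hA', ← EReal.coe_sub]
    exact ⟨fun _ => lt_top_iff_ne_top.2 hA, fun _ => EReal.coe_lt_top _⟩

theorem choquet_toENNReal {Y : Ω → ℝ} (h0 : ∀ ω, 0 ≤ Y ω) :
    (S.choquet Y).toENNReal = ∫⁻ x in Ioi (0 : ℝ), S.V {ω | x < Y ω} := by
  have hB : ∫⁻ x in Iio (0 : ℝ), (1 - S.V {ω | x < Y ω}) = 0 := by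
    rw [setLIntegral_congr_fun (g := fun _ => 0) measurableSet_Iio, lintegral_zero]
    intro x hx
    have : {ω | x < Y ω} = univ := eq_univ_of_forall fun ω => lt_of_lt_of_le hx (h0 ω)
    beta_reduce
    rw [this, V_univ, tsub_self]
  unfold choquet
  rw [hB]
  simp

variable {X : ℕ → Ω → ℝ} {X₀ : Ω → ℝ}

theorem antitone_V_lt_abs (hX₀ : X₀ ∈ S.H) : Antitone fun v : ℝ => S.V {ω | v < |X₀ ω|} :=
  fun u v huv => V_mono (measurableSet_lt_abs hX₀ v) (measurableSet_lt_abs hX₀ u)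
    fun _ hω => lt_of_le_of_lt huv hω

theorem choquet_rpow_lt_top_iff {p : ℝ} (hp : 0 < p) :
    S.choquet (fun ω => |X₀ ω| ^ p) < ⊤ ↔
      ∫⁻ z in Ioi (0 : ℝ), ENNReal.ofReal (z ^ (p - 1)) * S.V {ω | z < |X₀ ω|} < ⊤ := by
  rw [choquet_lt_top_iff (c := 0) fun ω => by simpa using Real.rpow_nonneg (abs_nonneg _) p,
    lintegral_Ioi_rpow_sub hp le_rfl, Real.zero_rpow (by positivity)]
  have : ∫⁻ u in Ioi (0 : ℝ), ENNReal.ofReal (p * u ^ (p - 1)) *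
      S.V {ω | u ^ p - 0 < |X₀ ω| ^ p} = ENNReal.ofReal p *
      ∫⁻ z in Ioi (0 : ℝ), ENNReal.ofReal (z ^ (p - 1)) * S.V {ω | z < |X₀ ω|} := by
    rw [← lintegral_const_mul' _ _ ENNReal.ofReal_ne_top]
    refine setLIntegral_congr_fun measurableSet_Ioi fun u hu => ?_
    have hu0 : 0 < u := hu
    simp only [sub_zero, Real.rpow_lt_rpow_iff hu0.le (abs_nonneg _) hp]
    rw [ENNReal.ofReal_mul hp.le, mul_assoc]
  rw [this]
  constructor
  · intro h
    by_contra hcon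
    rw [not_lt, top_le_iff] at hcon
    rw [hcon, ENNReal.mul_top (by simpa using hp)] at h
    exact lt_irrefl _ h
  · exact fun h => ENNReal.mul_lt_top ENNReal.ofReal_lt_top h

theorem choquet_rpow_mul_log_lt_top_iff {s : ℝ} (hs : 0 < s) :
    S.choquet (fun ω => |X₀ ω| ^ s * Real.log |X₀ ω|) < ⊤ ↔
      ∫⁻ z in Ioi (1 : ℝ), ENNReal.ofReal (z ^ (s - 1) * (1 + s * Real.log z)) *
        S.V {ω | z < |X₀ ω|} < ⊤ := by
  -- From exp t ≥ 1 + t at t = -s log z; it makes the negative part of the Choquet integral finite.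
  have hbelow : ∀ z : ℝ, 0 ≤ z → -(1 / s) ≤ z ^ s * Real.log z := by
    intro z hz
    rcases hz.eq_or_lt with rfl | hz
    · simp [hs.le]
    have hzs : 0 < z ^ s := Real.rpow_pos_of_pos hz s
    have h1 := Real.add_one_le_exp (-(s * Real.log z) )
    have h2 : Real.exp (-(s * Real.log z)) * z ^ s = 1 := by
      rw [Real.rpow_def_of_pos hz, ← Real.exp_add]
      simp [mul_comm]
    have h3 : -1 ≤ s * (z ^ s * Real.log z) := by nlinarith
    rw [neg_le_iff_add_nonneg, ← mul_le_mul_iff_right₀ hs, mul_zero, mul_add,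
      mul_one_div_cancel hs.ne']
    linarith
  rw [choquet_lt_top_iff (c := 1 / s) fun ω => hbelow _ (abs_nonneg _),
    lintegral_Ioi_rpow_mul_log hs]
  refine iff_of_eq (congrArg (· < ⊤) ?_)
  refine setLIntegral_congr_fun measurableSet_Ioi fun z hz => ?_
  have hz1 : (1 : ℝ) < z := hz
  -- The function is increasing only from 1 on, but below 1 it is nonpositive and so cannot reach a
  -- positive level.
  have hset : {ω | z ^ s * Real.log z < |X₀ ω| ^ s * Real.log |X₀ ω|} = {ω | z < |X₀ ω|} := by
    ext ω
    simp only [mem_ofPred_eq]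
    rcases lt_or_ge |X₀ ω| 1 with h | h
    · have h1 : |X₀ ω| ^ s * Real.log |X₀ ω| ≤ 0 :=
        mul_nonpos_of_nonneg_of_nonpos (by positivity)
          (Real.log_nonpos (abs_nonneg _) h.le)
      have h2 : 0 < z ^ s * Real.log z := mul_pos (by positivity) (Real.log_pos hz1)
      constructor <;> intro h3 <;> linarith
    · exact (strictMonoOn_rpow_mul_log hs).lt_iff_lt (show z ∈ Ici 1 from hz1.le) h
  simp only [hset]

/-- The three moment conditions in terms of the weighted tail integral. -/
theorem moment_conditions_iff (hX₀ : X₀ ∈ S.H) {p s : ℝ} (hp : 0 < p) (hs : 0 < s) :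
    ((p > s → S.choquet (fun ω => |X₀ ω| ^ p) < ⊤) ∧
     (p = s → S.choquet (fun ω => |X₀ ω| ^ s * Real.log |X₀ ω|) < ⊤) ∧
     (p < s → S.choquet (fun ω => |X₀ ω| ^ s) < ⊤)) ↔
    tailMoment p (s - p) (fun v => S.V {ω | v < |X₀ ω|}) < ⊤ := by
  have hG1 : ∀ v : ℝ, S.V {ω | v < |X₀ ω|} ≤ 1 := fun v => V_le_one (measurableSet_lt_abs hX₀ v)
  rcases lt_trichotomy p s with h | h | h
  · simp only [not_lt.2 h.le, h.ne, h, false_imp_iff, true_imp_iff, true_and]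
    rw [choquet_rpow_lt_top_iff hs, lintegral_Ioi_zero_lt_top_iff hG1 hs zero_le_one]
    refine iff_of_eq (congrArg (· < ⊤) ?_)
    refine setLIntegral_congr_fun measurableSet_Ioi fun z hz => ?_
    have hz0 : (0 : ℝ) < z := lt_trans one_pos hz
    have h1 : ¬ s - p < 0 := by linarith
    have h2 : ¬ s - p = 0 := by intro h'; linarith
    simp only [momentWeight, h1, h2, if_false]
    rw [← Real.rpow_add hz0]
    congr 3
    ring
  · subst h
    simp only [lt_irrefl, false_imp_iff, true_imp_iff, true_and, and_true, sub_self]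
    rw [choquet_rpow_mul_log_lt_top_iff hp]
    unfold tailMoment
    constructor
    · refine lintegral_lt_top_of_le_const_mul measurableSet_Ioi (C := 1 + 1 / p) fun z hz => ?_
      have hz0 : (0 : ℝ) < z := lt_trans one_pos hz
      have hl := Real.log_pos hz
      rw [← mul_assoc, ← ENNReal.ofReal_mul (by positivity)]
      refine mul_le_mul' (ENNReal.ofReal_le_ofReal ?_) le_rfl
      simp only [momentWeight, lt_irrefl, if_false, if_true]
      have h1 : 1 + Real.log z ≤ (1 + 1 / p) * (1 + p * Real.log z) := by
        have h2 : (1 + 1 / p) * (1 + p * Real.log z) =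
            1 + Real.log z + 1 / p + p * Real.log z := by field_simp; ring
        rw [h2]
        have : 0 < 1 / p + p * Real.log z := by positivity
        linarith
      calc z ^ (p - 1) * (1 + Real.log z)
          ≤ z ^ (p - 1) * ((1 + 1 / p) * (1 + p * Real.log z)) := by gcongr
        _ = _ := by ring
    · refine lintegral_lt_top_of_le_const_mul measurableSet_Ioi (C := 1 + p) fun z hz => ?_
      have hz0 : (0 : ℝ) < z := lt_trans one_pos hz
      have hl := Real.log_pos hz
      rw [← mul_assoc, ← ENNReal.ofReal_mul (by positivity)]
      refine mul_le_mul' (ENNReal.ofReal_le_ofReal ?_) le_rfl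
      simp only [momentWeight, lt_irrefl, if_false, if_true]
      have h1 : 1 + p * Real.log z ≤ (1 + p) * (1 + Real.log z) := by nlinarith
      calc z ^ (p - 1) * (1 + p * Real.log z)
          ≤ z ^ (p - 1) * ((1 + p) * (1 + Real.log z)) := by gcongr
        _ = _ := by ring
  · simp only [not_lt.2 h.le, gt_iff_lt, h.ne', h, false_imp_iff, true_imp_iff, and_true]
    rw [choquet_rpow_lt_top_iff hp, lintegral_Ioi_zero_lt_top_iff hG1 hp zero_le_one]
    have h1 : s - p < 0 := by linarith
    simp only [tailMoment, momentWeight, h1, if_true, mul_one]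

theorem choquet_maxPartialSumPow_toENNReal (a : ℕ → ℕ → ℝ) {p ε : ℝ} (hp : 0 < p) (hε : 0 ≤ ε)
    (n : ℕ+) :
    (S.choquet (fun ω => max (maxPartialSumPow a X p n ω - ε) 0)).toENNReal =
      ∫⁻ u in Ioi (ε ^ (1 / p)), ENNReal.ofReal (p * u ^ (p - 1)) *
        S.V {ω | ∃ k, 1 ≤ k ∧ k ≤ (n : ℕ) ∧ u < |∑ i ∈ Finset.Icc 1 k, a n i * X i ω|} := by
  rw [choquet_toENNReal fun ω => le_max_right _ _, lintegral_Ioi_rpow_sub hp hε]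
  refine setLIntegral_congr_fun measurableSet_Ioi fun u hu => ?_
  have hδ : 0 ≤ ε ^ (1 / p) := Real.rpow_nonneg hε _
  have hu0 : 0 < u := lt_of_le_of_lt hδ hu
  have hup : ε < u ^ p := by
    have := Real.rpow_lt_rpow hδ hu hp
    rwa [← Real.rpow_mul hε, one_div_mul_cancel hp.ne', Real.rpow_one] at this
  have hset : {ω | u ^ p - ε < max (maxPartialSumPow a X p n ω - ε) 0} =
      {ω | ∃ k, 1 ≤ k ∧ k ≤ (n : ℕ) ∧ u < |∑ i ∈ Finset.Icc 1 k, a n i * X i ω|} := by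
    ext ω
    simp only [mem_ofPred_eq, lt_max_iff, sub_lt_sub_iff_right, not_lt.2 (sub_nonneg.2 hup.le),
      or_false]
    refine (Finset.lt_sup'_iff _).trans ?_
    simp only [Finset.mem_Icc, and_assoc, Real.rpow_lt_rpow_iff hu0.le (abs_nonneg _) hp]
  rw [hset]

/-- A crude bound, by the union of the summands, making each single Choquet expectation finite. -/
theorem lintegral_partialSum_lt_top (hX : ∀ n, 1 ≤ n → X n ∈ S.H) (hX₀ : X₀ ∈ S.H)
    (hident : ∀ n, 1 ≤ n → S.IdentDistrib (X n) X₀) {p δ : ℝ} (hp : 0 < p) (hδ : 0 < δ)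
    (hfin : ∫⁻ z in Ioi (0 : ℝ), ENNReal.ofReal (z ^ (p - 1)) * S.V {ω | z < |X₀ ω|} < ⊤)
    (w : ℕ → ℝ) {n : ℕ} (hn : 1 ≤ n) :
    ∫⁻ u in Ioi δ, ENNReal.ofReal (p * u ^ (p - 1)) *
      S.V {ω | ∃ k, 1 ≤ k ∧ k ≤ n ∧ u < |∑ i ∈ Finset.Icc 1 k, w i * X i ω|} < ⊤ := by
  have hn0 : (0 : ℝ) < n := by exact_mod_cast hn
  have hanti := antitone_V_lt_abs hX₀
  -- If a partial sum exceeds u, some summand exceeds u / n. The added 1 avoids dividing by a zero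
  -- weight, and the factor δ fits `lintegral_Ioi_rpow_scale`.
  have hb : ∀ i, 0 < n * (|w i| + 1) / δ := fun i => by positivity
  have hbound : ∀ u ∈ Ioi δ, ENNReal.ofReal (p * u ^ (p - 1)) *
      S.V {ω | ∃ k, 1 ≤ k ∧ k ≤ n ∧ u < |∑ i ∈ Finset.Icc 1 k, w i * X i ω|} ≤
      ∑ i ∈ Finset.Icc 1 n, ENNReal.ofReal (p * u ^ (p - 1)) *
        S.V {ω | u / (δ * (n * (|w i| + 1) / δ)) < |X₀ ω|} := by
    intro u hu
    have hu0 : 0 < u := hδ.trans hu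
    rw [← Finset.mul_sum]
    refine mul_le_mul' le_rfl ?_
    have hmX : ∀ i ∈ Finset.Icc 1 n,
        MeasurableSet {ω | u / (δ * (n * (|w i| + 1) / δ)) < |X i ω|} := fun i hi =>
      measurableSet_lt_abs (hX i (Finset.mem_Icc.1 hi).1) _
    refine (V_mono (measurableSet_lt_abs_partialSum hX w n u)
      (Finset.measurableSet_biUnion _ hmX) ?_).trans
      ((V_biUnion_le _ hmX).trans (Finset.sum_le_sum fun i hi => ?_))
    · rintro ω ⟨k, hk1, hkn, hk⟩
      by_contra hcon
      simp only [mem_iUnion, not_exists, mem_ofPred_eq, not_lt] at hcon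
      have hsum : |∑ i ∈ Finset.Icc 1 k, w i * X i ω| ≤ ∑ i ∈ Finset.Icc 1 k, u / n := by
        refine (Finset.abs_sum_le_sum_abs _ _).trans (Finset.sum_le_sum fun i hi => ?_)
        rw [Finset.mem_Icc] at hi
        have h1 := hcon i (Finset.mem_Icc.2 ⟨hi.1, hi.2.trans hkn⟩)
        rw [abs_mul]
        calc |w i| * |X i ω| ≤ (|w i| + 1) * (u / (δ * (n * (|w i| + 1) / δ))) := by
              gcongr; linarith
          _ = u / n := by
              have : 0 < |w i| + 1 := by positivity
              field_simp
      rw [Finset.sum_const, Nat.card_Icc, Nat.add_sub_cancel, nsmul_eq_mul] at hsum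
      have hkn' : (k : ℝ) ≤ n := by exact_mod_cast hkn
      have : (k : ℝ) * (u / n) ≤ n * (u / n) := by gcongr
      rw [mul_div_cancel₀ _ hn0.ne'] at this
      linarith
    · have hi1 := (Finset.mem_Icc.1 hi).1
      exact ((hident i hi1).V_lt_abs (hX i hi1) hX₀ _).le
  refine (setLIntegral_mono' measurableSet_Ioi hbound).trans_lt ?_
  rw [lintegral_finsetSum]
  · refine ENNReal.sum_lt_top.2 fun i _ => ?_
    rw [lintegral_Ioi_rpow_scale hp hδ (hb i) (fun v => S.V {ω | v < |X₀ ω|})]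
    refine ENNReal.mul_lt_top ENNReal.ofReal_lt_top (ENNReal.mul_lt_top ENNReal.ofReal_lt_top ?_)
    exact (lintegral_mono_set (Ioi_subset_Ioi (by have := hb i; positivity))).trans_lt hfin
  · intro i _
    refine Measurable.mul ?_ (hanti.measurable.comp (measurable_id.div_const _))
    exact ((measurable_id.pow_const _).const_mul p).ennreal_ofReal

/-! ### The two implications -/

/-- Convergence of the series of Choquet expectations under the moment condition. -/
theorem tsum_choquet_lt_top_of_tailMoment (hX₀ : X₀ ∈ S.H) (hX : ∀ n, 1 ≤ n → X n ∈ S.H)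
    (hindep : S.IndepSeq X) (hident : ∀ n, 1 ≤ n → S.IdentDistrib (X n) X₀) {r q β p : ℝ}
    (hr : 1 < r) (hq : 1 / 2 < q) (hβ₁ : -q < β) (hβ₂ : β < -q / r) (hp : 0 < p)
    (hmean : q ≤ 1 → S.E X₀ = 0 ∧ S.E (fun ω => -X₀ ω) = 0) {a : ℕ → ℕ → ℝ} {C : ℝ} (hC : 0 < C)
    {N : ℕ} (ha : ∀ n, N ≤ n → ∀ i, 1 ≤ i → i ≤ n →
      |a n i| ≤ C * ((i : ℝ) ^ β * (n : ℝ) ^ (-(q + β))))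
    (hT : tailMoment p ((r - 1) / (q + β) - p) (fun v => S.V {ω | v < |X₀ ω|}) < ⊤)
    {ε : ℝ} (hε : 0 < ε) :
    ∑' n : ℕ+, ENNReal.ofReal ((n : ℝ) ^ (r - 2)) *
      (S.choquet (fun ω => max (maxPartialSumPow a X p n ω - ε) 0)).toENNReal < ⊤ := by
  have hα : 0 < q + β := by linarith
  have hq0 : 0 < q := by linarith
  have hr0 : 0 < r := by linarith
  set s := (r - 1) / (q + β) with hs_def
  have hs0 : 0 < s := div_pos (by linarith) hα
  have hβ0 : β < 0 := hβ₂.trans (div_neg_of_neg_of_pos (by linarith) hr0)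
  have hqs : 1 < q * s := by
    rw [hs_def, mul_div_assoc', lt_div_iff₀ hα]
    have h1 : β * r < -q := by rwa [lt_div_iff₀ hr0] at hβ₂
    nlinarith
  have hsq : 1 / q < s := by rwa [div_lt_iff₀' hq0]
  have hanti := antitone_V_lt_abs hX₀
  have hG1 : ∀ v : ℝ, S.V {ω | v < |X₀ ω|} ≤ 1 := fun v => V_le_one (measurableSet_lt_abs hX₀ v)
  have hpfin := lintegral_rpow_lt_top_of_tailMoment hG1 hp hT
  have hsfin : ∫⁻ z in Ioi (0 : ℝ), ENNReal.ofReal (z ^ (s - 1)) * S.V {ω | z < |X₀ ω|} < ⊤ := by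
    rw [lintegral_Ioi_zero_lt_top_iff hG1 hs0 zero_le_one]
    refine (setLIntegral_mono' measurableSet_Ioi fun z hz => ?_).trans_lt hT
    have hz1 : (1 : ℝ) < z := hz
    have hz0 : (0 : ℝ) < z := lt_trans one_pos hz
    refine mul_le_mul' (ENNReal.ofReal_le_ofReal ?_) le_rfl
    rcases lt_or_ge 0 (s - p) with h | h
    · simp only [momentWeight, not_lt.2 h.le, h.ne', if_false]
      rw [← Real.rpow_add hz0]
      apply le_of_eq
      congr 1
      ring
    · calc z ^ (s - 1) ≤ z ^ (p - 1) := Real.rpow_le_rpow_of_exponent_le hz1.le (by linarith)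
        _ ≤ _ := le_mul_of_one_le_right (by positivity) (one_le_momentWeight hz1.le)
  -- An exponent above 1 / q that avoids 1. If q ≤ 1 it lies in (1, 2) and needs the centering; if q
  -- > 1 it can be taken below 1.
  obtain ⟨m, hm1, hms, hmcase⟩ : ∃ m : ℝ, 1 / q < m ∧ m ≤ s ∧
      (m < 1 ∨ (1 < m ∧ m < 2 ∧ S.E X₀ ≤ 0 ∧ S.E (fun ω => -X₀ ω) ≤ 0)) := by
    rcases le_or_gt q 1 with hq1 | hq1
    · have h1 : 1 ≤ 1 / q := (one_le_div hq0).2 hq1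
      have h2 : 1 / q < 2 := by rw [div_lt_iff₀ hq0]; linarith
      obtain ⟨m, hm1, hm2⟩ := exists_between (lt_min h2 hsq)
      obtain ⟨e1, e2⟩ := hmean hq1
      exact ⟨m, hm1, (lt_min_iff.1 hm2).2.le,
        Or.inr ⟨h1.trans_lt hm1, (lt_min_iff.1 hm2).1, e1.le, e2.le⟩⟩
    · have h2 : 1 / q < 1 := by rw [div_lt_iff₀ hq0]; linarith
      obtain ⟨m, hm1, hm2⟩ := exists_between (lt_min h2 hsq)
      exact ⟨m, hm1, (lt_min_iff.1 hm2).2.le, Or.inl (lt_min_iff.1 hm2).1⟩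
  have hm0 : 0 < m := lt_trans (by positivity) hm1
  have hqm : 1 < q * m := by rwa [div_lt_iff₀' hq0] at hm1
  have h2m : 0 < 2 - m := by rcases hmcase with h | ⟨-, h, -⟩ <;> linarith
  obtain ⟨A, hA, htail⟩ := exists_tail_le_rpow hanti hG1 hs0 hm0 hms hsfin
  obtain ⟨C₁, γ, hC₁, hγ, hwsum⟩ := exists_sum_weight_rpow_le hα hm0 hqm
  set δ := ε ^ (1 / p) with hδ_def
  have hδ : 0 < δ := Real.rpow_pos_of_pos hε _
  -- The two inequalities make the remainder integrable in u and summable in n; K = 4 κ turns K / 4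
  -- into κ.
  obtain ⟨κ, hκ1, hκ2, hκ0⟩ : ∃ κ : ℝ, p < m * κ ∧ r - 1 < γ * κ ∧ 0 < κ := by
    refine ⟨p / m + (r - 1) / γ + 1, ?_, ?_, ?_⟩
    · have h1 : m * (p / m + (r - 1) / γ + 1) = p + m * ((r - 1) / γ) + m := by field_simp
      have h2 : 0 < m * ((r - 1) / γ) := mul_pos hm0 (div_pos (by linarith) hγ)
      linarith
    · have h1 : γ * (p / m + (r - 1) / γ + 1) = γ * (p / m) + (r - 1) + γ := by field_simp
      have h2 : 0 < γ * (p / m) := by positivity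
      linarith
    · have : 0 < (r - 1) / γ := div_pos (by linarith) hγ
      positivity
  set K := 4 * κ with hK_def
  have hK : 0 < K := by positivity
  set L := (1 / |1 - m| + 2 / (2 - m)) * A with hL_def
  have hL : 0 ≤ L := by positivity
  -- The added 1 keeps Λ positive even when A = 0.
  set c := (L * K ^ m * C ^ m * C₁ + 1) with hc_def
  have hc : 0 < c := by positivity
  have hcη : 0 < δ / (K * C) := by positivity
  have hfirst := tsum_kernel_lt_top hanti hG1 hr hβ₁ hβ₂ hq0 hp hT hδ hcη
  have hsecond := tsum_remainder_lt_top (r := r) (p := p) (δ := δ) (m := m) (γ := γ) (κ := κ)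
    (c := c) (D := 2 * Real.exp (K + 1)) hδ hp hc.le (by positivity) hκ1 hκ2
  have hboth := ENNReal.add_lt_top.2 ⟨hfirst, hsecond⟩
  rw [← ENNReal.tsum_add] at hboth
  simp only [choquet_maxPartialSumPow_toENNReal a hp hε.le]
  -- The array is uncontrolled for n < N, so those terms are only shown to be finite.
  refine tsum_pnat_lt_top_of_le (N := N) (fun n => ?_) (fun n hn => ?_) hboth
  · exact ENNReal.mul_lt_top ENNReal.ofReal_lt_top
      (lintegral_partialSum_lt_top hX hX₀ hident hp hδ hpfin (a n) n.pos)
  have hn0 : (0 : ℝ) < n := by exact_mod_cast n.pos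
  rw [← mul_add]
  refine mul_le_mul' le_rfl ?_
  have hmeasG : ∀ i : ℕ, Measurable fun u : ℝ => ENNReal.ofReal (p * u ^ (p - 1)) *
      S.V {ω | δ / (K * C) * (u / (δ * ((i : ℝ) ^ β * (n : ℝ) ^ (-(q + β))))) < |X₀ ω|} := fun i =>
    Measurable.mul ((measurable_id.pow_const _).const_mul p).ennreal_ofReal
      (hanti.measurable.comp ((measurable_id.div_const _).const_mul _))
  rw [← lintegral_finsetSum _ fun i _ => hmeasG i,
    ← lintegral_add_left (Finset.measurable_sum _ fun i _ => hmeasG i)]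
  refine setLIntegral_mono' measurableSet_Ioi fun u hu => ?_
  have hu0 : 0 < u := hδ.trans hu
  rw [← Finset.mul_sum, ← mul_add]
  refine mul_le_mul' le_rfl ?_
  have hΛ0 : 0 < c * (n : ℝ) ^ (-γ) * u ^ (-m) := by positivity
  have key := hindep.V_lt_abs_partialSum_le hX hX₀ hident hA hmcase htail hK hu0 (a n) n.pos hΛ0 ?_
  · refine key.trans (add_le_add (Finset.sum_le_sum fun i hi => ?_) (le_of_eq ?_))
    · rw [Finset.mem_Icc] at hi
      have hb0 := (weight_pos_le_one hα hβ0 hi.1 n.pos).1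
      have hai := ha n hn i hi.1 hi.2
      set b := (i : ℝ) ^ β * (n : ℝ) ^ (-(q + β)) with hb_def
      refine V_mono (measurableSet_lt_abs (smul_mem hX₀ (a n i)) _) (measurableSet_lt_abs hX₀ _) ?_
      intro ω hω
      simp only [mem_ofPred_eq, abs_mul] at hω ⊢
      have h1 : u / K < C * b * |X₀ ω| :=
        hω.trans_le (mul_le_mul_of_nonneg_right hai (abs_nonneg _))
      have h2 : δ / (K * C) * (u / (δ * b)) = u / K / (C * b) := by field_simp
      rw [h2, div_lt_iff₀' (by positivity)]
      exact h1
    · rw [hK_def]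
      congr 3
      ring
  · have hsum : ∑ i ∈ Finset.Icc 1 (n : ℕ), |a n i| ^ m ≤ C ^ m * (C₁ * (n : ℝ) ^ (-γ)) := by
      calc ∑ i ∈ Finset.Icc 1 (n : ℕ), |a n i| ^ m
          ≤ ∑ i ∈ Finset.Icc 1 (n : ℕ),
              C ^ m * ((i : ℝ) ^ β * (n : ℝ) ^ (-(q + β))) ^ m := by
            refine Finset.sum_le_sum fun i hi => ?_
            rw [Finset.mem_Icc] at hi
            have hb0 := (weight_pos_le_one hα hβ0 hi.1 n.pos).1
            rw [← Real.mul_rpow hC.le hb0.le]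
            exact Real.rpow_le_rpow (abs_nonneg _) (ha n hn i hi.1 hi.2) hm0.le
        _ ≤ _ := by
            rw [← Finset.mul_sum]
            gcongr
            exact hwsum n n.pos
    have huK : (u / K) ^ (-m) = K ^ m * u ^ (-m) := by
      rw [Real.div_rpow hu0.le hK.le, Real.rpow_neg hK.le]
      field_simp
    calc L * (u / K) ^ (-m) * ∑ i ∈ Finset.Icc 1 (n : ℕ), |a n i| ^ m
        ≤ L * (u / K) ^ (-m) * (C ^ m * (C₁ * (n : ℝ) ^ (-γ))) := by gcongr
      _ = (L * K ^ m * C ^ m * C₁) * (n : ℝ) ^ (-γ) * u ^ (-m) := by rw [huK]; ring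
      _ ≤ c * (n : ℝ) ^ (-γ) * u ^ (-m) := by
          gcongr
          rw [hc_def]
          linarith

/-- Necessity of the moment condition; only the first summand of each partial sum is used. -/
theorem tailMoment_lt_top_of_tsum_choquet (hX₀ : X₀ ∈ S.H) (hX : ∀ n, 1 ≤ n → X n ∈ S.H)
    (hident : ∀ n, 1 ≤ n → S.IdentDistrib (X n) X₀) {r α p : ℝ} (hα : 0 < α) (hp : 0 < p)
    {a : ℕ → ℕ → ℝ} {C : ℝ} (hC : 0 < C) {N : ℕ}
    (ha : ∀ n : ℕ, N ≤ n → 1 ≤ n → (n : ℝ) ^ (-α) ≤ C * a n 1)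
    (h : ∀ ε : ℝ, 0 < ε → ∑' n : ℕ+, ENNReal.ofReal ((n : ℝ) ^ (r - 2)) *
      (S.choquet (fun ω => max (maxPartialSumPow a X p n ω - ε) 0)).toENNReal < ⊤) :
    tailMoment p ((r - 1) / α - p) (fun v => S.V {ω | v < |X₀ ω|}) < ⊤ := by
  have hG1 : ∀ v : ℝ, S.V {ω | v < |X₀ ω|} ≤ 1 := fun v => V_le_one (measurableSet_lt_abs hX₀ v)
  have hδ : 0 < 1 / C := by positivity
  -- A single value of ε suffices; this one makes ε ^ (1 / p) = 1 / C, the constant in the lower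
  -- bound for a_{n1}.
  have hε : 0 < (1 / C) ^ p := by positivity
  have hδε : ((1 / C) ^ p) ^ (1 / p) = 1 / C := by
    rw [← Real.rpow_mul hδ.le, mul_one_div_cancel hp.ne', Real.rpow_one]
  refine tailMoment_lt_top_of_tsum (antitone_V_lt_abs hX₀) hG1 hα hp hδ N
    (lt_of_le_of_lt (ENNReal.tsum_le_tsum fun n => ?_) (h _ hε))
  split_ifs with hn
  · rw [choquet_maxPartialSumPow_toENNReal a hp hε.le, hδε]
    refine mul_le_mul' le_rfl (setLIntegral_mono' measurableSet_Ioi fun u hu => ?_)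
    have hu0 : 0 < u := hδ.trans hu
    have hn0 : (0 : ℝ) < n := by exact_mod_cast n.pos
    have hb : 0 < (n : ℝ) ^ (-α) := Real.rpow_pos_of_pos hn0 _
    have han := ha n hn n.pos
    have ha0 : 0 < a n 1 := pos_of_mul_pos_right (hb.trans_le han) hC.le
    refine mul_le_mul' le_rfl ?_
    rw [← (hident 1 le_rfl).V_lt_abs (hX 1 le_rfl) hX₀]
    refine V_mono (measurableSet_lt_abs (hX 1 le_rfl) _)
      (measurableSet_lt_abs_partialSum hX (a n) n u) fun ω hω => ⟨1, le_rfl, n.pos, ?_⟩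
    simp only [mem_ofPred_eq] at hω
    rw [Finset.Icc_self, Finset.sum_singleton, abs_mul, abs_of_pos ha0]
    rw [div_lt_iff₀ (by positivity)] at hω
    refine hω.trans_le ?_
    rw [mul_comm]
    refine mul_le_mul_of_nonneg_right ?_ (abs_nonneg _)
    rw [one_div_mul_eq_div, div_le_iff₀' hC]
    exact han
  · exact zero_le

end SublinearExpectationSpace

theorem div_rpow_mul_one_div_rpow {i n q β : ℝ} (hi : 0 ≤ i) (hn : 0 < n) :
    (i / n) ^ β * (1 / n ^ q) = i ^ β * n ^ (-(q + β)) := by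
  rw [Real.div_rpow hi hn.le, neg_add, Real.rpow_add hn, Real.rpow_neg hn.le, Real.rpow_neg hn.le]
  field_simp

end

theorem theorem3 {Ω : Type*} [MeasurableSpace Ω] (S : SublinearExpectationSpace Ω)
    (X₀ : Ω → ℝ) (hX₀ : X₀ ∈ S.H)
    (X : ℕ → Ω → ℝ) (hX : ∀ n, 1 ≤ n → X n ∈ S.H)
    (hindep : S.IndepSeq X)
    (hident : ∀ n, 1 ≤ n → S.IdentDistrib (X n) X₀)
    (r q β p : ℝ) (hr : 1 < r) (hq : 1 / 2 < q) (hβ₁ : -q < β) (hβ₂ : β < -q / r) (hp : 0 < p)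
    (hmean : q ≤ 1 → S.E X₀ = 0 ∧ -S.E (fun ω => -X₀ ω) = 0)
    (a : ℕ → ℕ → ℝ)
    (ha : ArrayApprox a (fun n i => ((i : ℝ) / (n : ℝ)) ^ β * (1 / (n : ℝ) ^ q))) :
    (∀ ε : ℝ, 0 < ε →
      ∑' n : ℕ+, ENNReal.ofReal ((n : ℝ) ^ (r - 2)) *
        (S.choquet (fun ω => max (maxPartialSumPow a X p n ω - ε) 0)).toENNReal < ⊤) ↔
    ((p > (r - 1) / (q + β) → S.choquet (fun ω => |X₀ ω| ^ p) < ⊤) ∧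
     (p = (r - 1) / (q + β) →
        S.choquet (fun ω => |X₀ ω| ^ ((r - 1) / (q + β)) * Real.log |X₀ ω|) < ⊤) ∧
     (p < (r - 1) / (q + β) → S.choquet (fun ω => |X₀ ω| ^ ((r - 1) / (q + β))) < ⊤)) := by
  have hα : 0 < q + β := by linarith
  have hs : 0 < (r - 1) / (q + β) := div_pos (by linarith) hα
  rw [SublinearExpectationSpace.moment_conditions_iff hX₀ hp hs]
  obtain ⟨⟨C, hC, N, hCN⟩, ⟨C', hC', N', hCN'⟩⟩ := ha
  have hb : ∀ n i : ℕ, 1 ≤ i → i ≤ n → ((i : ℝ) / (n : ℝ)) ^ β * (1 / (n : ℝ) ^ q) =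
      (i : ℝ) ^ β * (n : ℝ) ^ (-(q + β)) := fun n i h1 h2 =>
    div_rpow_mul_one_div_rpow (by positivity) (by exact_mod_cast (lt_of_lt_of_le h1 h2))
  constructor
  · refine SublinearExpectationSpace.tailMoment_lt_top_of_tsum_choquet hX₀ hX hident hα hp hC'
      (N := N') fun n hn h1 => ?_
    have := hCN' n hn 1 le_rfl h1
    beta_reduce at this
    rw [hb n 1 le_rfl h1] at this
    simpa using this
  · intro hT ε hε
    refine SublinearExpectationSpace.tsum_choquet_lt_top_of_tailMoment hX₀ hX hindep hident hr hq
      hβ₁ hβ₂ hp (fun h => ⟨(hmean h).1, EReal.neg_eq_zero_iff.1 (hmean h).2⟩) hC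
      (N := max N N') (fun n hn i h1 h2 => ?_) hT hε
    have e1 := hCN n ((le_max_left _ _).trans hn) i h1 h2
    have e2 := hCN' n ((le_max_right _ _).trans hn) i h1 h2
    beta_reduce at e1 e2
    rw [hb n i h1 h2] at e1 e2
    have hn0 : (0 : ℝ) < n := by exact_mod_cast lt_of_lt_of_le h1 h2
    have hi0 : (0 : ℝ) < i := by exact_mod_cast h1
    -- The lower comparison forces the weights to be positive, so the upper one bounds their
    -- absolute values.
    have hpos : 0 < C' * a n i := lt_of_lt_of_le (by positivity) e2
    rw [abs_of_pos (pos_of_mul_pos_right hpos hC'.le)]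
    exact e1
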